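/- **Objects.** A binary tree is either a leaf or a node with a left and a right subtree; its size is its number of nodes. For binary trees $T,T'$ of size $n$ write $T\le T'$ (Tamari order) if $T'$ is obtained from $T$ by a sequence of right rotations, each replacing a subtree $((T_A,T_B),T_C)$ by $(T_A,(T_B,T_C))$. A *Tamari interval* of size $n$ is a pair $(T,T')$ of binary trees of size $n$ with $T\le T'$; let $\mathcal I_n$ be the set of these. Let $\operatorname{mir}(T)$ be the left-right mirror image of $T$. A *diagram-drawing* of size $n$ is a non-crossing set of arcs in the upper half-plane on the points $0,\frac12,1,\dots,n-\frac12,n$ of the $x$-axis (integral points are black, the others white), each arc having a black left end and a white right end, and each white point being incident to exactly one arc. A *meandering diagram* of size $n$ is the superimposition of a diagram-drawing of size $n$ (upper arcs) and of the half-turn of a diagram-drawing of size $n$ (lower arcs, each with a white left end and a black right end). Its underlying graph has the black points as vertices and one edge for every white point, joining the black ends of the upper and the lower arc at this point. It is a *meandering tree* if this graph is a tree; let $\mathcal{MT}_n$ be the set of meandering trees of size $n$. A *bicolored blossoming tree* of size $n\ge 1$ is an unrooted plane tree with $n+1$ nodes and $n$ edges between nodes (plain edges), in which every node carries in addition exactly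 two buds (dangling edges), together with a colouring of the halves of the plain edges in red and blue, such that the two halves of every plain edge have different colours and such that, at each node, the two buds separate the half-edges into a group of blue ones and a group of red ones (a group may be empty). Such trees are considered up to orientation- and colour-preserving isomorphism; let $\mathcal B_n$ be the set of them. **Maps.** * $\phi$: place the leaves of a binary tree $T$ of size $n$, from left to right, at $0,\dots,n$, and represent each node by an arc (a semi-circle in the upper half-plane) from the leftmost to the rightmost leaf below it; this is the smooth drawing of $T$. The diagram-drawing $\hat T$ of $T$ has, for each $t\in\{1,\dots,n\}$, an arc between the white point $t-\frac12$ and the left end of the deepest arc of the smooth drawing above $[t-1,t]$. For a pair $(T,T')$ of binary trees of size $n$, $\phi(T,T')$ has the arcs of $\widehat{T'}$ as upper arcs, and the half-turn of those of $\widehat{\operatorname{mir}(T)}$ as lower arcs. * $\psi$: given a diagram-drawing of size $n$, replace each arc from a black point $b$ to a white point $w$ by an arc from $b$ to the rightmost black point that can be reached from $w$ in the upper half-plane without crossing an arc; the result is the smooth drawing of a binary tree of size $n$. Then $\psi(M)=(T,T')$, where $T'$ is obtained in this way from the upper arcs of $M$, and $\operatorname{mir}(T)$ from the half-turn of its lower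 arcs. * $\gamma$: given $M\in\mathcal{MT}_n$, add at each black point a bud to the left and a bud to the right along the $x$-axis, and turn the upper (resp. lower) arcs into blue (resp. red) half-edges, the two arcs at a white point forming a plain edge. * $\delta$: given $B\in\mathcal B_n$, insert in the middle of each plain edge an edge-vertex carrying two legs, one on each side of the edge. Going around the tree counterclockwise, match buds (opening parentheses) and legs (closing parentheses) in a planar way, according to the resulting cyclic parenthesis word, leaving two buds unmatched. The $2n$ matched pairs form a path through the $n+1$ nodes and the $n$ edge-vertices. Stretch this path into the horizontal segment from $0$ to $n$, with $2n+1$ equally spaced vertices, in the direction for which the blue half-edges lie above and the red half-edges below. Then $\delta(B)$ is the arc-diagram formed by the blue and the red half-edges. **Theorem.** Let $n\ge 1$. The maps $\phi:\mathcal I_n\to\mathcal{MT}_n$, $\gamma:\mathcal{MT}_n\to\mathcal B_n$, $\delta:\mathcal B_n\to\mathcal{MT}_n$ and $\psi:\mathcal{MT}_n\to\mathcal I_n$ are well defined (each sends the first set into the second), the map $\Phi=\gamma\circ\phi$ is a bijection from $\mathcal I_n$ to $\mathcal B_n$, and its inverse is $\psi\circ\delta$. -/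

import Mathlib

namespace TamariBlossom

open Classical in
/-- The element with property `P`, if there is one, and the default value `d` otherwise. -/
noncomputable def pick {α : Type*} (d : α) (P : α → Prop) : α :=
  if h : ∃ x, P x then h.choose else d

/-! ### Binary trees and Tamari intervals -/

/-- Binary trees: a leaf is `.nil`, a binary node with subtrees `L`, `R` is `.node () L R`.
The size is `BinaryTree.numNodes`, the number of binary nodes. -/
abbrev BinTree : Type := BinaryTree Unit

/-- `RightRotation T T'`: the tree `T'` is obtained from `T` by replacing one subtree
`((A, B), C)` by `(A, (B, C))`. -/
inductive RightRotation : BinTree → BinTree → Prop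
  | root (A B C : BinTree) :
      RightRotation (.node () (.node () A B) C) (.node () A (.node () B C))
  | left {L L' : BinTree} (R : BinTree) (h : RightRotation L L') :
      RightRotation (.node () L R) (.node () L' R)
  | right (L : BinTree) {R R' : BinTree} (h : RightRotation R R') :
      RightRotation (.node () L R) (.node () L R')

/-- The Tamari order, the reflexive and transitive closure of right rotation. -/
def TamariLE : BinTree → BinTree → Prop := Relation.ReflTransGen RightRotation

/-- The set of Tamari intervals of size `n`. -/
def tamariIntervals (n : ℕ) : Set (BinTree × BinTree) :=
  {X | X.1.numNodes = n ∧ X.2.numNodes = n ∧ TamariLE X.1 X.2}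

/-- The mirror image of a binary tree, exchanging left and right. -/
def mir : BinTree → BinTree
  | .nil => .nil
  | .node () L R => .node () (mir R) (mir L)

/-! ### Arc-diagrams

An arc in the upper or in the lower half-plane is given by its two ends, the left one first.
The arcs of a smooth drawing join points of integral abscissa, and those abscissas are used as
they are. In (meandering) diagrams of size `n` the points are `0, 1/2, 1, …, n - 1/2, n`, and all
abscissas are doubled: the black points are `0, 2, …, 2 n` and the white points
`1, 3, …, 2 n - 1`. -/

/-- The arcs of the smooth drawing of `T`, whose leaves, from left to right, are placed at
`k, k + 1, …`. Every node gives an arc, from the leftmost to the rightmost leaf below it. -/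
def smoothArcs : BinTree → ℕ → Set (ℕ × ℕ)
  | .nil, _ => ∅
  | .node () L R, k =>
      {(k, k + (L.numNodes + R.numNodes + 1))} ∪
        (smoothArcs L k ∪ smoothArcs R (k + L.numNodes + 1))

/-- `a` is an arc of `S` above the unit segment `[s, s + 1]`. -/
def IsAbove (S : Set (ℕ × ℕ)) (s : ℕ) (a : ℕ × ℕ) : Prop :=
  a ∈ S ∧ a.1 ≤ s ∧ s + 1 ≤ a.2

/-- `a` is the arc of `S` above `[s, s + 1]` that is visible from this segment, i.e. the deepest
one: it lies below every other arc above the segment. -/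
def IsVisible (S : Set (ℕ × ℕ)) (s : ℕ) (a : ℕ × ℕ) : Prop :=
  IsAbove S s a ∧ ∀ b, IsAbove S s b → b.1 ≤ a.1 ∧ a.2 ≤ b.2

/-- The diagram-drawing of `T`: for every unit segment `[s, s + 1]`, an arc from the black point
at the left end of the arc visible from the segment to the white point at the middle of the
segment. -/
def diagramDrawing (T : BinTree) : Set (ℕ × ℕ) :=
  {p | ∃ s a, IsVisible (smoothArcs T 0) s a ∧ p = (2 * a.1, 2 * s + 1)}

/-- The rotation by a half-turn of a set of arcs on the points `0, …, 2 n` (doubled abscissas). -/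
def halfTurn (n : ℕ) (A : Set (ℕ × ℕ)) : Set (ℕ × ℕ) :=
  (fun p => (2 * n - p.2, 2 * n - p.1)) '' A

/-- An arc-diagram: the arcs in the upper half-plane (which are blue) and the arcs in the lower
half-plane (which are red), with doubled abscissas. -/
@[ext]
structure ArcDiagram where
  upper : Set (ℕ × ℕ)
  lower : Set (ℕ × ℕ)

/-- No two of the given arcs, drawn in the same half-plane, cross. -/
def NonCrossing (A : Set (ℕ × ℕ)) : Prop :=
  ∀ p ∈ A, ∀ q ∈ A, ¬ (p.1 < q.1 ∧ q.1 < p.2 ∧ p.2 < q.2)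

/-- The meandering diagrams of size `n`: non-crossing, with upper arcs having a black left end
and a white right end, lower arcs having a white left end and a black right end, and every white
point being incident to exactly one upper arc and exactly one lower arc. -/
structure IsMeanderingDiagram (n : ℕ) (M : ArcDiagram) : Prop where
  upper_lt : ∀ p ∈ M.upper, p.1 < p.2 ∧ p.2 ≤ 2 * n
  lower_lt : ∀ p ∈ M.lower, p.1 < p.2 ∧ p.2 ≤ 2 * n
  upper_color : ∀ p ∈ M.upper, Even p.1 ∧ Odd p.2
  lower_color : ∀ p ∈ M.lower, Odd p.1 ∧ Even p.2
  upper_unique : ∀ s < n, ∃! p, p ∈ M.upper ∧ p.2 = 2 * s + 1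
  lower_unique : ∀ s < n, ∃! p, p ∈ M.lower ∧ p.1 = 2 * s + 1
  upper_nonCrossing : NonCrossing M.upper
  lower_nonCrossing : NonCrossing M.lower

/-- The white point at `w` gives an edge of the underlying graph between the black points at `b`
and `b'`, the black ends of its upper and of its lower arc. -/
def IsEdgeAt (M : ArcDiagram) (w b b' : ℕ) : Prop :=
  (b, w) ∈ M.upper ∧ (w, b') ∈ M.lower

/-- The simple graph on the `n + 1` black points (the `k`-th one being at doubled abscissa `2 k`)
that underlies the underlying graph of `M`. -/
def underlyingGraph (n : ℕ) (M : ArcDiagram) : SimpleGraph (Fin (n + 1)) :=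
  SimpleGraph.fromRel fun i j => ∃ w, IsEdgeAt M w (2 * (i : ℕ)) (2 * (j : ℕ))

/-- The meandering trees of size `n`: meandering diagrams whose underlying graph, with one edge
for each white point, is a tree. (There are no loops, since `b < w < b'` if `IsEdgeAt M w b b'`.) -/
structure IsMeanderingTree (n : ℕ) (M : ArcDiagram) : Prop where
  isMeanderingDiagram : IsMeanderingDiagram n M
  isTree : (underlyingGraph n M).IsTree
  edge_injective : ∀ w w' b b', IsEdgeAt M w b b' → IsEdgeAt M w' b b' → w = w'

/-- The set of meandering trees of size `n`. -/
def meanderingTrees (n : ℕ) : Set ArcDiagram := {M | IsMeanderingTree n M}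

/-- The map `φ`, sending a pair `(T, T')` of binary trees of size `n` to its diagram-drawing: the
diagram-drawing of `T'` in the upper half-plane and the diagram-drawing of the mirror of `T`,
rotated by a half-turn, in the lower half-plane. -/
def phi (n : ℕ) (X : BinTree × BinTree) : ArcDiagram where
  upper := diagramDrawing X.2
  lower := halfTurn n (diagramDrawing (mir X.1))

/-- For a diagram-drawing `A` of size `n`, the right-attachment point of the white point at
(doubled) abscissa `w`: the rightmost black point that can be reached from `w` in the upper
half-plane without crossing an arc. It is the last black point if no arc of `A` covers `w`, and the
black point immediately to the left of the right end of the innermost arc covering `w` otherwise.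
(The result is an undoubled abscissa.) -/
noncomputable def rightAttachment (n : ℕ) (A : Set (ℕ × ℕ)) (w : ℕ) : ℕ :=
  sInf ({n} ∪ {s | ∃ b, (b, 2 * s + 1) ∈ A ∧ b < w ∧ w < 2 * s + 1})

/-- The smooth drawing computed from a diagram-drawing of size `n`, by prolonging every arc to the
right-attachment point of its white end. -/
noncomputable def smoothOfDiagram (n : ℕ) (A : Set (ℕ × ℕ)) : Set (ℕ × ℕ) :=
  {p | ∃ w, (2 * p.1, w) ∈ A ∧ p.2 = rightAttachment n A w}

open Classical in
/-- The binary tree of size `m` with leaves at `i, …, i + m` read off from its smooth drawing `S`: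
the root has wedge `(i, i + m)`, and its left subtree is given by the longest proper arc that
starts at `i` (it is a leaf if there is none). -/
noncomputable def treeOfSmooth (S : Set (ℕ × ℕ)) (i : ℕ) : ℕ → BinTree
  | 0 => .nil
  | m + 1 =>
      .node () (treeOfSmooth S i (Nat.findGreatest (fun k => (i, i + k) ∈ S) m))
        (treeOfSmooth S (i + Nat.findGreatest (fun k => (i, i + k) ∈ S) m + 1)
          (m - Nat.findGreatest (fun k => (i, i + k) ∈ S) m))
  termination_by m => m
  decreasing_by
    · exact Nat.lt_succ_of_le (Nat.findGreatest_le m)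
    · exact Nat.lt_succ_of_le (Nat.sub_le _ _)

/-- The binary tree of size `n` with diagram-drawing `A`. -/
noncomputable def treeOfDiagram (n : ℕ) (A : Set (ℕ × ℕ)) : BinTree :=
  treeOfSmooth (smoothOfDiagram n A) 0 n

/-- The map `ψ`: the upper half-plane part of `M` gives `T'`, and the half-turn of the lower
half-plane part gives the mirror of `T`. -/
noncomputable def psi (n : ℕ) (M : ArcDiagram) : BinTree × BinTree :=
  (mir (treeOfDiagram n (halfTurn n M.lower)), treeOfDiagram n M.upper)

/-! ### Bicolored blossoming trees -/

/-- The kinds of half-edges: buds, and blue and red halves of plain edges. -/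
inductive Kind
  | bud
  | blue
  | red

/-- A combinatorial map with buds: the half-edges at the nodes, the half-edge `next h` that follows
`h` in counterclockwise order around its node, and the opposite half `twin h` of the same edge. A
bud (an edge from a node to a leaf) is a single dangling half-edge, and is its own twin. The laws
are listed in `IsBicoloredBlossomingTree`. -/
structure BudMap where
  HalfEdge : Type
  kind : HalfEdge → Kind
  next : HalfEdge → HalfEdge
  twin : HalfEdge → HalfEdge

namespace BudMap

/-- The nodes: the orbits of `next`. -/
def Node (B : BudMap) : Type := Quot fun h h' : B.HalfEdge => B.next h = h'

/-- The node carrying a half-edge. -/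
def node (B : BudMap) (h : B.HalfEdge) : B.Node := Quot.mk _ h

/-- The halves of the plain edges. -/
def PlainHalf (B : BudMap) : Type := {h : B.HalfEdge // B.kind h ≠ Kind.bud}

/-- The simple graph on the nodes that underlies the graph of plain edges. -/
def graph (B : BudMap) : SimpleGraph B.Node :=
  SimpleGraph.fromRel fun u v =>
    ∃ h : B.PlainHalf, B.node h.1 = u ∧ B.node (B.twin h.1) = v

/-- Turning counterclockwise around a node from `b`, one meets half-edges of kind `c` only
(possibly none) and then `b'`. -/
def Run (B : BudMap) (c : Kind) (b b' : B.HalfEdge) : Prop :=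
  ∃ m, B.next^[m + 1] b = b' ∧ ∀ i < m, B.kind (B.next^[i + 1] b) = c

/-- `b` and `b'` are two distinct buds at the same node that separate its other half-edges into a
blue group, lying counterclockwise from `b` to `b'`, and a red group, lying counterclockwise from
`b'` to `b`. -/
def SplitBuds (B : BudMap) (b b' : B.HalfEdge) : Prop :=
  B.kind b = Kind.bud ∧ B.kind b' = Kind.bud ∧ b ≠ b' ∧
    B.Run Kind.blue b b' ∧ B.Run Kind.red b' b

/-- The bicolored blossoming trees of size `n`. -/
structure IsBicoloredBlossomingTree (n : ℕ) (B : BudMap) : Prop where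
  finite : Finite B.HalfEdge
  next_bijective : Function.Bijective B.next
  twin_twin : ∀ h, B.twin (B.twin h) = h
  /-- buds are dangling half-edges -/
  twin_bud : ∀ h, B.kind h = Kind.bud → B.twin h = h
  /-- no plain edge is monochromatic -/
  twin_blue : ∀ h, B.kind h = Kind.blue → B.kind (B.twin h) = Kind.red
  twin_red : ∀ h, B.kind h = Kind.red → B.kind (B.twin h) = Kind.blue
  /-- the nodes and plain edges form a tree -/
  isTree : B.graph.IsTree
  no_loop : ∀ h, B.kind h ≠ Kind.bud → B.node h ≠ B.node (B.twin h)
  no_multiple_edge : ∀ h h', B.kind h ≠ Kind.bud → B.kind h' ≠ Kind.bud →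
    B.node h = B.node h' → B.node (B.twin h) = B.node (B.twin h') → h = h'
  /-- there are `n` plain edges -/
  card_plain : Nat.card B.PlainHalf = 2 * n
  /-- every node carries exactly two buds -/
  card_buds : ∀ v, {h | B.node h = v ∧ B.kind h = Kind.bud}.ncard = 2
  /-- the two buds separate the half-edges at a node by colour -/
  split : ∀ v, ∃ b b', B.node b = v ∧ B.SplitBuds b b'

/-- An isomorphism of maps, respecting the cyclic orders, the edges, the buds and the colours. -/
structure Iso (A B : BudMap) where
  toEquiv : A.HalfEdge ≃ B.HalfEdge
  kind_eq : ∀ h, B.kind (toEquiv h) = A.kind h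
  next_eq : ∀ h, B.next (toEquiv h) = toEquiv (A.next h)
  twin_eq : ∀ h, B.twin (toEquiv h) = toEquiv (A.twin h)

/-- The inverse isomorphism. -/
def Iso.symm {A B : BudMap} (e : Iso A B) : Iso B A where
  toEquiv := e.toEquiv.symm
  kind_eq h := by rw [← e.kind_eq, Equiv.apply_symm_apply]
  next_eq h := by rw [Equiv.eq_symm_apply, ← e.next_eq, Equiv.apply_symm_apply]
  twin_eq h := by rw [Equiv.eq_symm_apply, ← e.twin_eq, Equiv.apply_symm_apply]

instance setoid : Setoid BudMap where
  r A B := Nonempty (Iso A B)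
  iseqv :=
    { refl := fun _ => ⟨⟨Equiv.refl _, fun _ => rfl, fun _ => rfl, fun _ => rfl⟩⟩
      symm := fun ⟨e⟩ => ⟨e.symm⟩
      trans := fun ⟨e⟩ ⟨f⟩ => ⟨⟨e.toEquiv.trans f.toEquiv,
        fun h => (f.kind_eq _).trans (e.kind_eq h),
        fun h => (f.next_eq _).trans (congrArg f.toEquiv (e.next_eq h)),
        fun h => (f.twin_eq _).trans (congrArg f.toEquiv (e.twin_eq h))⟩⟩ }

/-! #### The closure -/

/-- One step of the counterclockwise contour of the map: follow the right side of `h` from its node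
to its other end, and continue with the next half-edge there. The half-edges met in this way stand
for the letters of the contour word: a bud is an opening parenthesis, and a half `h` of a plain edge
is a closing parenthesis, namely the leg attached to the middle of the edge on the right of `h`. -/
def contour (B : BudMap) (h : B.HalfEdge) : B.HalfEdge := B.next (B.twin h)

/-- The weight of a letter of the contour: `1` for buds and `-1` for legs. -/
def weight : Kind → ℤ
  | Kind.bud => 1
  | Kind.blue => -1
  | Kind.red => -1

/-- The number of buds minus the number of legs among the first `k + 1` letters of the contour
starting at `b`. -/
def height (B : BudMap) (b : B.HalfEdge) (k : ℕ) : ℤ :=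
  ∑ j ∈ Finset.range (k + 1), weight (B.kind (B.contour^[j] b))

/-- The bud `b` is matched with the leg on the right of `h` in the planar matching of buds
(opening parentheses) and legs (closing parentheses) along the cyclic contour. -/
def Matched (B : BudMap) (b h : B.HalfEdge) : Prop :=
  B.kind b = Kind.bud ∧
    ∃ k, B.contour^[k] b = h ∧ B.height b k = 0 ∧ ∀ j < k, 0 < B.height b j

/-- The edge-vertices, in the middle of the plain edges. -/
def EdgeVertex (B : BudMap) : Type := Quot fun h h' : B.PlainHalf => B.twin h.1 = h'.1

/-- The edge-vertex of a plain edge. -/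
def edgeVertex (B : BudMap) (h : B.PlainHalf) : B.EdgeVertex := Quot.mk _ h

/-- The vertices of the closure. -/
abbrev ClosureVertex (B : BudMap) : Type := B.Node ⊕ B.EdgeVertex

/-- The closure-edges, i.e. the matched pairs of buds and legs, oriented as they are traversed by
the meandric path with the blue half-edges on its left: the path leaves a node through the bud `b`
and arrives at a node through the bud `b'`, if the buds `b, b'` of the node have the blue
half-edges between them counterclockwise from `b` to `b'`. -/
inductive ClosureStep (B : BudMap) : B.ClosureVertex → B.ClosureVertex → Prop
  | leave (b b' : B.HalfEdge) (h : B.PlainHalf) (hb : B.SplitBuds b b') (hm : B.Matched b h.1) :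
      ClosureStep B (Sum.inl (B.node b)) (Sum.inr (B.edgeVertex h))
  | arrive (b b' : B.HalfEdge) (h : B.PlainHalf) (hb : B.SplitBuds b b') (hm : B.Matched b' h.1) :
      ClosureStep B (Sum.inr (B.edgeVertex h)) (Sum.inl (B.node b'))

/-- The (doubled) abscissa of a vertex of the closure when the meandric path is stretched to a
horizontal segment, from left to right and with the blue half-edges above: the number of vertices
that precede it on the path. -/
noncomputable def abscissa (B : BudMap) (v : B.ClosureVertex) : ℕ :=
  {u | Relation.TransGen B.ClosureStep u v}.ncard

/-- The stretched closure of `B`: the blue (resp. red) half-edges become arcs above (resp. below)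
the meandric path, between their node and their edge-vertex. -/
noncomputable def stretchedClosure (B : BudMap) : ArcDiagram where
  upper := {p | ∃ h : B.PlainHalf, B.kind h.1 = Kind.blue ∧
    p = (B.abscissa (Sum.inl (B.node h.1)), B.abscissa (Sum.inr (B.edgeVertex h)))}
  lower := {p | ∃ h : B.PlainHalf, B.kind h.1 = Kind.red ∧
    p = (B.abscissa (Sum.inr (B.edgeVertex h)), B.abscissa (Sum.inl (B.node h.1)))}

end BudMap

/-- Maps up to isomorphism. -/
abbrev BudMapClass : Type 1 := Quotient BudMap.setoid

/-- The set of bicolored blossoming trees of size `n`, as unrooted plane trees, i.e. up to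
isomorphism. -/
def bicoloredBlossomingTrees (n : ℕ) : Set BudMapClass :=
  {q | ∃ B : BudMap, B.IsBicoloredBlossomingTree n ∧ Quotient.mk BudMap.setoid B = q}

/-! ### The map `γ` -/

/-- The half-edges of the blossoming tree of `M`: a left and a right bud on the horizontal line at
every black point (the `k`-th one being at doubled abscissa `2 k`), and the arcs. -/
inductive DrawnHalfEdge (n : ℕ) (M : ArcDiagram) : Type
  | rightBud (k : Fin (n + 1))
  | upperArc (a : M.upper)
  | leftBud (k : Fin (n + 1))
  | lowerArc (a : M.lower)

namespace DrawnHalfEdge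

variable {n : ℕ} {M : ArcDiagram}

/-- The kind of a half-edge: upper arcs are blue, lower arcs are red. -/
def kind : DrawnHalfEdge n M → Kind
  | rightBud _ => Kind.bud
  | upperArc _ => Kind.blue
  | leftBud _ => Kind.bud
  | lowerArc _ => Kind.red

/-- The (doubled) abscissa of the black end of a half-edge. -/
def black : DrawnHalfEdge n M → ℕ
  | rightBud k => 2 * (k : ℕ)
  | upperArc a => a.1.1
  | leftBud k => 2 * (k : ℕ)
  | lowerArc a => a.1.2

/-- The counterclockwise order, starting from the right bud, of the half-edges at a black point:
the right bud, the upper arcs (which all go to the right) from the innermost to the outermost one,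
the left bud, the lower arcs (which all go to the left) from the innermost to the outermost one. -/
def angle : DrawnHalfEdge n M → ℤ
  | rightBud _ => 0
  | upperArc a => (a.1.2 : ℤ)
  | leftBud _ => 2 * (n : ℤ) + 1
  | lowerArc a => 4 * (n : ℤ) + 2 - (a.1.1 : ℤ)

/-- `y` comes immediately after `x` in counterclockwise order around the black end of `x`. -/
def IsNext (x y : DrawnHalfEdge n M) : Prop :=
  y.black = x.black ∧
    ((x.angle < y.angle ∧ ∀ z : DrawnHalfEdge n M, z.black = x.black →
        x.angle < z.angle → y.angle ≤ z.angle) ∨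
      ((∀ z : DrawnHalfEdge n M, z.black = x.black → z.angle ≤ x.angle) ∧
        ∀ z : DrawnHalfEdge n M, z.black = x.black → y.angle ≤ z.angle))

/-- `x` and `y` are the upper and the lower arc, in some order, incident to one white point. -/
def IsTwin : DrawnHalfEdge n M → DrawnHalfEdge n M → Prop
  | upperArc a, lowerArc c => a.1.2 = c.1.1
  | lowerArc c, upperArc a => a.1.2 = c.1.1
  | _, _ => False

end DrawnHalfEdge

/-- The bicolored blossoming tree of a meandering tree `M` of size `n`, obtained by adding a left
and a right bud at each black point and turning the arcs into the halves of plain edges. -/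
noncomputable def opened (n : ℕ) (M : ArcDiagram) : BudMap where
  HalfEdge := DrawnHalfEdge n M
  kind := DrawnHalfEdge.kind
  next x := pick x x.IsNext
  twin x := pick x x.IsTwin

/-- The map `γ`. -/
noncomputable def gamma (n : ℕ) (M : ArcDiagram) : BudMapClass :=
  Quotient.mk BudMap.setoid (opened n M)

/-! ### The map `δ`

The stretched closure does not depend on the choice of a representative. -/

namespace BudMap

variable {A B : BudMap}

/-- The map induced by an isomorphism on the halves of plain edges. -/
def Iso.mapPlain (e : Iso A B) : A.PlainHalf ≃ B.PlainHalf :=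
  e.toEquiv.subtypeEquiv fun h => by rw [e.kind_eq]

/-- The map induced by an isomorphism on nodes. -/
def Iso.mapNode (e : Iso A B) : A.Node ≃ B.Node :=
  Quot.congr e.toEquiv fun h h' => by rw [e.next_eq]; exact e.toEquiv.injective.eq_iff.symm

/-- The map induced by an isomorphism on edge-vertices. -/
def Iso.mapEdgeVertex (e : Iso A B) : A.EdgeVertex ≃ B.EdgeVertex :=
  Quot.congr e.mapPlain fun h h' => by
    change _ ↔ B.twin (e.toEquiv h.1) = e.toEquiv h'.1
    rw [e.twin_eq]; exact e.toEquiv.injective.eq_iff.symm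

/-- The map induced by an isomorphism on the vertices of the closure. -/
def Iso.mapVertex (e : Iso A B) : A.ClosureVertex ≃ B.ClosureVertex :=
  Equiv.sumCongr e.mapNode e.mapEdgeVertex

theorem Iso.next_iterate (e : Iso A B) (m : ℕ) (h : A.HalfEdge) :
    B.next^[m] (e.toEquiv h) = e.toEquiv (A.next^[m] h) := by
  induction m generalizing h with
  | zero => rfl
  | succ m ih => rw [Function.iterate_succ_apply, e.next_eq, ih, Function.iterate_succ_apply]

theorem Iso.contour_iterate (e : Iso A B) (m : ℕ) (h : A.HalfEdge) :
    B.contour^[m] (e.toEquiv h) = e.toEquiv (A.contour^[m] h) := by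
  induction m generalizing h with
  | zero => rfl
  | succ m ih =>
    rw [Function.iterate_succ_apply, Function.iterate_succ_apply, ← ih]
    simp only [contour, e.twin_eq, e.next_eq]

theorem Iso.run (e : Iso A B) {c : Kind} {b b' : A.HalfEdge} (h : A.Run c b b') :
    B.Run c (e.toEquiv b) (e.toEquiv b') := by
  obtain ⟨m, h1, h2⟩ := h
  refine ⟨m, by rw [e.next_iterate, h1], fun i hi => ?_⟩
  rw [e.next_iterate, e.kind_eq, h2 i hi]

theorem Iso.splitBuds (e : Iso A B) {b b' : A.HalfEdge} (h : A.SplitBuds b b') :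
    B.SplitBuds (e.toEquiv b) (e.toEquiv b') := by
  obtain ⟨h1, h2, h3, h4, h5⟩ := h
  exact ⟨by rw [e.kind_eq, h1], by rw [e.kind_eq, h2], e.toEquiv.injective.ne h3, e.run h4,
    e.run h5⟩

theorem Iso.height_eq (e : Iso A B) (b : A.HalfEdge) (k : ℕ) :
    B.height (e.toEquiv b) k = A.height b k := by
  simp only [height, e.contour_iterate, e.kind_eq]

theorem Iso.matched (e : Iso A B) {b h : A.HalfEdge} (hm : A.Matched b h) :
    B.Matched (e.toEquiv b) (e.toEquiv h) := by
  obtain ⟨h1, k, h2, h3, h4⟩ := hm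
  refine ⟨by rw [e.kind_eq, h1], k, by rw [e.contour_iterate, h2], by rw [e.height_eq, h3], ?_⟩
  intro j hj
  rw [e.height_eq]
  exact h4 j hj

theorem Iso.closureStep (e : Iso A B) {u v : A.ClosureVertex} (h : A.ClosureStep u v) :
    B.ClosureStep (e.mapVertex u) (e.mapVertex v) := by
  cases h with
  | leave b b' h hb hm =>
    exact ClosureStep.leave (e.toEquiv b) (e.toEquiv b') (e.mapPlain h) (e.splitBuds hb)
      (e.matched hm)
  | arrive b b' h hb hm =>
    exact ClosureStep.arrive (e.toEquiv b) (e.toEquiv b') (e.mapPlain h) (e.splitBuds hb)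
      (e.matched hm)

theorem Iso.mapVertex_symm (e : Iso A B) (v : B.ClosureVertex) :
    e.symm.mapVertex v = e.mapVertex.symm v := by
  rcases v with v | v
  · induction v using Quot.ind
    rfl
  · induction v using Quot.ind
    rfl

theorem Iso.transGen_iff (e : Iso A B) (u v : A.ClosureVertex) :
    Relation.TransGen B.ClosureStep (e.mapVertex u) (e.mapVertex v) ↔
      Relation.TransGen A.ClosureStep u v := by
  constructor
  · intro h
    have h' := h.lift (r := B.ClosureStep) (p := A.ClosureStep) e.symm.mapVertex
      (fun _ _ hs => e.symm.closureStep hs)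
    simpa only [Function.onFun, e.mapVertex_symm, Equiv.symm_apply_apply] using h'
  · intro h
    exact h.lift (p := B.ClosureStep) e.mapVertex (fun _ _ hs => e.closureStep hs)

theorem Iso.abscissa_eq (e : Iso A B) (v : A.ClosureVertex) :
    B.abscissa (e.mapVertex v) = A.abscissa v := by
  unfold abscissa
  rw [← Set.ncard_image_of_injective _ e.mapVertex.injective]
  congr 1
  ext u
  obtain ⟨u, rfl⟩ := e.mapVertex.surjective u
  rw [e.mapVertex.injective.mem_set_image]
  exact e.transGen_iff u v

theorem Iso.abscissa_node (e : Iso A B) (h : A.HalfEdge) :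
    B.abscissa (Sum.inl (B.node (e.toEquiv h))) = A.abscissa (Sum.inl (A.node h)) :=
  e.abscissa_eq (Sum.inl (A.node h))

theorem Iso.abscissa_edgeVertex (e : Iso A B) (h : A.PlainHalf) :
    B.abscissa (Sum.inr (B.edgeVertex (e.mapPlain h))) = A.abscissa (Sum.inr (A.edgeVertex h)) :=
  e.abscissa_eq (Sum.inr (A.edgeVertex h))

theorem Iso.stretchedClosure_eq (e : Iso A B) : A.stretchedClosure = B.stretchedClosure := by
  have hn : ∀ h : A.PlainHalf, B.abscissa (Sum.inl (B.node (e.mapPlain h).1)) =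
      A.abscissa (Sum.inl (A.node h.1)) := fun h => e.abscissa_node h.1
  have hk : ∀ h : A.PlainHalf, B.kind (e.mapPlain h).1 = A.kind h.1 := fun h => e.kind_eq h.1
  ext p
  · simp only [stretchedClosure, Set.mem_ofPred_eq]
    rw [e.mapPlain.surjective.exists]
    simp only [hn, hk, e.abscissa_edgeVertex]
  · simp only [stretchedClosure, Set.mem_ofPred_eq]
    rw [e.mapPlain.surjective.exists]
    simp only [hn, hk, e.abscissa_edgeVertex]

end BudMap

/-- The map `δ`, sending a bicolored blossoming tree to its stretched closure. -/
noncomputable def delta (q : BudMapClass) : ArcDiagram :=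
  Quotient.lift (s := BudMap.setoid) BudMap.stretchedClosure
    (fun _ _ h => Nonempty.elim h fun e => e.stretchedClosure_eq) q

/-- The map `Φ = γ ∘ φ`. -/
noncomputable def Phi (n : ℕ) : BinTree × BinTree → BudMapClass := gamma n ∘ phi n

/-- The map `Ψ = ψ ∘ δ`. -/
noncomputable def Psi (n : ℕ) : BudMapClass → BinTree × BinTree := psi n ∘ delta

end TamariBlossom

open TamariBlossom

namespace TamariBlossom

/-! ### Meandering diagrams as pairs of functions -/

/-! A meandering diagram of size `n` amounts to two functions: the white point number `s` (between
the black points `s` and `s + 1`) is joined to the black point `u s` above and to `d s` below,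
subject to the non-crossing inequalities of `IsMeander`. All objects are translated into such pairs.

The pivot is the condition `Compatible`: there are no `s < t` with `u t ≤ s` and `t < d s`. In a
connected diagram such a pair cannot exist: some edge leaves the set of black points enclosed
between the two arcs, and it produces a closer pair of the same sort, so there is an infinite
descent. Conversely, in a compatible diagram the last white point `t` with `u t = 0` cuts the axis
into `[0, t]` and `[t + 1, n]`; both are closed under the edges at their white points, and the edge
at `t` joins them. Iterating this (`IsMeander.interval_induction`) gives connectedness, and a
connected graph with `n + 1` vertices and `n` edges is a tree.

For a pair `(T, T')`, `phi` yields for `u` the leftmost leaves below the nodes of `T'` and for `d`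
the rightmost leaves below the nodes of `T`, in infix order (`phi_eq_arcs`). Intervals of leaves in
one tree are nested or disjoint, and right rotations can only move left ends to the right, so `T ≤
T'` implies compatibility. Conversely, compatibility says that the node of `T` destined to be the
root of `T'` lies on the left branch; rotations bring it to the root, and one recurses in the two
subtrees (`tamariLE_of_compatible`). Since `psi` recovers the trees from their drawings (`psi_phi`),
`phi` is a bijection from intervals to meandering trees.

For `gamma`, the same decomposition into intervals shows that the planar matching follows the axis:
the right bud at `k` is matched with the leg of the upper arc at the white point `k`, and the left
bud at `k + 1` with the leg of the lower arc at `k` (`IsMeander.matched`). The meandric path is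
therefore the axis itself, and `delta_gamma` says that closing undoes opening.

It remains to see that `gamma` is surjective, which avoids any direct study of the closure of an
abstract blossoming tree. The tree is drawn one leaf at a time: each new leaf and its edge are
inserted as two consecutive points of the axis, at a place where the new arcs cross nothing and
respect the cyclic order (`HalfEdgeSystem.Labeling.exists_place`). The final drawing is a meandering
tree whose opening is the given tree, and the theorem follows formally. -/

/-- The pairs of functions that describe the meandering diagrams of size `n`: the white point
number `s` is joined to the black points number `u s` (upper arc) and `d s` (lower arc). -/
structure IsMeander (n : ℕ) (u d : ℕ → ℕ) : Prop where
  u_le : ∀ s < n, u s ≤ s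
  lt_d : ∀ s < n, s < d s
  d_le : ∀ s < n, d s ≤ n
  u_nc : ∀ s t, s < t → t < n → u t ≤ u s ∨ s < u t
  d_nc : ∀ s t, s < t → t < n → d t ≤ d s ∨ d s ≤ t

/-- The arc-diagram given by the black ends of the upper and lower arcs. -/
def arcs (n : ℕ) (u d : ℕ → ℕ) : ArcDiagram where
  upper := {p | ∃ s < n, p = (2 * u s, 2 * s + 1)}
  lower := {p | ∃ s < n, p = (2 * s + 1, 2 * d s)}

theorem IsMeander.isMeanderingDiagram {n : ℕ} {u d : ℕ → ℕ} (h : IsMeander n u d) :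
    IsMeanderingDiagram n (arcs n u d) where
  upper_lt := by
    rintro _ ⟨s, hs, rfl⟩
    have := h.u_le s hs
    dsimp only
    omega
  lower_lt := by
    rintro _ ⟨s, hs, rfl⟩
    have := h.lt_d s hs
    have := h.d_le s hs
    dsimp only
    omega
  upper_color := by
    rintro _ ⟨s, hs, rfl⟩
    exact ⟨even_two_mul _, odd_two_mul_add_one _⟩
  lower_color := by
    rintro _ ⟨s, hs, rfl⟩
    exact ⟨odd_two_mul_add_one _, even_two_mul _⟩
  upper_unique := by
    refine fun s hs => ⟨(2 * u s, 2 * s + 1), ⟨⟨s, hs, rfl⟩, rfl⟩, ?_⟩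
    rintro _ ⟨⟨t, ht, rfl⟩, h2⟩
    obtain rfl : t = s := by dsimp only at h2; omega
    rfl
  lower_unique := by
    refine fun s hs => ⟨(2 * s + 1, 2 * d s), ⟨⟨s, hs, rfl⟩, rfl⟩, ?_⟩
    rintro _ ⟨⟨t, ht, rfl⟩, h2⟩
    obtain rfl : t = s := by dsimp only at h2; omega
    rfl
  upper_nonCrossing := by
    rintro _ ⟨s, hs, rfl⟩ _ ⟨t, ht, rfl⟩ ⟨h1, h2, h3⟩
    dsimp only at h1 h2 h3
    have := h.u_nc s t (by omega) ht
    omega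
  lower_nonCrossing := by
    rintro _ ⟨s, hs, rfl⟩ _ ⟨t, ht, rfl⟩ ⟨h1, h2, h3⟩
    dsimp only at h1 h2 h3
    have := h.d_nc s t (by omega) ht
    omega

theorem IsMeanderingDiagram.exists_eq_arcs {n : ℕ} {M : ArcDiagram}
    (h : IsMeanderingDiagram n M) : ∃ u d, IsMeander n u d ∧ M = arcs n u d := by
  -- Values at `s ≥ n` are arbitrary, as `arcs n` never reads them.
  have hu : ∀ s, ∃ b, s < n → (2 * b, 2 * s + 1) ∈ M.upper := by
    intro s
    by_cases hs : s < n
    · obtain ⟨p, ⟨hp, h2⟩, -⟩ := h.upper_unique s hs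
      obtain ⟨b, hb⟩ := (h.upper_color p hp).1.exists_two_nsmul
      refine ⟨b, fun _ => ?_⟩
      convert hp using 1
      ext
      · simp [hb]
      · simp [h2]
    · exact ⟨0, fun h => absurd h hs⟩
  have hd : ∀ s, ∃ b, s < n → (2 * s + 1, 2 * b) ∈ M.lower := by
    intro s
    by_cases hs : s < n
    · obtain ⟨p, ⟨hp, h2⟩, -⟩ := h.lower_unique s hs
      obtain ⟨b, hb⟩ := (h.lower_color p hp).2.exists_two_nsmul
      refine ⟨b, fun _ => ?_⟩
      convert hp using 1
      ext
      · simp [h2]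
      · simp [hb]
    · exact ⟨0, fun h => absurd h hs⟩
  choose u hu using hu
  choose d hd using hd
  refine ⟨u, d, ⟨?_, ?_, ?_, ?_, ?_⟩, ?_⟩
  · intro s hs
    have := (h.upper_lt _ (hu s hs)).1
    dsimp only at this
    omega
  · intro s hs
    have := (h.lower_lt _ (hd s hs)).1
    dsimp only at this
    omega
  · intro s hs
    have := (h.lower_lt _ (hd s hs)).2
    dsimp only at this
    omega
  · intro s t hst ht
    have := h.upper_nonCrossing _ (hu s (by omega)) _ (hu t ht)
    dsimp only at this
    omega
  · intro s t hst ht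
    have := h.lower_nonCrossing _ (hd s (by omega)) _ (hd t ht)
    dsimp only at this
    omega
  · ext p
    · constructor
      · intro hp
        obtain ⟨s, hs⟩ := (h.upper_color p hp).2
        have hsn : s < n := by have := (h.upper_lt p hp).2; omega
        exact ⟨s, hsn, (h.upper_unique s hsn).unique ⟨hp, hs⟩ ⟨hu s hsn, rfl⟩⟩
      · rintro ⟨s, hs, rfl⟩
        exact hu s hs
    · constructor
      · intro hp
        obtain ⟨s, hs⟩ := (h.lower_color p hp).1
        have hsn : s < n := by
          have h1 := (h.lower_lt p hp).2
          have h2 := (h.lower_lt p hp).1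
          omega
        exact ⟨s, hsn, (h.lower_unique s hsn).unique ⟨hp, hs⟩ ⟨hd s hsn, rfl⟩⟩
      · rintro ⟨s, hs, rfl⟩
        exact hd s hs

/-! ### Connectedness of the underlying graph and compatibility of the arcs -/

theorem isEdgeAt_arcs {n : ℕ} {u d : ℕ → ℕ} {w b b' : ℕ} :
    IsEdgeAt (arcs n u d) w b b' ↔ ∃ s < n, w = 2 * s + 1 ∧ b = 2 * u s ∧ b' = 2 * d s := by
  constructor
  · rintro ⟨⟨s, hs, h1⟩, t, ht, h2⟩
    rw [Prod.mk.injEq] at h1 h2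
    obtain rfl : s = t := by omega
    exact ⟨s, hs, h1.2, h1.1, h2.2⟩
  · rintro ⟨s, hs, rfl, rfl, rfl⟩
    exact ⟨⟨s, hs, rfl⟩, s, hs, rfl⟩

theorem underlyingGraph_arcs_adj {n : ℕ} {u d : ℕ → ℕ} {i j : Fin (n + 1)} :
    (underlyingGraph n (arcs n u d)).Adj i j ↔
      i ≠ j ∧ ∃ s < n, (u s = i ∧ d s = j) ∨ (u s = j ∧ d s = i) := by
  simp only [underlyingGraph, SimpleGraph.fromRel_adj, isEdgeAt_arcs]
  refine and_congr_right fun _ => ⟨?_, ?_⟩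
  · rintro (⟨_, s, hs, -, h1, h2⟩ | ⟨_, s, hs, -, h1, h2⟩)
    · exact ⟨s, hs, Or.inl ⟨by omega, by omega⟩⟩
    · exact ⟨s, hs, Or.inr ⟨by omega, by omega⟩⟩
  · rintro ⟨s, hs, ⟨h1, h2⟩ | ⟨h1, h2⟩⟩
    · exact Or.inl ⟨2 * s + 1, s, hs, rfl, by omega, by omega⟩
    · exact Or.inr ⟨2 * s + 1, s, hs, rfl, by omega, by omega⟩

/-- Every proper nonempty set of black points is left by an edge. -/
def CutConnected (n : ℕ) (u d : ℕ → ℕ) : Prop :=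
  ∀ X : Set ℕ, ∀ i ≤ n, ∀ j ≤ n, i ∈ X → j ∉ X → ∃ s < n, ¬ (u s ∈ X ↔ d s ∈ X)

/-- No pair of white points `s < t` is enclosed by the upper arc at `t` and the lower arc
at `s`. -/
def Compatible (n : ℕ) (u d : ℕ → ℕ) : Prop :=
  ∀ s t, s < t → t < n → s < u t ∨ d s ≤ t

/-- A connected graph has an edge leaving any proper nonempty set of vertices. -/
theorem exists_adj_of_connected {V : Type*} {G : SimpleGraph V} (h : G.Connected) (X : Set V)
    {i j : V} (hi : i ∈ X) (hj : j ∉ X) : ∃ a b, G.Adj a b ∧ a ∈ X ∧ b ∉ X := by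
  obtain ⟨p⟩ := h.preconnected i j
  obtain ⟨e, -, h1, h2⟩ := p.exists_boundary_dart X hi hj
  exact ⟨e.fst, e.snd, e.adj, h1, h2⟩

/-- A graph in which an edge leaves every proper nonempty set of vertices is connected. -/
theorem connected_of_exists_adj {V : Type*} [Nonempty V] {G : SimpleGraph V}
    (h : ∀ (X : Set V) (i j : V), i ∈ X → j ∉ X → ∃ a b, G.Adj a b ∧ ¬ (a ∈ X ↔ b ∈ X)) :
    G.Connected := by
  refine ⟨fun i j => ?_⟩
  by_contra hij
  obtain ⟨a, b, hab, hX⟩ := h {k | G.Reachable i k} i j (SimpleGraph.Reachable.refl i) hij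
  exact hX ⟨fun ha => ha.trans hab.reachable, fun hb => hb.trans hab.symm.reachable⟩

theorem cutConnected_of_connected {n : ℕ} {u d : ℕ → ℕ}
    (h : (underlyingGraph n (arcs n u d)).Connected) : CutConnected n u d := by
  intro X i hi j hj hiX hjX
  obtain ⟨a, b, hab, ha, hb⟩ := exists_adj_of_connected h {k : Fin (n + 1) | (k : ℕ) ∈ X}
    (i := ⟨i, by omega⟩) (j := ⟨j, by omega⟩) hiX hjX
  obtain ⟨-, s, hs, ⟨h1, h2⟩ | ⟨h1, h2⟩⟩ := underlyingGraph_arcs_adj.1 hab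
  · exact ⟨s, hs, by rw [h1, h2]; exact fun h => hb (h.1 ha)⟩
  · exact ⟨s, hs, by rw [h1, h2]; exact fun h => hb (h.2 ha)⟩

theorem IsMeander.connected_of_cutConnected {n : ℕ} {u d : ℕ → ℕ} (hM : IsMeander n u d)
    (h : CutConnected n u d) : (underlyingGraph n (arcs n u d)).Connected := by
  refine connected_of_exists_adj fun X i j hi hj => ?_
  obtain ⟨s, hs, hX⟩ := h ((fun k : Fin (n + 1) => (k : ℕ)) '' X) i (by omega) j (by omega)
    ⟨i, hi, rfl⟩ (by rintro ⟨k, hk, h2⟩; exact hj (Fin.ext h2 ▸ hk))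
  have h1 := hM.u_le s hs
  have h2 := hM.lt_d s hs
  have h3 := hM.d_le s hs
  refine ⟨⟨u s, by omega⟩, ⟨d s, by omega⟩, underlyingGraph_arcs_adj.2
    ⟨fun h => ?_, s, hs, Or.inl ⟨rfl, rfl⟩⟩, fun h => hX ?_⟩
  · have := congrArg Fin.val h
    dsimp only at this
    omega
  · have key : ∀ a (ha : a < n + 1),
        a ∈ (fun k : Fin (n + 1) => (k : ℕ)) '' X ↔ (⟨a, ha⟩ : Fin (n + 1)) ∈ X := fun a ha =>
      ⟨by rintro ⟨k, hk, rfl⟩; exact hk, fun h => ⟨_, h, rfl⟩⟩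
    rw [key (u s) (by omega), key (d s) (by omega)]
    exact h

/-- Counting: the `n` white points map onto the edges, so there are at most `n` of these, while a
connected graph on `n + 1` vertices has at least `n`. Equality makes the graph a tree and the map
injective, which excludes double edges. -/
theorem IsMeander.isMeanderingTree_of_cutConnected {n : ℕ} {u d : ℕ → ℕ} (hM : IsMeander n u d)
    (h : CutConnected n u d) : IsMeanderingTree n (arcs n u d) := by
  have hc := hM.connected_of_cutConnected h
  set G := underlyingGraph n (arcs n u d) with hG
  have hlt : ∀ s : Fin n, u s < n + 1 ∧ d s < n + 1 := fun s => by
    have h1 := hM.u_le s s.2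
    have h2 := hM.lt_d s s.2
    have h3 := hM.d_le s s.2
    omega
  have hadj : ∀ s : Fin n, G.Adj ⟨u s, (hlt s).1⟩ ⟨d s, (hlt s).2⟩ := fun s =>
    underlyingGraph_arcs_adj.2 ⟨fun h => by
      have := congrArg Fin.val h
      have h1 := hM.u_le s s.2
      have h2 := hM.lt_d s s.2
      dsimp only at this
      omega, s, s.2, Or.inl ⟨rfl, rfl⟩⟩
  let f : Fin n → G.edgeSet := fun s => ⟨s(_, _), hadj s⟩
  have hf : Function.Surjective f := by
    rintro ⟨e, he⟩
    induction e using Sym2.ind with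
    | _ i j =>
      obtain ⟨-, s, hs, ⟨h1, h2⟩ | ⟨h1, h2⟩⟩ := underlyingGraph_arcs_adj.1 he
      · refine ⟨⟨s, hs⟩, Subtype.ext ?_⟩
        rw [Sym2.eq_iff]
        exact Or.inl ⟨Fin.ext h1, Fin.ext h2⟩
      · refine ⟨⟨s, hs⟩, Subtype.ext ?_⟩
        rw [Sym2.eq_iff]
        exact Or.inr ⟨Fin.ext h1, Fin.ext h2⟩
  have hle : Nat.card G.edgeSet ≤ n := by
    simpa using Nat.card_le_card_of_surjective f hf
  have hge := hc.card_vert_le_card_edgeSet_add_one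
  rw [Nat.card_fin] at hge
  have hinj : Function.Injective f :=
    (Nat.bijective_iff_surjective_and_card f |>.2 ⟨hf, by rw [Nat.card_fin]; omega⟩).1
  refine ⟨hM.isMeanderingDiagram, ?_, ?_⟩
  · change G.IsTree
    rw [SimpleGraph.isTree_iff_connected_and_card]
    exact ⟨hc, by rw [Nat.card_fin]; omega⟩
  · intro w w' b b' h1 h2
    rw [isEdgeAt_arcs] at h1 h2
    obtain ⟨s, hs, rfl, rfl, rfl⟩ := h1
    obtain ⟨t, ht, rfl, h3, h4⟩ := h2
    have : (⟨s, hs⟩ : Fin n) = ⟨t, ht⟩ := hinj (Subtype.ext (by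
      rw [Sym2.eq_iff]
      exact Or.inl ⟨Fin.ext (by dsimp only; omega), Fin.ext (by dsimp only; omega)⟩))
    rw [Fin.mk.injEq] at this
    rw [this]

/-- The last `t < n` with `u t = a`, in an interval `[a, b)` on which `a ≤ u`. -/
theorem IsMeander.exists_last {n : ℕ} {u d : ℕ → ℕ} (hM : IsMeander n u d) {a b : ℕ}
    (hab : a < b) (hb : b ≤ n) (hu : ∀ s, a ≤ s → s < b → a ≤ u s) :
    ∃ t, a ≤ t ∧ t < b ∧ u t = a ∧ ∀ s, t < s → s < b → t < u s := by
  classical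
  -- The search is not vacuous: `a ≤ u a ≤ a`, so `a` itself qualifies.
  have ha : a ≤ Nat.findGreatest (fun t => u t = a) (b - 1) :=
    Nat.le_findGreatest (by omega) (le_antisymm (hM.u_le a (by omega)) (hu a le_rfl hab))
  have h1 : u (Nat.findGreatest (fun t => u t = a) (b - 1)) = a :=
    Nat.findGreatest_spec (P := fun t => u t = a) (m := a) (by omega)
      (le_antisymm (hM.u_le a (by omega)) (hu a le_rfl hab))
  have h2 := Nat.findGreatest_le (P := fun t => u t = a) (b - 1)
  refine ⟨_, ha, by omega, h1, fun s hs hsb => ?_⟩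
  have h3 := Nat.findGreatest_is_greatest (P := fun t => u t = a) hs (by omega)
  -- Maximality gives `u s ≠ a`, and the arc at `s` cannot cross the one from `a` to `t`; hence it
  -- starts to the right of `t`.
  have h4 := hM.u_nc _ s hs (by omega)
  have h5 := hu s (by omega) hsb
  omega

/-- An interval of black points that is closed under the edges at the white points in it. -/
structure IsClosedInterval (u d : ℕ → ℕ) (a b : ℕ) : Prop where
  le_u : ∀ s, a ≤ s → s < b → a ≤ u s
  d_le : ∀ s, a ≤ s → s < b → d s ≤ b

/-- Induction on closed intervals: `[a, b]` is cut at the white point `t`, the last one with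
`u t = a`. -/
theorem IsMeander.interval_induction {n : ℕ} {u d : ℕ → ℕ} (hM : IsMeander n u d)
    (hC : Compatible n u d) {P : ℕ → ℕ → Prop} (single : ∀ a ≤ n, P a a)
    (split : ∀ a b t, a ≤ t → t < b → b ≤ n → u t = a → (∀ s, t < s → s < b → t < u s) →
      (∀ s, a ≤ s → s < t → d s ≤ t) →
      IsClosedInterval u d a b → P a t → P (t + 1) b → P a b) :
    ∀ a b, a ≤ b → b ≤ n → IsClosedInterval u d a b → P a b := by
  suffices h : ∀ m a b, b = a + m → b ≤ n → IsClosedInterval u d a b → P a b from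
    fun a b hab hb hI => h (b - a) a b (by omega) hb hI
  intro m
  induction m using Nat.strong_induction_on with
  | _ m ih =>
    intro a b hm hb hI
    rcases Nat.eq_zero_or_pos m with rfl | hpos
    · obtain rfl : b = a := hm
      exact single b hb
    · obtain ⟨t, h1, h2, h3, h4⟩ := hM.exists_last (by omega) hb hI.le_u
      -- Since `u t = a ≤ s`, the first alternative of `Compatible` fails, so no lower arc from the
      -- left part passes over `t`.
      have h5 : ∀ s, a ≤ s → s < t → d s ≤ t := fun s hs hst => by
        have := hC s t hst (by omega)
        omega
      refine split a b t h1 h2 hb h3 h4 h5 hI ?_ ?_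
      · exact ih (t - a) (by omega) a t (by omega) (by omega)
          ⟨fun s hs hst => hI.le_u s hs (by omega), h5⟩
      · exact ih (b - (t + 1)) (by omega) (t + 1) b (by omega) hb
          ⟨fun s hs hsb => h4 s (by omega) hsb, fun s hs hsb => hI.d_le s (by omega) hsb⟩

theorem IsMeander.isClosedInterval {n : ℕ} {u d : ℕ → ℕ} (hM : IsMeander n u d) :
    IsClosedInterval u d 0 n :=
  ⟨fun _ _ _ => Nat.zero_le _, fun s _ h => hM.d_le s h⟩

/-- If no edge left `X`, membership in `X` would be constant on every closed interval: it is
constant on both halves by induction, and the edge at the cutting point `t` joins `a` in the left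
half to `d t` in the right half. -/
theorem IsMeander.cutConnected {n : ℕ} {u d : ℕ → ℕ} (hM : IsMeander n u d)
    (hC : Compatible n u d) : CutConnected n u d := by
  intro X i hi j hj hiX hjX
  by_contra! hX
  have key : ∀ a b, a ≤ b → b ≤ n → IsClosedInterval u d a b →
      ∀ k, a ≤ k → k ≤ b → (k ∈ X ↔ a ∈ X) := by
    refine hM.interval_induction hC (fun a ha k h1 h2 => ?_) ?_
    · rw [le_antisymm h2 h1]
    · intro a b t h1 h2 hb h3 h4 h5 hI ih1 ih2 k hk1 hk2
      rcases le_or_gt k t with hkt | hkt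
      · exact ih1 k hk1 hkt
      · have h6 := hI.d_le t h1 h2
        have h7 := hM.lt_d t (by omega)
        rw [ih2 k hkt hk2, ← ih2 (d t) h7 h6, ← hX t (by omega), h3]
  have h1 := key 0 n (by omega) le_rfl hM.isClosedInterval i (by omega) hi
  have h2 := key 0 n (by omega) le_rfl hM.isClosedInterval j (by omega) hj
  exact hjX (h2.2 (h1.1 hiX))

/-- Descent on `t - s`. Let `w` be a white point whose edge leaves the set of black points `(s, t]`.
The arcs at `s` and `t` shield this set from edges at `w ≤ s` or `w ≥ t`, so `s < w < t`. If `u w ≤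
s`, then `(s, w)` is a closer bad pair; otherwise `t < d w` and `(w, t)` is one. -/
theorem IsMeander.compatible {n : ℕ} {u d : ℕ → ℕ} (hM : IsMeander n u d)
    (hX : CutConnected n u d) : Compatible n u d := by
  suffices h : ∀ m s t, t = s + m → s < t → t < n → u t ≤ s → t < d s → False by
    intro s t hst ht
    by_contra! hc
    exact h (t - s) s t (by omega) hst ht hc.1 hc.2
  intro m
  induction m using Nat.strong_induction_on with
  | _ m ih =>
    intro s t hm hst ht hut hds
    -- The set contains `t`, and not `0`, so it is proper and nonempty.
    obtain ⟨w, hw, hX⟩ := hX (Set.Ioc s t) t (by omega) 0 (by omega) ⟨hst, le_rfl⟩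
      (fun h => absurd h.1 (by omega))
    rw [Set.mem_Ioc, Set.mem_Ioc] at hX
    have h1 := hM.u_le w hw
    have h2 := hM.lt_d w hw
    have h3 : s < w := by
      rcases lt_trichotomy w s with h | rfl | h
      · have := hM.d_nc w s h (by omega)
        omega
      · omega
      · exact h
    have h4 : w < t := by
      rcases lt_trichotomy t w with h | rfl | h
      · have := hM.u_nc t w h hw
        omega
      · omega
      · exact h
    rcases le_or_gt (u w) s with h | h
    · exact ih (w - s) (by omega) s w (by omega) h3 hw h (by omega)
    · exact ih (t - w) (by omega) w t (by omega) h4 ht (by omega) (by omega)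

/-- The meandering trees of size `n`. -/
theorem mem_meanderingTrees_iff {n : ℕ} {M : ArcDiagram} :
    M ∈ meanderingTrees n ↔ ∃ u d, IsMeander n u d ∧ Compatible n u d ∧ M = arcs n u d := by
  constructor
  · intro h
    obtain ⟨u, d, hM, rfl⟩ := IsMeanderingDiagram.exists_eq_arcs h.isMeanderingDiagram
    exact ⟨u, d, hM, hM.compatible (cutConnected_of_connected h.isTree.connected), rfl⟩
  · rintro ⟨u, d, hM, hC, rfl⟩
    exact hM.isMeanderingTree_of_cutConnected (hM.cutConnected hC)

/-! ### Binary trees as pairs of functions -/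

/-- The leftmost leaf below the `s`-th node of `T` in infix order. -/
def leftEnd : BinTree → ℕ → ℕ
  | .nil, s => s
  | .node () L R, s =>
      if s < L.numNodes then leftEnd L s
      else if s = L.numNodes then 0
      else L.numNodes + 1 + leftEnd R (s - (L.numNodes + 1))

/-- The rightmost leaf below the `s`-th node of `T` in infix order. -/
def rightEnd : BinTree → ℕ → ℕ
  | .nil, s => s
  | .node () L R, s =>
      if s < L.numNodes then rightEnd L s
      else if s = L.numNodes then L.numNodes + R.numNodes + 1
      else L.numNodes + 1 + rightEnd R (s - (L.numNodes + 1))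

theorem numNodes_node (L R : BinTree) :
    (BinaryTree.node () L R).numNodes = L.numNodes + R.numNodes + 1 := rfl

section node

variable (L R : BinTree)

theorem leftEnd_node_left {s : ℕ} (h : s < L.numNodes) :
    leftEnd (.node () L R) s = leftEnd L s := by
  rw [leftEnd, if_pos h]

theorem leftEnd_node_root : leftEnd (.node () L R) L.numNodes = 0 := by
  rw [leftEnd, if_neg (lt_irrefl _), if_pos rfl]

theorem leftEnd_node_right (s : ℕ) :
    leftEnd (.node () L R) (L.numNodes + 1 + s) = L.numNodes + 1 + leftEnd R s := by
  rw [leftEnd, if_neg (by omega), if_neg (by omega), Nat.add_sub_cancel_left]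

theorem rightEnd_node_left {s : ℕ} (h : s < L.numNodes) :
    rightEnd (.node () L R) s = rightEnd L s := by
  rw [rightEnd, if_pos h]

theorem rightEnd_node_root :
    rightEnd (.node () L R) L.numNodes = L.numNodes + R.numNodes + 1 := by
  rw [rightEnd, if_neg (lt_irrefl _), if_pos rfl]

theorem rightEnd_node_right (s : ℕ) :
    rightEnd (.node () L R) (L.numNodes + 1 + s) = L.numNodes + 1 + rightEnd R s := by
  rw [rightEnd, if_neg (by omega), if_neg (by omega), Nat.add_sub_cancel_left]

theorem node_cases {s : ℕ} (h : s < (BinaryTree.node () L R).numNodes) :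
    s < L.numNodes ∨ s = L.numNodes ∨ ∃ r < R.numNodes, s = L.numNodes + 1 + r := by
  rw [numNodes_node] at h
  rcases lt_trichotomy s L.numNodes with h1 | h1 | h1
  · exact Or.inl h1
  · exact Or.inr (Or.inl h1)
  · exact Or.inr (Or.inr ⟨s - (L.numNodes + 1), by omega, by omega⟩)

end node

theorem leftEnd_le (T : BinTree) : ∀ s < T.numNodes, leftEnd T s ≤ s := by
  induction T with
  | nil => exact fun s h => le_rfl
  | node x L R ihL ihR =>
    intro s hs
    rcases node_cases L R hs with h | rfl | ⟨r, hr, rfl⟩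
    · rw [leftEnd_node_left _ _ h]; exact ihL s h
    · rw [leftEnd_node_root]; exact Nat.zero_le _
    · rw [leftEnd_node_right]; have := ihR r hr; omega

theorem rightEnd_bounds (T : BinTree) :
    ∀ s < T.numNodes, s < rightEnd T s ∧ rightEnd T s ≤ T.numNodes := by
  induction T with
  | nil => exact fun s h => absurd h (Nat.not_lt_zero _)
  | node x L R ihL ihR =>
    intro s hs
    rw [numNodes_node]
    rcases node_cases L R hs with h | rfl | ⟨r, hr, rfl⟩
    · rw [rightEnd_node_left _ _ h]; have := ihL s h; omega
    · rw [rightEnd_node_root]; omega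
    · rw [rightEnd_node_right]; have := ihR r hr; omega

/-- The intervals of leaves below two nodes are nested or disjoint. -/
theorem ends_nested (T : BinTree) : ∀ s t, s < t → t < T.numNodes →
    (s < leftEnd T t ∧ rightEnd T t ≤ rightEnd T s) ∨
    (leftEnd T t ≤ leftEnd T s ∧ rightEnd T s ≤ t) ∨
    (s < leftEnd T t ∧ rightEnd T s ≤ t) := by
  induction T with
  | nil => exact fun s t _ h => absurd h (Nat.not_lt_zero _)
  | node x L R ihL ihR =>
    intro s t hst ht
    rcases node_cases L R (hst.trans ht) with hs | rfl | ⟨r, hr, rfl⟩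
    · have h1 := rightEnd_bounds L s hs
      rw [rightEnd_node_left _ _ hs, leftEnd_node_left _ _ hs]
      rcases node_cases L R ht with ht | rfl | ⟨q, hq, rfl⟩
      · rw [rightEnd_node_left _ _ ht, leftEnd_node_left _ _ ht]
        exact ihL s t hst ht
      · rw [rightEnd_node_root, leftEnd_node_root]
        omega
      · rw [rightEnd_node_right, leftEnd_node_right]
        omega
    · rw [rightEnd_node_root, leftEnd_node_root]
      rcases node_cases L R ht with ht | rfl | ⟨q, hq, rfl⟩
      · omega
      · omega
      · rw [rightEnd_node_right, leftEnd_node_right]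
        have := rightEnd_bounds R q hq
        omega
    · rw [rightEnd_node_right, leftEnd_node_right]
      rcases node_cases L R ht with ht | rfl | ⟨q, hq, rfl⟩
      · omega
      · omega
      · rw [rightEnd_node_right, leftEnd_node_right]
        have := ihR r q (by omega) hq
        omega

/-- When the rightmost leaf below node `s` is not the last leaf, its number is also the number of
the nearest ancestor having `s` in its left subtree. That ancestor therefore extends to the left at
least as far as `s`. -/
theorem leftEnd_rightEnd_le (T : BinTree) : ∀ s < T.numNodes, rightEnd T s < T.numNodes →
    leftEnd T (rightEnd T s) ≤ s := by
  induction T with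
  | nil => exact fun s h => absurd h (Nat.not_lt_zero _)
  | node x L R ihL ihR =>
    intro s hs h1
    rcases node_cases L R hs with h | rfl | ⟨r, hr, rfl⟩
    · have h2 := rightEnd_bounds L s h
      rw [rightEnd_node_left _ _ h] at h1 ⊢
      rcases h2.2.lt_or_eq with h3 | h3
      · rw [leftEnd_node_left _ _ h3]
        exact ihL s h h3
      · rw [h3, leftEnd_node_root]
        exact Nat.zero_le _
    · rw [rightEnd_node_root, numNodes_node] at h1
      omega
    · rw [rightEnd_node_right, numNodes_node] at h1
      rw [rightEnd_node_right, leftEnd_node_right]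
      have := ihR r hr (by omega)
      omega

/-- The upper and lower non-crossing conditions are each half of `ends_nested`, for `T'` and for `T`
respectively. -/
theorem isMeander_ends {T T' : BinTree} (h : T.numNodes = T'.numNodes) :
    IsMeander T.numNodes (leftEnd T') (rightEnd T) where
  u_le s hs := leftEnd_le T' s (h ▸ hs)
  lt_d s hs := (rightEnd_bounds T s hs).1
  d_le s hs := (rightEnd_bounds T s hs).2
  u_nc s t hst ht := by have := ends_nested T' s t hst (h ▸ ht); omega
  d_nc s t hst ht := by have := ends_nested T s t hst ht; omega

/-! ### Smooth drawings and diagram-drawings -/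

theorem mem_smoothArcs (T : BinTree) (k : ℕ) (p : ℕ × ℕ) :
    p ∈ smoothArcs T k ↔ ∃ s < T.numNodes, p = (k + leftEnd T s, k + rightEnd T s) := by
  induction T generalizing k with
  | nil => simp [smoothArcs]
  | node x L R ihL ihR =>
    rw [smoothArcs, Set.mem_union, Set.mem_union, ihL, ihR, Set.mem_singleton_iff]
    constructor
    · rintro (rfl | ⟨s, hs, rfl⟩ | ⟨s, hs, rfl⟩)
      · exact ⟨L.numNodes, by rw [numNodes_node]; omega,
          by rw [leftEnd_node_root, rightEnd_node_root, add_zero]⟩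
      · exact ⟨s, by rw [numNodes_node]; omega,
          by rw [leftEnd_node_left _ _ hs, rightEnd_node_left _ _ hs]⟩
      · refine ⟨L.numNodes + 1 + s, by rw [numNodes_node]; omega, ?_⟩
        rw [leftEnd_node_right, rightEnd_node_right]
        simp only [add_assoc]
    · rintro ⟨s, hs, rfl⟩
      rcases node_cases L R hs with h1 | rfl | ⟨r, hr, rfl⟩
      · exact Or.inr (Or.inl ⟨s, h1,
          by rw [leftEnd_node_left _ _ h1, rightEnd_node_left _ _ h1]⟩)
      · exact Or.inl (by rw [leftEnd_node_root, rightEnd_node_root, add_zero])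
      · refine Or.inr (Or.inr ⟨r, hr, ?_⟩)
        rw [leftEnd_node_right, rightEnd_node_right]
        simp only [add_assoc]

/-- The node number `s` in infix order separates the leaves `s` and `s + 1`, so it is their lowest
common ancestor. Any other arc above the segment is nested with its arc, and can only lie outside
it. -/
theorem isVisible_smoothArcs_iff (T : BinTree) (s : ℕ) (a : ℕ × ℕ) :
    IsVisible (smoothArcs T 0) s a ↔ s < T.numNodes ∧ a = (leftEnd T s, rightEnd T s) := by
  have key : s < T.numNodes → IsVisible (smoothArcs T 0) s (leftEnd T s, rightEnd T s) := by
    intro hs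
    have h1 := leftEnd_le T s hs
    have h2 := rightEnd_bounds T s hs
    refine ⟨⟨(mem_smoothArcs _ _ _).2 ⟨s, hs, by simp only [zero_add]⟩, h1, h2.1⟩, ?_⟩
    rintro b ⟨hb, h3, h4⟩
    obtain ⟨t, ht, rfl⟩ := (mem_smoothArcs _ _ _).1 hb
    simp only [zero_add] at h3 h4 ⊢
    have h5 := leftEnd_le T t ht
    have h6 := rightEnd_bounds T t ht
    rcases lt_trichotomy s t with h | rfl | h
    · have := ends_nested T s t h ht
      omega
    · omega
    · have := ends_nested T t s h hs
      omega
  constructor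
  · intro h
    have hs : s < T.numNodes := by
      obtain ⟨t, ht, h1⟩ := (mem_smoothArcs _ _ _).1 h.1.1
      have h2 := h.1.2.2
      have h3 := rightEnd_bounds T t ht
      rw [h1] at h2
      dsimp only at h2
      omega
    have h1 := h.2 _ (key hs).1
    have h2 := (key hs).2 _ h.1
    exact ⟨hs, Prod.ext (le_antisymm h2.1 h1.1) (le_antisymm h1.2 h2.2)⟩
  · rintro ⟨hs, rfl⟩
    exact key hs

theorem mem_diagramDrawing (T : BinTree) (p : ℕ × ℕ) :
    p ∈ diagramDrawing T ↔ ∃ s < T.numNodes, p = (2 * leftEnd T s, 2 * s + 1) := by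
  simp only [diagramDrawing, Set.mem_ofPred_eq, isVisible_smoothArcs_iff]
  constructor
  · rintro ⟨s, a, ⟨hs, rfl⟩, rfl⟩
    exact ⟨s, hs, rfl⟩
  · rintro ⟨s, hs, rfl⟩
    exact ⟨s, _, ⟨hs, rfl⟩, rfl⟩

/-! ### Mirror images and the half-turn -/

theorem numNodes_mir (T : BinTree) : (mir T).numNodes = T.numNodes := by
  induction T with
  | nil => rfl
  | node x L R ihL ihR =>
    rw [mir, numNodes_node, numNodes_node, ihL, ihR]
    omega

theorem mir_mir (T : BinTree) : mir (mir T) = T := by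
  induction T with
  | nil => rfl
  | node x L R ihL ihR => rw [mir, mir, ihL, ihR]

/-- The mirror reverses the infix order of the nodes and the order of the leaves, so node `t`
becomes node `numNodes - 1 - t` and right ends become left ends. -/
theorem leftEnd_mir (T : BinTree) : ∀ s t, s + t + 1 = T.numNodes →
    leftEnd (mir T) s + rightEnd T t = T.numNodes := by
  induction T with
  | nil => exact fun s t h => absurd h (Nat.succ_ne_zero _)
  | node x L R ihL ihR =>
    intro s t h
    have h1 := numNodes_mir R
    have h0 := numNodes_mir L
    rw [numNodes_node] at h ⊢
    rw [mir]
    rcases node_cases L R (s := t) (by rw [numNodes_node]; omega) with ht | rfl | ⟨r, hr, rfl⟩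
    · obtain ⟨q, rfl⟩ : ∃ q, s = (mir R).numNodes + 1 + q := ⟨s - (R.numNodes + 1), by omega⟩
      rw [leftEnd_node_right, rightEnd_node_left _ _ ht]
      have := ihL q t (by omega)
      omega
    · obtain rfl : s = (mir R).numNodes := by omega
      rw [leftEnd_node_root, rightEnd_node_root]
      omega
    · rw [leftEnd_node_left _ _ (by omega), rightEnd_node_right]
      have := ihR s r (by omega)
      omega

/-- The half-turn cancels the mirror: what remains of `mir T` in the lower half-plane is the family
of right ends of `T`, at white points numbered in the original direction. -/
theorem phi_eq_arcs {n : ℕ} {T T' : BinTree} (h : T.numNodes = n) (h' : T'.numNodes = n) :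
    phi n (T, T') = arcs n (leftEnd T') (rightEnd T) := by
  subst h
  ext p
  · change p ∈ diagramDrawing T' ↔ _
    rw [mem_diagramDrawing, h']
    rfl
  · change p ∈ halfTurn T.numNodes (diagramDrawing (mir T)) ↔ ∃ s < T.numNodes, p = _
    simp only [halfTurn, Set.mem_image, mem_diagramDrawing, numNodes_mir]
    constructor
    · rintro ⟨_, ⟨s, hs, rfl⟩, rfl⟩
      refine ⟨T.numNodes - 1 - s, by omega, ?_⟩
      have := leftEnd_mir T s (T.numNodes - 1 - s) (by omega)
      ext <;> dsimp only <;> omega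
    · rintro ⟨s, hs, rfl⟩
      refine ⟨_, ⟨T.numNodes - 1 - s, by omega, rfl⟩, ?_⟩
      have := leftEnd_mir T (T.numNodes - 1 - s) s (by omega)
      ext <;> dsimp only <;> omega

/-! ### Reconstruction of a tree from its diagram-drawing -/

/-- The infimum is attained at `n` if `rightEnd T s = n`, and otherwise at the arc whose white point
has number `rightEnd T s`, which covers `s` by `leftEnd_rightEnd_le`. An arc over `s` with a white
end further left would contradict `ends_nested`. -/
theorem rightAttachment_diagramDrawing (T : BinTree) {s : ℕ} (hs : s < T.numNodes) :
    rightAttachment T.numNodes (diagramDrawing T) (2 * s + 1) = rightEnd T s := by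
  have h1 := rightEnd_bounds T s hs
  apply le_antisymm
  · apply Nat.sInf_le
    rcases h1.2.lt_or_eq with h2 | h2
    · have h3 := leftEnd_rightEnd_le T s hs h2
      exact Or.inr ⟨_, (mem_diagramDrawing _ _).2 ⟨_, h2, rfl⟩, by omega, by omega⟩
    · exact Or.inl h2
  · refine le_csInf ⟨T.numNodes, Or.inl rfl⟩ fun t ht => ?_
    rcases ht with ht | ⟨b, hb, h2, h3⟩
    · exact h1.2.trans_eq (Set.mem_singleton_iff.1 ht).symm
    · obtain ⟨r, hr, h4⟩ := (mem_diagramDrawing _ _).1 hb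
      rw [Prod.mk.injEq] at h4
      obtain rfl : t = r := by omega
      have := ends_nested T s t (by omega) hr
      omega

theorem smoothOfDiagram_diagramDrawing (T : BinTree) :
    smoothOfDiagram T.numNodes (diagramDrawing T) = smoothArcs T 0 := by
  ext p
  rw [mem_smoothArcs]
  simp only [smoothOfDiagram, Set.mem_ofPred_eq, mem_diagramDrawing, zero_add]
  constructor
  · rintro ⟨w, ⟨s, hs, h1⟩, h2⟩
    rw [Prod.mk.injEq] at h1
    rw [h1.2, rightAttachment_diagramDrawing T hs] at h2
    exact ⟨s, hs, Prod.ext (by dsimp only; omega) h2⟩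
  · rintro ⟨s, hs, rfl⟩
    exact ⟨2 * s + 1, ⟨s, hs, rfl⟩, (rightAttachment_diagramDrawing T hs).symm⟩

/-- The agreement with a smooth drawing is required only for arcs between the leaves of `T`, so that
the hypothesis passes to both subtrees although `S` contains arcs of the ambient tree. -/
theorem treeOfSmooth_eq (S : Set (ℕ × ℕ)) (T : BinTree) : ∀ i,
    (∀ p : ℕ × ℕ, i ≤ p.1 → p.2 ≤ i + T.numNodes → (p ∈ S ↔ p ∈ smoothArcs T i)) →
    treeOfSmooth S i T.numNodes = T := by
  classical
  induction T with
  | nil => exact fun i _ => by rw [BinaryTree.numNodes, treeOfSmooth]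
  | node x L R ihL ihR =>
    intro i hS
    rw [numNodes_node] at hS ⊢
    have hg : Nat.findGreatest (fun k => (i, i + k) ∈ S) (L.numNodes + R.numNodes) =
        L.numNodes := by
      rw [Nat.findGreatest_eq_iff]
      -- If `L` is a leaf, no proper arc starts at `i` and `Nat.findGreatest` returns its default
      -- value `0`, which is the right size. Otherwise the root arc of `L` is the longest proper arc
      -- from `i`.
      refine ⟨by omega, fun h0 => ?_, fun k hk1 hk2 h => ?_⟩
      · rw [hS _ le_rfl (by dsimp only; omega), smoothArcs]
        refine Or.inr (Or.inl ?_)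
        cases L with
        | nil => exact absurd rfl h0
        | node y A B =>
          rw [smoothArcs]
          exact Or.inl rfl
      · rw [hS _ le_rfl (by dsimp only; omega), mem_smoothArcs] at h
        obtain ⟨s, hs, h⟩ := h
        rw [Prod.mk.injEq] at h
        rcases node_cases L R hs with h1 | rfl | ⟨r, hr, rfl⟩
        · rw [rightEnd_node_left _ _ h1] at h
          have := rightEnd_bounds L s h1
          omega
        · rw [rightEnd_node_root] at h
          omega
        · rw [leftEnd_node_right] at h
          omega
    rw [treeOfSmooth]
    have hg' := hg
    simp only [hg', Nat.add_sub_cancel_left]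
    rw [ihL, ihR]
    · intro p h1 h2
      rw [hS p (by omega) (by omega), mem_smoothArcs, mem_smoothArcs]
      constructor
      · rintro ⟨s, hs, rfl⟩
        dsimp only at h1
        rcases node_cases L R hs with h3 | rfl | ⟨r, hr, rfl⟩
        · rw [leftEnd_node_left _ _ h3] at h1
          have := leftEnd_le L s h3
          omega
        · rw [leftEnd_node_root] at h1
          omega
        · refine ⟨r, hr, ?_⟩
          rw [leftEnd_node_right, rightEnd_node_right]
          simp only [add_assoc]
      · rintro ⟨r, hr, rfl⟩
        refine ⟨L.numNodes + 1 + r, by rw [numNodes_node]; omega, ?_⟩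
        rw [leftEnd_node_right, rightEnd_node_right]
        simp only [add_assoc]
    · intro p h1 h2
      rw [hS p (by omega) (by omega), mem_smoothArcs, mem_smoothArcs]
      constructor
      · rintro ⟨s, hs, rfl⟩
        dsimp only at h2
        rcases node_cases L R hs with h3 | rfl | ⟨r, hr, rfl⟩
        · exact ⟨s, h3, by rw [leftEnd_node_left _ _ h3, rightEnd_node_left _ _ h3]⟩
        · rw [rightEnd_node_root] at h2
          omega
        · rw [rightEnd_node_right] at h2
          omega
      · rintro ⟨r, hr, rfl⟩
        exact ⟨r, by rw [numNodes_node]; omega,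
          by rw [leftEnd_node_left _ _ hr, rightEnd_node_left _ _ hr]⟩

theorem treeOfDiagram_diagramDrawing {n : ℕ} {T : BinTree} (h : T.numNodes = n) :
    treeOfDiagram n (diagramDrawing T) = T := by
  subst h
  rw [treeOfDiagram, smoothOfDiagram_diagramDrawing]
  exact treeOfSmooth_eq _ T 0 fun _ _ _ => Iff.rfl

/-- The bound on the abscissas is needed because the subtraction of natural numbers is truncated. -/
theorem halfTurn_halfTurn {n : ℕ} {A : Set (ℕ × ℕ)} (hA : ∀ p ∈ A, p.1 ≤ 2 * n ∧ p.2 ≤ 2 * n) :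
    halfTurn n (halfTurn n A) = A := by
  rw [halfTurn, halfTurn, ← Set.image_comp]
  conv_rhs => rw [← Set.image_id A]
  refine Set.image_congr fun p hp => ?_
  have := hA p hp
  ext <;> simp only [Function.comp, id] <;> omega

theorem psi_phi {n : ℕ} {X : BinTree × BinTree} (h : X.1.numNodes = n)
    (h' : X.2.numNodes = n) : psi n (phi n X) = X := by
  obtain ⟨T, T'⟩ := X
  dsimp only at h h'
  rw [psi, phi]
  dsimp only
  rw [halfTurn_halfTurn, treeOfDiagram_diagramDrawing h',
    treeOfDiagram_diagramDrawing ((numNodes_mir T).trans h), mir_mir]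
  intro p hp
  obtain ⟨s, hs, rfl⟩ := (mem_diagramDrawing _ _).1 hp
  have h1 := leftEnd_le _ s hs
  rw [numNodes_mir] at hs
  dsimp only
  omega

/-! ### Realizing a meandering diagram by a pair of trees -/

/-- The function `u` alone determines a tree. Pairing it with the shortest lower arcs, `s + 1` in
place of `d s`, makes compatibility trivial, so that the interval induction applies; the cutting
point `t` is the root, with the trees built on `[a, t]` and `[t + 1, b]` as its subtrees. -/
theorem exists_leftEnd_eq {n : ℕ} {u d : ℕ → ℕ} (hM : IsMeander n u d) :
    ∃ T : BinTree, T.numNodes = n ∧ ∀ s < n, leftEnd T s = u s := by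
  have hM' : IsMeander n u (fun s => s + 1) :=
    ⟨hM.u_le, fun _ _ => Nat.lt_succ_self _, fun _ h => h, hM.u_nc, fun _ _ h _ => Or.inr h⟩
  have key : ∀ a b, a ≤ b → b ≤ n → IsClosedInterval u (fun s => s + 1) a b →
      ∃ T : BinTree, a + T.numNodes = b ∧ ∀ s < T.numNodes, a + leftEnd T s = u (a + s) := by
    refine hM'.interval_induction (fun _ _ h _ => Or.inr h)
      (fun a _ => ⟨.nil, rfl, fun s h => absurd h (Nat.not_lt_zero _)⟩) ?_
    rintro a b t h1 h2 hb h3 h4 h5 hI ⟨L, hL, hL'⟩ ⟨R, hR, hR'⟩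
    refine ⟨.node () L R, by rw [numNodes_node]; omega, fun s hs => ?_⟩
    rcases node_cases L R hs with h6 | rfl | ⟨r, hr, rfl⟩
    · rw [leftEnd_node_left _ _ h6, hL' s h6]
    · rw [leftEnd_node_root, hL, h3, add_zero]
    · rw [leftEnd_node_right]
      have h7 := hR' r hr
      rw [show a + (L.numNodes + 1 + r) = t + 1 + r by omega, ← h7]
      omega
  obtain ⟨T, hT, hT'⟩ := key 0 n (Nat.zero_le _) le_rfl hM'.isClosedInterval
  rw [zero_add] at hT
  subst hT
  exact ⟨T, rfl, fun s hs => by simpa using hT' s hs⟩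

/-- The half-turn of a meandering diagram. -/
theorem IsMeander.reverse {n : ℕ} {u d : ℕ → ℕ} (hM : IsMeander n u d) :
    IsMeander n (fun s => n - d (n - 1 - s)) (fun s => n - u (n - 1 - s)) where
  u_le s hs := by
    have := hM.lt_d (n - 1 - s) (by omega)
    omega
  lt_d s hs := by
    have := hM.u_le (n - 1 - s) (by omega)
    omega
  d_le s hs := Nat.sub_le _ _
  u_nc s t hst ht := by
    have h1 := hM.d_le (n - 1 - s) (by omega)
    have h2 := hM.d_le (n - 1 - t) (by omega)
    have h3 := hM.d_nc (n - 1 - t) (n - 1 - s) (by omega) (by omega)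
    omega
  d_nc s t hst ht := by
    have h1 := hM.u_le (n - 1 - s) (by omega)
    have h2 := hM.u_le (n - 1 - t) (by omega)
    have h3 := hM.u_nc (n - 1 - t) (n - 1 - s) (by omega) (by omega)
    omega

theorem arcs_congr {n : ℕ} {u d u' d' : ℕ → ℕ} (hu : ∀ s < n, u s = u' s)
    (hd : ∀ s < n, d s = d' s) : arcs n u d = arcs n u' d' := by
  ext p
  · exact exists_congr fun s => and_congr_right fun hs => by rw [hu s hs]
  · exact exists_congr fun s => and_congr_right fun hs => by rw [hd s hs]

/-- The upper tree comes from `u`. The lower one is obtained by the same construction from the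
half-turn of the diagram, followed by a mirror. -/
theorem exists_phi_eq_arcs {n : ℕ} {u d : ℕ → ℕ} (hM : IsMeander n u d) :
    ∃ T T' : BinTree, T.numNodes = n ∧ T'.numNodes = n ∧ (∀ s < n, leftEnd T' s = u s) ∧
      (∀ s < n, rightEnd T s = d s) ∧ phi n (T, T') = arcs n u d := by
  obtain ⟨T', hT', hu⟩ := exists_leftEnd_eq hM
  obtain ⟨T, hT, hd⟩ := exists_leftEnd_eq hM.reverse
  have hT2 : (mir T).numNodes = n := (numNodes_mir T).trans hT
  have hd2 : ∀ s < n, rightEnd (mir T) s = d s := by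
    intro s hs
    have h1 := leftEnd_mir (mir T) (n - 1 - s) s (by omega)
    rw [mir_mir, hd _ (by omega), hT2, show n - 1 - (n - 1 - s) = s by omega] at h1
    have := hM.d_le s hs
    omega
  exact ⟨mir T, T', hT2, hT', hu, hd2, (phi_eq_arcs hT2 hT').trans (arcs_congr hu hd2)⟩

/-! ### The Tamari order -/

theorem RightRotation.numNodes_eq {T T' : BinTree} (h : RightRotation T T') :
    T.numNodes = T'.numNodes := by
  induction h with
  | root A B C => simp only [numNodes_node]; omega
  | left R h ih => rw [numNodes_node, numNodes_node, ih]
  | right L h ih => rw [numNodes_node, numNodes_node, ih]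

/-- In a rotation of `((A, B), C)` a single left end changes: that of the upper node, which loses
the leaves of `A`. -/
theorem RightRotation.leftEnd_le {T T' : BinTree} (h : RightRotation T T') :
    ∀ s < T.numNodes, leftEnd T s ≤ leftEnd T' s := by
  induction h with
  | root A B C =>
    intro s hs
    rcases node_cases _ C hs with h1 | rfl | ⟨r, hr, rfl⟩
    · rw [leftEnd_node_left _ _ h1]
      rcases node_cases A B h1 with h2 | rfl | ⟨r, hr, rfl⟩
      · rw [leftEnd_node_left _ _ h2, leftEnd_node_left _ _ h2]
      · rw [leftEnd_node_root, leftEnd_node_root]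
      · rw [leftEnd_node_right, leftEnd_node_right, leftEnd_node_left _ _ hr]
    · rw [leftEnd_node_root]
      exact Nat.zero_le _
    · rw [leftEnd_node_right, numNodes_node,
        show A.numNodes + B.numNodes + 1 + 1 + r = A.numNodes + 1 + (B.numNodes + 1 + r) by omega,
        leftEnd_node_right, leftEnd_node_right]
      omega
  | @left L L' R h ih =>
    intro s hs
    have he := h.numNodes_eq
    rcases node_cases _ _ hs with h1 | rfl | ⟨r, hr, rfl⟩
    · rw [leftEnd_node_left _ _ h1, leftEnd_node_left _ _ (he ▸ h1)]
      exact ih s h1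
    · rw [leftEnd_node_root]
      exact Nat.zero_le _
    · rw [leftEnd_node_right, he, leftEnd_node_right]
  | @right L R R' h ih =>
    intro s hs
    rcases node_cases _ _ hs with h1 | rfl | ⟨r, hr, rfl⟩
    · rw [leftEnd_node_left _ _ h1, leftEnd_node_left _ _ h1]
    · rw [leftEnd_node_root]
      exact Nat.zero_le _
    · rw [leftEnd_node_right, leftEnd_node_right]
      exact Nat.add_le_add_left (ih r hr) _

theorem TamariLE.numNodes_eq {T T' : BinTree} (h : TamariLE T T') :
    T.numNodes = T'.numNodes := by
  induction h with
  | refl => rfl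
  | tail _ h ih => exact ih.trans h.numNodes_eq

theorem TamariLE.leftEnd_le {T T' : BinTree} (h : TamariLE T T') :
    ∀ s < T.numNodes, leftEnd T s ≤ leftEnd T' s := by
  induction h with
  | refl => exact fun _ _ => le_rfl
  | tail h1 h2 ih =>
    exact fun s hs => (ih s hs).trans (h2.leftEnd_le s (TamariLE.numNodes_eq h1 ▸ hs))

/-- Left ends increase along the Tamari order, so a violation for `(T, T')` would give one for `(T,
T)`, that is, two crossing intervals of leaves in `T`. -/
theorem TamariLE.compatible {T T' : BinTree} (h : TamariLE T T') :
    Compatible T.numNodes (leftEnd T') (rightEnd T) := by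
  intro s t hst ht
  have h1 := h.leftEnd_le t ht
  have h2 := ends_nested T s t hst ht
  omega

theorem TamariLE.node {L L' R R' : BinTree} (hL : TamariLE L L') (hR : TamariLE R R') :
    TamariLE (.node () L R) (.node () L' R') :=
  (hL.lift (fun L => BinaryTree.node () L R) fun _ _ h => RightRotation.left R h).trans
    (hR.lift (fun R => BinaryTree.node () L' R) fun _ _ h => RightRotation.right L' h)

/-- A node on the left branch of a tree can be moved to the root by right rotations. -/
theorem exists_tamariLE_node (T : BinTree) : ∀ t < T.numNodes, (∀ s < t, rightEnd T s ≤ t) →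
    ∃ A B : BinTree, TamariLE T (.node () A B) ∧ A.numNodes = t ∧
      ∀ s < T.numNodes, s ≠ t → rightEnd (.node () A B) s = rightEnd T s := by
  induction T with
  | nil => exact fun t h => absurd h (Nat.not_lt_zero _)
  | node x L R ihL ihR =>
    intro t ht h
    rcases node_cases L R ht with h1 | rfl | ⟨r, hr, rfl⟩
    · obtain ⟨A, B, hAB, hA, hd⟩ := ihL t h1 fun s hs => by
        rw [← rightEnd_node_left L R (hs.trans h1)]
        exact h s hs
      have hsz := hAB.numNodes_eq
      rw [numNodes_node] at hsz
      -- Once `t` is the root of the left subtree, one rotation at the root lifts it to the top. It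
      -- affects the right end of `t` only.
      refine ⟨A, .node () B R, ((TamariLE.node hAB .refl).tail (RightRotation.root A B R)), hA,
        fun s hs hst => ?_⟩
      rcases node_cases L R hs with h2 | rfl | ⟨q, hq, rfl⟩
      · rw [rightEnd_node_left _ _ h2, ← hd s h2 hst]
        rcases node_cases A B (s := s) (by rw [numNodes_node]; omega) with h3 | rfl | ⟨q, hq, rfl⟩
        · rw [rightEnd_node_left _ _ h3, rightEnd_node_left _ _ h3]
        · exact absurd hA hst
        · rw [rightEnd_node_right, rightEnd_node_right, rightEnd_node_left _ _ hq]
      · rw [rightEnd_node_root, hsz, show A.numNodes + B.numNodes + 1 =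
          A.numNodes + 1 + B.numNodes by omega, rightEnd_node_right, rightEnd_node_root]
        omega
      · rw [rightEnd_node_right, hsz, show A.numNodes + B.numNodes + 1 + 1 + q =
          A.numNodes + 1 + (B.numNodes + 1 + q) by omega, rightEnd_node_right,
          rightEnd_node_right]
        omega
    · exact ⟨L, R, .refl, rfl, fun _ _ _ => rfl⟩
    -- The node `t` cannot lie in the right subtree: the root precedes it and its right end is the
    -- last leaf, beyond `t`.
    · have := h L.numNodes (by omega)
      rw [rightEnd_node_root] at this
      omega

/-- Recursion on `T'`. The root of `T'` has left end `0`, so compatibility at its number forces the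
earlier nodes of `T` to end before it, and `exists_tamariLE_node` rotates the node of this number to
the root of `T`. The other right ends are unchanged, so compatibility is inherited by both subtrees.
-/
theorem tamariLE_of_compatible (T' : BinTree) : ∀ T : BinTree, T.numNodes = T'.numNodes →
    Compatible T.numNodes (leftEnd T') (rightEnd T) → TamariLE T T' := by
  induction T' with
  | nil =>
    intro T hT _
    cases T with
    | nil => exact .refl
    | node x L R => exact absurd hT (Nat.succ_ne_zero _)
  | node x L' R' ihL ihR =>
    intro T hT hC
    rw [numNodes_node] at hT
    obtain ⟨A, B, hAB, hA, hd⟩ := exists_tamariLE_node T L'.numNodes (by omega) fun s hs => by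
      have := hC s L'.numNodes hs (by omega)
      rw [leftEnd_node_root] at this
      omega
    have hsz := hAB.numNodes_eq
    rw [numNodes_node] at hsz
    refine hAB.trans (TamariLE.node (ihL A hA ?_) (ihR B (by omega) ?_))
    · intro s t hst ht
      have h1 := hC s t hst (by omega)
      rw [leftEnd_node_left _ _ (hA ▸ ht), ← hd s (by omega) (by omega),
        rightEnd_node_left _ _ (hst.trans ht)] at h1
      exact h1
    · intro s t hst ht
      have h1 := hC (L'.numNodes + 1 + s) (L'.numNodes + 1 + t) (by omega) (by omega)
      rw [leftEnd_node_right, ← hd _ (by omega) (by omega), ← hA, rightEnd_node_right] at h1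
      omega

theorem phi_mem_meanderingTrees {n : ℕ} {X : BinTree × BinTree} (hX : X ∈ tamariIntervals n) :
    phi n X ∈ meanderingTrees n := by
  obtain ⟨T, T'⟩ := X
  obtain ⟨h1, h2, h3⟩ := hX
  dsimp only at h1 h2 h3
  subst h1
  exact mem_meanderingTrees_iff.2
    ⟨_, _, isMeander_ends h2.symm, h3.compatible, phi_eq_arcs rfl h2⟩

theorem exists_phi_eq {n : ℕ} {M : ArcDiagram} (hM : M ∈ meanderingTrees n) :
    ∃ X ∈ tamariIntervals n, phi n X = M := by
  obtain ⟨u, d, hud, hC, rfl⟩ := mem_meanderingTrees_iff.1 hM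
  obtain ⟨T, T', h1, h2, hu, hd, h3⟩ := exists_phi_eq_arcs hud
  refine ⟨(T, T'), ⟨h1, h2, tamariLE_of_compatible T' T (h1.trans h2.symm) ?_⟩, h3⟩
  intro s t hst ht
  rw [h1] at ht
  rw [hu t ht, hd s (hst.trans ht)]
  exact hC s t hst ht

/-! ### The opening of a meandering tree -/

theorem pick_eq {α : Type*} {d x : α} {P : α → Prop} (hx : P x) (hu : ∀ y, P y → y = x) :
    pick d P = x := by
  have h : ∃ x, P x := ⟨x, hx⟩
  rw [pick, dif_pos h]
  exact hu _ h.choose_spec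

theorem pick_eq_default {α : Type*} {d : α} {P : α → Prop} (h : ∀ y, ¬ P y) : pick d P = d := by
  rw [pick, dif_neg (not_exists.2 h)]

namespace BudMap

variable {B : BudMap}

theorem node_next (h : B.HalfEdge) : B.node (B.next h) = B.node h :=
  (Quot.sound (r := fun h h' => B.next h = h') rfl).symm

theorem node_next_iterate (m : ℕ) (h : B.HalfEdge) : B.node (B.next^[m] h) = B.node h := by
  induction m generalizing h with
  | zero => rfl
  | succ m ih => rw [Function.iterate_succ_apply, ih, node_next]

theorem Run.node_eq {c : Kind} {b b' : B.HalfEdge} (h : B.Run c b b') : B.node b = B.node b' := by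
  obtain ⟨m, rfl, -⟩ := h
  exact (node_next_iterate _ _).symm

theorem Run.single {c : Kind} {b b' : B.HalfEdge} (h : B.next b = b') : B.Run c b b' :=
  ⟨0, h, fun _ hi => absurd hi (Nat.not_lt_zero _)⟩

theorem Run.cons {c : Kind} {b x b' : B.HalfEdge} (h : B.next b = x) (hx : B.kind x = c)
    (hr : B.Run c x b') : B.Run c b b' := by
  obtain ⟨m, h1, h2⟩ := hr
  refine ⟨m + 1, by rw [Function.iterate_succ_apply, h, h1], fun i hi => ?_⟩
  cases i with
  | zero => rw [Function.iterate_one, h, hx]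
  | succ i => rw [Function.iterate_succ_apply, h, h2 i (by omega)]

end BudMap

namespace DrawnHalfEdge

variable {n : ℕ} {u d : ℕ → ℕ}

/-- The right bud at the black point number `k`. -/
def rightAt (u d : ℕ → ℕ) (k : ℕ) (hk : k ≤ n) : DrawnHalfEdge n (arcs n u d) :=
  rightBud ⟨k, Nat.lt_succ_of_le hk⟩

/-- The left bud at the black point number `k`. -/
def leftAt (u d : ℕ → ℕ) (k : ℕ) (hk : k ≤ n) : DrawnHalfEdge n (arcs n u d) :=
  leftBud ⟨k, Nat.lt_succ_of_le hk⟩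

/-- The upper arc at the white point number `s`. -/
def upperAt (u d : ℕ → ℕ) (s : ℕ) (hs : s < n) : DrawnHalfEdge n (arcs n u d) :=
  upperArc ⟨(2 * u s, 2 * s + 1), s, hs, rfl⟩

/-- The lower arc at the white point number `s`. -/
def lowerAt (u d : ℕ → ℕ) (s : ℕ) (hs : s < n) : DrawnHalfEdge n (arcs n u d) :=
  lowerArc ⟨(2 * s + 1, 2 * d s), s, hs, rfl⟩

@[elab_as_elim]
theorem drawnCases {motive : DrawnHalfEdge n (arcs n u d) → Prop}
    (right : ∀ k hk, motive (rightAt u d k hk)) (upper : ∀ s hs, motive (upperAt u d s hs))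
    (left : ∀ k hk, motive (leftAt u d k hk)) (lower : ∀ s hs, motive (lowerAt u d s hs))
    (x : DrawnHalfEdge n (arcs n u d)) : motive x := by
  rcases x with k | ⟨_, s, hs, rfl⟩ | k | ⟨_, s, hs, rfl⟩
  · exact right k (Nat.le_of_lt_succ k.2)
  · exact upper s hs
  · exact left k (Nat.le_of_lt_succ k.2)
  · exact lower s hs

section simp_lemmas

variable (u d)

@[simp] theorem black_rightAt (k : ℕ) (hk : k ≤ n) : (rightAt u d k hk).black = 2 * k := rfl
@[simp] theorem black_leftAt (k : ℕ) (hk : k ≤ n) : (leftAt u d k hk).black = 2 * k := rfl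
@[simp] theorem black_upperAt (s : ℕ) (hs : s < n) : (upperAt u d s hs).black = 2 * u s := rfl
@[simp] theorem black_lowerAt (s : ℕ) (hs : s < n) : (lowerAt u d s hs).black = 2 * d s := rfl
@[simp] theorem angle_rightAt (k : ℕ) (hk : k ≤ n) : (rightAt u d k hk).angle = 0 := rfl
@[simp] theorem angle_leftAt (k : ℕ) (hk : k ≤ n) :
    (leftAt u d k hk).angle = 2 * (n : ℤ) + 1 := rfl
@[simp] theorem angle_upperAt (s : ℕ) (hs : s < n) :
    (upperAt u d s hs).angle = 2 * (s : ℤ) + 1 := by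
  change ((2 * s + 1 : ℕ) : ℤ) = _
  push_cast
  rfl
@[simp] theorem angle_lowerAt (s : ℕ) (hs : s < n) :
    (lowerAt u d s hs).angle = 4 * (n : ℤ) + 1 - 2 * (s : ℤ) := by
  change 4 * (n : ℤ) + 2 - ((2 * s + 1 : ℕ) : ℤ) = _
  push_cast
  ring

end simp_lemmas

/-- The angles lie in four disjoint ranges: `0` for right buds, the odd numbers below `2 n` for
upper arcs, `2 n + 1` for left buds, and the odd numbers from `2 n + 3` to `4 n + 1` for lower arcs.
An angle identifies an arc completely, and a bud up to its black point. -/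
theorem eq_of_angle_eq {x y : DrawnHalfEdge n (arcs n u d)} (hb : x.black = y.black)
    (ha : x.angle = y.angle) : x = y := by
  induction x using drawnCases with
  | right k hk =>
    induction y using drawnCases with
    | right l hl =>
      obtain rfl : k = l := by simpa using hb
      rfl
    | upper t ht => simp at ha; omega
    | left l hl => simp at ha; omega
    | lower t ht => simp at ha; omega
  | upper s hs =>
    induction y using drawnCases with
    | right l hl => simp at ha; omega
    | upper t ht =>
      obtain rfl : s = t := by simpa using ha
      rfl
    | left l hl => simp at ha; omega
    | lower t ht => simp at ha; omega
  | left k hk =>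
    induction y using drawnCases with
    | right l hl => simp at ha; omega
    | upper t ht => simp at ha; omega
    | left l hl =>
      obtain rfl : k = l := by simpa using hb
      rfl
    | lower t ht => simp at ha; omega
  | lower s hs =>
    induction y using drawnCases with
    | right l hl => simp at ha; omega
    | upper t ht => simp at ha; omega
    | left l hl => simp at ha; omega
    | lower t ht =>
      obtain rfl : s = t := by simpa using ha
      rfl

instance finite_arcs : Finite (DrawnHalfEdge n (arcs n u d)) := by
  let f : (Fin (n + 1) ⊕ Fin n) ⊕ (Fin (n + 1) ⊕ Fin n) → DrawnHalfEdge n (arcs n u d) :=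
    Sum.elim (Sum.elim (fun k => rightAt u d k (by omega)) fun s => upperAt u d s s.2)
      (Sum.elim (fun k => leftAt u d k (by omega)) fun s => lowerAt u d s s.2)
  refine Finite.of_surjective f fun x => ?_
  induction x using drawnCases with
  | right k hk => exact ⟨.inl (.inl ⟨k, by omega⟩), rfl⟩
  | upper s hs => exact ⟨.inl (.inr ⟨s, hs⟩), rfl⟩
  | left k hk => exact ⟨.inr (.inl ⟨k, by omega⟩), rfl⟩
  | lower s hs => exact ⟨.inr (.inr ⟨s, hs⟩), rfl⟩

/-- The successor has the least larger angle at the same black point, or the least angle overall if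
`x` is the last one. -/
theorem exists_isNext (x : DrawnHalfEdge n (arcs n u d)) : ∃ y, x.IsNext y := by
  by_cases h : ∃ z : DrawnHalfEdge n (arcs n u d), z.black = x.black ∧ x.angle < z.angle
  · obtain ⟨y, ⟨h1, h2⟩, h3⟩ := Set.exists_min_image
      {z : DrawnHalfEdge n (arcs n u d) | z.black = x.black ∧ x.angle < z.angle} angle
      (Set.toFinite _) h
    exact ⟨y, h1, Or.inl ⟨h2, fun z hz hxz => h3 z ⟨hz, hxz⟩⟩⟩
  · push Not at h
    obtain ⟨y, h1, h2⟩ := Set.exists_min_image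
      {z : DrawnHalfEdge n (arcs n u d) | z.black = x.black} angle (Set.toFinite _) ⟨x, rfl⟩
    exact ⟨y, h1, Or.inr ⟨h, fun z hz => h2 z hz⟩⟩

theorem IsNext.eq {x y z : DrawnHalfEdge n (arcs n u d)} (hy : x.IsNext y) (hz : x.IsNext z) :
    y = z := by
  obtain ⟨by1, hy⟩ := hy
  obtain ⟨bz, hz⟩ := hz
  refine eq_of_angle_eq (by1.trans bz.symm) ?_
  rcases hy with ⟨h1, h2⟩ | ⟨h1, h2⟩ <;> rcases hz with ⟨h3, h4⟩ | ⟨h3, h4⟩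
  · exact le_antisymm (h2 z bz h3) (h4 y by1 h1)
  · exact absurd (h3 y by1) h1.not_ge
  · exact absurd (h1 z bz) h3.not_ge
  · exact le_antisymm (h2 z bz) (h4 y by1)

theorem IsNext.injective {x y z : DrawnHalfEdge n (arcs n u d)} (hx : x.IsNext z)
    (hy : y.IsNext z) : x = y := by
  obtain ⟨bx, hx⟩ := hx
  obtain ⟨b', hy⟩ := hy
  have hb : x.black = y.black := bx.symm.trans b'
  refine eq_of_angle_eq hb ?_
  rcases hx with ⟨h1, h2⟩ | ⟨h1, h2⟩ <;> rcases hy with ⟨h3, h4⟩ | ⟨h3, h4⟩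
  · rcases lt_trichotomy x.angle y.angle with h | h | h
    · exact absurd (h2 y hb.symm h) h3.not_ge
    · exact h
    · exact absurd (h4 x hb h) h1.not_ge
  · exact absurd (h4 x hb) h1.not_ge
  · exact absurd (h2 y hb.symm) h3.not_ge
  · exact le_antisymm (h3 x hb) (h1 y hb.symm)

theorem IsNext.of_lt {x y : DrawnHalfEdge n (arcs n u d)} (hb : y.black = x.black)
    (ha : x.angle < y.angle)
    (hz : ∀ z : DrawnHalfEdge n (arcs n u d), z.black = x.black → x.angle < z.angle →
      y.angle ≤ z.angle) : x.IsNext y :=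
  ⟨hb, Or.inl ⟨ha, hz⟩⟩

end DrawnHalfEdge

open DrawnHalfEdge

section opened

variable {n : ℕ} {u d : ℕ → ℕ}

theorem opened_next_eq_iff {x y : DrawnHalfEdge n (arcs n u d)} :
    (opened n (arcs n u d)).next x = y ↔ x.IsNext y := by
  obtain ⟨z, hz⟩ := exists_isNext x
  have h1 : (opened n (arcs n u d)).next x = z := pick_eq hz fun w hw => hw.eq hz
  rw [h1]
  exact ⟨fun h => h ▸ hz, fun h => hz.eq h⟩

theorem isNext_opened_next (x : DrawnHalfEdge n (arcs n u d)) :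
    x.IsNext ((opened n (arcs n u d)).next x) :=
  opened_next_eq_iff.1 rfl

theorem opened_twin_upperAt {s : ℕ} (hs : s < n) :
    (opened n (arcs n u d)).twin (upperAt u d s hs) = lowerAt u d s hs := by
  refine pick_eq (show 2 * s + 1 = 2 * s + 1 from rfl) fun y hy => ?_
  induction y using drawnCases with
  | lower t ht =>
    replace hy : 2 * s + 1 = 2 * t + 1 := hy
    obtain rfl : s = t := by omega
    rfl
  | right k hk => exact hy.elim
  | left k hk => exact hy.elim
  | upper t ht => exact hy.elim

theorem opened_twin_lowerAt {s : ℕ} (hs : s < n) :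
    (opened n (arcs n u d)).twin (lowerAt u d s hs) = upperAt u d s hs := by
  refine pick_eq (show 2 * s + 1 = 2 * s + 1 from rfl) fun y hy => ?_
  induction y using drawnCases with
  | upper t ht =>
    replace hy : 2 * t + 1 = 2 * s + 1 := hy
    obtain rfl : s = t := by omega
    rfl
  | right k hk => exact hy.elim
  | left k hk => exact hy.elim
  | lower t ht => exact hy.elim

theorem opened_twin_rightAt {k : ℕ} (hk : k ≤ n) :
    (opened n (arcs n u d)).twin (rightAt u d k hk) = rightAt u d k hk :=
  pick_eq_default fun y hy => by cases y <;> exact hy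

theorem opened_twin_leftAt {k : ℕ} (hk : k ≤ n) :
    (opened n (arcs n u d)).twin (leftAt u d k hk) = leftAt u d k hk :=
  pick_eq_default fun y hy => by cases y <;> exact hy

/-! #### The cyclic order around the black points -/

theorem IsMeander.next_rightAt_eq_upperAt (hM : IsMeander n u d) {s : ℕ} (hs : s < n)
    (h : u s = s) : (opened n (arcs n u d)).next (rightAt u d s hs.le) = upperAt u d s hs := by
  refine opened_next_eq_iff.2 (.of_lt (by simp [h]) (by simp) fun z hz ha => ?_)
  induction z using drawnCases with
  | right k hk => simp at ha
  | upper t ht => have := hM.u_le t ht; simp at hz ⊢; omega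
  | left k hk => simp; omega
  | lower t ht => simp; omega

theorem next_rightAt_eq_leftAt {k : ℕ} (hk : k ≤ n) (h : ∀ s < n, u s ≠ k) :
    (opened n (arcs n u d)).next (rightAt u d k hk) = leftAt u d k hk := by
  refine opened_next_eq_iff.2 (.of_lt rfl (by simp) fun z hz ha => ?_)
  induction z using drawnCases with
  | right k hk => simp at ha
  | upper t ht => simp at hz; exact absurd hz (h t ht)
  | left k hk => simp
  | lower t ht => simp; omega

theorem next_upperAt_eq_upperAt {s t : ℕ} (hst : s < t) (ht : t < n) (h : u t = u s)
    (hr : ∀ r, s < r → r < t → u r ≠ u s) :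
    (opened n (arcs n u d)).next (upperAt u d s (hst.trans ht)) = upperAt u d t ht := by
  refine opened_next_eq_iff.2 (.of_lt (by simp [h]) (by simp; omega) fun z hz ha => ?_)
  induction z using drawnCases with
  | right k hk => simp at ha; omega
  | upper r hr' => have := hr r; simp at hz ha ⊢; omega
  | left k hk => simp; omega
  | lower t ht => simp; omega

theorem next_upperAt_eq_leftAt {s k : ℕ} (hs : s < n) (hk : k ≤ n) (h : u s = k)
    (hr : ∀ r, s < r → r < n → u r ≠ k) :
    (opened n (arcs n u d)).next (upperAt u d s hs) = leftAt u d k hk := by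
  refine opened_next_eq_iff.2 (.of_lt (by simp [h]) (by simp; omega) fun z hz ha => ?_)
  induction z using drawnCases with
  | right k hk => simp at ha; omega
  | upper r hr' => have := hr r; simp at hz ha ⊢; omega
  | left k hk => simp
  | lower t ht => simp; omega

theorem IsMeander.next_leftAt_eq_lowerAt (hM : IsMeander n u d) {s : ℕ} (hs : s < n)
    (h : d s = s + 1) :
    (opened n (arcs n u d)).next (leftAt u d (s + 1) hs) = lowerAt u d s hs := by
  refine opened_next_eq_iff.2 (.of_lt (by simp [h]) (by simp; omega) fun z hz ha => ?_)
  induction z using drawnCases with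
  | right k hk => simp at ha; omega
  | upper t ht => simp at ha; omega
  | left k hk => simp at ha
  | lower t ht => have := hM.lt_d t ht; simp at hz ⊢; omega

theorem next_leftAt_eq_rightAt {k : ℕ} (hk : k ≤ n) (h : ∀ s < n, d s ≠ k) :
    (opened n (arcs n u d)).next (leftAt u d k hk) = rightAt u d k hk := by
  refine opened_next_eq_iff.2 ⟨rfl, Or.inr ⟨fun z hz => ?_, fun z hz => ?_⟩⟩ <;>
    induction z using drawnCases with
    | right k hk => simp; try omega
    | upper t ht => simp; omega
    | left k hk => simp; try omega
    | lower t ht => simp at hz; exact absurd hz (h t ht)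

theorem next_lowerAt_eq_lowerAt {s t : ℕ} (hst : s < t) (ht : t < n) (h : d s = d t)
    (hr : ∀ r, s < r → r < t → d r ≠ d t) :
    (opened n (arcs n u d)).next (lowerAt u d t ht) = lowerAt u d s (hst.trans ht) := by
  refine opened_next_eq_iff.2 (.of_lt (by simp [h]) (by simp; omega) fun z hz ha => ?_)
  induction z using drawnCases with
  | right k hk => simp at ha; omega
  | upper r hr' => simp at ha; omega
  | left k hk => simp at ha; omega
  | lower r hr' => have := hr r; simp at hz ha ⊢; omega

theorem next_lowerAt_eq_rightAt {s k : ℕ} (hs : s < n) (hk : k ≤ n) (h : d s = k)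
    (hr : ∀ r < s, d r ≠ k) :
    (opened n (arcs n u d)).next (lowerAt u d s hs) = rightAt u d k hk := by
  refine opened_next_eq_iff.2 ⟨by simp [h], Or.inr ⟨fun z hz => ?_, fun z hz => ?_⟩⟩ <;>
    induction z using drawnCases with
    | right k hk => simp; try omega
    | upper t ht => simp; omega
    | left k hk => simp; try omega
    | lower t ht => have := hr t; simp at hz ⊢; omega

/-- Induction on the angle left before the left bud: angles increase at each turn, cannot jump over
the left bud, and take only the values of upper arcs before it. -/
theorem opened_run_blue {k : ℕ} (hk : k ≤ n) (x : DrawnHalfEdge n (arcs n u d))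
    (hx : x.black = 2 * k) (ha : x.angle < 2 * (n : ℤ) + 1) :
    (opened n (arcs n u d)).Run Kind.blue x (leftAt u d k hk) := by
  suffices h : ∀ (m : ℕ) (x : DrawnHalfEdge n (arcs n u d)), x.black = 2 * k →
      x.angle < 2 * (n : ℤ) + 1 → 2 * (n : ℤ) + 1 - x.angle ≤ m →
      (opened n (arcs n u d)).Run Kind.blue x (leftAt u d k hk) from
    h (2 * (n : ℤ) + 1 - x.angle).toNat x hx ha (Int.self_le_toNat _)
  intro m
  induction m with
  | zero => intro x _ _ _; omega
  | succ m ih =>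
    intro x hx ha hm
    have hL : (leftAt u d k hk).black = x.black := hx.symm
    obtain ⟨y, hy⟩ : ∃ y, (opened n (arcs n u d)).next x = y := ⟨_, rfl⟩
    obtain ⟨h1, ⟨h2, h3⟩ | ⟨h2, -⟩⟩ := opened_next_eq_iff.1 hy
    · have h4 := h3 _ hL ha
      induction y using drawnCases with
      | right l hl =>
        induction x using drawnCases <;> simp at h2 <;> omega
      | upper s hs =>
        refine BudMap.Run.cons hy rfl (ih _ (h1.trans hx) ?_ ?_)
        · simp; omega
        · omega
      | left l hl =>
        have : (leftAt u d l hl).black = (leftAt u d k hk).black := h1.trans hx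
        rw [eq_of_angle_eq this rfl] at hy
        exact BudMap.Run.single hy
      | lower s hs => simp at h4; omega
    · exact absurd (h2 _ hL) (by simpa using ha)

/-- As in `opened_run_blue`, with `4 n + 2` as a strict upper bound for all angles; the right bud is
reached by the wrap-around case of `IsNext`. -/
theorem opened_run_red {k : ℕ} (hk : k ≤ n) (x : DrawnHalfEdge n (arcs n u d))
    (hx : x.black = 2 * k) (ha : 2 * (n : ℤ) + 1 ≤ x.angle) :
    (opened n (arcs n u d)).Run Kind.red x (rightAt u d k hk) := by
  suffices h : ∀ (m : ℕ) (x : DrawnHalfEdge n (arcs n u d)), x.black = 2 * k →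
      2 * (n : ℤ) + 1 ≤ x.angle → 4 * (n : ℤ) + 2 - x.angle ≤ m →
      (opened n (arcs n u d)).Run Kind.red x (rightAt u d k hk) from
    h (4 * (n : ℤ) + 2 - x.angle).toNat x hx ha (Int.self_le_toNat _)
  intro m
  induction m with
  | zero => intro x _ _ _; induction x using drawnCases <;> simp at * <;> omega
  | succ m ih =>
    intro x hx ha hm
    have hL : (rightAt u d k hk).black = x.black := hx.symm
    obtain ⟨y, hy⟩ : ∃ y, (opened n (arcs n u d)).next x = y := ⟨_, rfl⟩
    obtain ⟨h1, ⟨h2, -⟩ | ⟨-, h3⟩⟩ := opened_next_eq_iff.1 hy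
    · induction y using drawnCases with
      | right l hl => simp at h2; omega
      | upper s hs => simp at h2; omega
      | left l hl => simp at h2; omega
      | lower s hs =>
        refine BudMap.Run.cons hy rfl (ih _ (h1.trans hx) ?_ ?_)
        · simp; omega
        · omega
    · have h4 := h3 _ hL
      induction y using drawnCases with
      | right l hl =>
        have : (rightAt u d l hl).black = (rightAt u d k hk).black := h1.trans hx
        rw [eq_of_angle_eq this rfl] at hy
        exact BudMap.Run.single hy
      | upper s hs => simp at h4; omega
      | left l hl => simp at h4; omega
      | lower s hs => simp at h4; omega

theorem opened_splitBuds {k : ℕ} (hk : k ≤ n) :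
    (opened n (arcs n u d)).SplitBuds (rightAt u d k hk) (leftAt u d k hk) :=
  ⟨rfl, rfl, fun h => absurd (congrArg angle h) (by simp; omega),
    opened_run_blue hk _ rfl (by simp), opened_run_red hk _ rfl le_rfl⟩

end opened

/-! ### The opening of a meandering tree is a bicolored blossoming tree -/

section opened

variable {n : ℕ} {u d : ℕ → ℕ}

theorem IsMeander.exists_black_eq (hM : IsMeander n u d) (x : DrawnHalfEdge n (arcs n u d)) :
    ∃ k ≤ n, x.black = 2 * k := by
  induction x using drawnCases with
  | right k hk => exact ⟨k, hk, rfl⟩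
  | upper s hs => exact ⟨u s, (hM.u_le s hs).trans hs.le, rfl⟩
  | left k hk => exact ⟨k, hk, rfl⟩
  | lower s hs => exact ⟨d s, hM.d_le s hs, rfl⟩

theorem black_eq_of_node_eq {x y : DrawnHalfEdge n (arcs n u d)}
    (h : (opened n (arcs n u d)).node x = (opened n (arcs n u d)).node y) :
    x.black = y.black := by
  have h1 := congrArg (Quot.lift (fun x : DrawnHalfEdge n (arcs n u d) => x.black)
    fun x y (hxy : (opened n (arcs n u d)).next x = y) => (opened_next_eq_iff.1 hxy).1.symm) h
  exact h1

/-- Turning counterclockwise from any half-edge at a black point leads to its right bud, so all of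
them share one orbit of `next`. -/
theorem opened_node_eq_rightAt {k : ℕ} (hk : k ≤ n) {x : DrawnHalfEdge n (arcs n u d)}
    (hx : x.black = 2 * k) :
    (opened n (arcs n u d)).node x = (opened n (arcs n u d)).node (rightAt u d k hk) := by
  rcases lt_or_ge x.angle (2 * (n : ℤ) + 1) with h | h
  · exact (opened_run_blue hk x hx h).node_eq.trans (opened_splitBuds hk).2.2.2.2.node_eq
  · exact (opened_run_red hk x hx h).node_eq

theorem IsMeander.node_eq_iff (hM : IsMeander n u d) {x y : DrawnHalfEdge n (arcs n u d)} :
    (opened n (arcs n u d)).node x = (opened n (arcs n u d)).node y ↔ x.black = y.black := by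
  refine ⟨black_eq_of_node_eq, fun h => ?_⟩
  obtain ⟨k, hk, hx⟩ := hM.exists_black_eq x
  rw [opened_node_eq_rightAt hk hx, opened_node_eq_rightAt hk (h.symm.trans hx)]

/-- The nodes of the opening of a meandering diagram are its black points. -/
noncomputable def IsMeander.nodeEquiv (hM : IsMeander n u d) :
    Fin (n + 1) ≃ (opened n (arcs n u d)).Node :=
  Equiv.ofBijective
    (fun k => (opened n (arcs n u d)).node (rightAt u d k (Nat.le_of_lt_succ k.2))) <| by
    refine ⟨fun k l h => ?_, fun v => ?_⟩
    · have := black_eq_of_node_eq h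
      simp at this
      omega
    · induction v using Quot.ind with
      | _ x =>
        obtain ⟨k, hk, hx⟩ := hM.exists_black_eq x
        exact ⟨⟨k, by omega⟩, (opened_node_eq_rightAt hk hx).symm⟩

theorem IsMeander.node_eq_nodeEquiv_iff (hM : IsMeander n u d)
    {x : DrawnHalfEdge n (arcs n u d)} {k : Fin (n + 1)} :
    (opened n (arcs n u d)).node x = hM.nodeEquiv k ↔ x.black = 2 * (k : ℕ) :=
  hM.node_eq_iff

theorem upperAt_ne_bud {s : ℕ} (hs : s < n) :
    (opened n (arcs n u d)).kind (upperAt u d s hs) ≠ Kind.bud := fun h => Kind.noConfusion h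

theorem lowerAt_ne_bud {s : ℕ} (hs : s < n) :
    (opened n (arcs n u d)).kind (lowerAt u d s hs) ≠ Kind.bud := fun h => Kind.noConfusion h

/-- The upper arc at a white point, as a half of a plain edge. -/
def upperHalf (u d : ℕ → ℕ) (s : Fin n) : (opened n (arcs n u d)).PlainHalf :=
  ⟨upperAt u d s s.2, upperAt_ne_bud s.2⟩

/-- The lower arc at a white point, as a half of a plain edge. -/
def lowerHalf (u d : ℕ → ℕ) (s : Fin n) : (opened n (arcs n u d)).PlainHalf :=
  ⟨lowerAt u d s s.2, lowerAt_ne_bud s.2⟩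

theorem plainHalf_cases (h : (opened n (arcs n u d)).PlainHalf) :
    (∃ s, h = upperHalf u d s) ∨ ∃ s, h = lowerHalf u d s := by
  obtain ⟨x, hx⟩ := h
  change DrawnHalfEdge n (arcs n u d) at x
  induction x using drawnCases with
  | right k hk => exact absurd rfl hx
  | upper s hs => exact Or.inl ⟨⟨s, hs⟩, rfl⟩
  | left k hk => exact absurd rfl hx
  | lower s hs => exact Or.inr ⟨⟨s, hs⟩, rfl⟩

theorem card_plainHalf_opened : Nat.card (opened n (arcs n u d)).PlainHalf = 2 * n := by
  have hb : Function.Bijective (Sum.elim (upperHalf (n := n) u d) (lowerHalf (n := n) u d)) := by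
    constructor
    · rintro (s | s) (t | t) h <;>
        have h1 := congrArg (fun h : (opened n (arcs n u d)).PlainHalf => DrawnHalfEdge.angle h.1) h
      · replace h1 : (upperAt u d s s.2).angle = (upperAt u d t t.2).angle := h1
        simp at h1
        rw [Fin.ext h1]
      · replace h1 : (upperAt u d s s.2).angle = (lowerAt u d t t.2).angle := h1
        simp at h1
        omega
      · replace h1 : (lowerAt u d s s.2).angle = (upperAt u d t t.2).angle := h1
        simp at h1
        omega
      · replace h1 : (lowerAt u d s s.2).angle = (lowerAt u d t t.2).angle := h1
        simp at h1
        rw [Fin.ext h1]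
    · intro h
      rcases plainHalf_cases h with ⟨s, rfl⟩ | ⟨s, rfl⟩
      · exact ⟨.inl s, rfl⟩
      · exact ⟨.inr s, rfl⟩
  rw [← Nat.card_eq_of_bijective _ hb, Nat.card_sum, Nat.card_fin]
  omega

theorem IsMeander.graph_adj_iff (hM : IsMeander n u d) {i j : Fin (n + 1)} :
    (opened n (arcs n u d)).graph.Adj (hM.nodeEquiv i) (hM.nodeEquiv j) ↔
      (underlyingGraph n (arcs n u d)).Adj i j := by
  have key : ∀ i j : Fin (n + 1), (∃ h : (opened n (arcs n u d)).PlainHalf,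
      (opened n (arcs n u d)).node h.1 = hM.nodeEquiv i ∧
      (opened n (arcs n u d)).node ((opened n (arcs n u d)).twin h.1) = hM.nodeEquiv j) ↔
      ∃ s < n, (u s = i ∧ d s = j) ∨ (u s = j ∧ d s = i) := by
    intro i j
    constructor
    · rintro ⟨h, h1, h2⟩
      rcases plainHalf_cases h with ⟨s, rfl⟩ | ⟨s, rfl⟩
      · have h3 : (opened n (arcs n u d)).twin (upperHalf u d s).1 = _ := opened_twin_upperAt s.2
        rw [h3] at h2
        replace h1 := hM.node_eq_nodeEquiv_iff.1 h1
        replace h2 := hM.node_eq_nodeEquiv_iff.1 h2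
        change 2 * u s = _ at h1
        rw [black_lowerAt] at h2
        exact ⟨s, s.2, Or.inl ⟨by omega, by omega⟩⟩
      · have h3 : (opened n (arcs n u d)).twin (lowerHalf u d s).1 = _ := opened_twin_lowerAt s.2
        rw [h3] at h2
        replace h1 := hM.node_eq_nodeEquiv_iff.1 h1
        replace h2 := hM.node_eq_nodeEquiv_iff.1 h2
        change 2 * d s = _ at h1
        rw [black_upperAt] at h2
        exact ⟨s, s.2, Or.inr ⟨by omega, by omega⟩⟩
    · rintro ⟨s, hs, ⟨h1, h2⟩ | ⟨h1, h2⟩⟩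
      · refine ⟨upperHalf u d ⟨s, hs⟩, hM.node_eq_nodeEquiv_iff.2 ?_, ?_⟩
        · change 2 * u s = _
          rw [h1]
        · have h3 : (opened n (arcs n u d)).twin (upperHalf u d ⟨s, hs⟩).1 = _ :=
            opened_twin_upperAt hs
          rw [h3]
          exact hM.node_eq_nodeEquiv_iff.2 (by rw [black_lowerAt, h2])
      · refine ⟨lowerHalf u d ⟨s, hs⟩, hM.node_eq_nodeEquiv_iff.2 ?_, ?_⟩
        · change 2 * d s = _
          rw [h2]
        · have h3 : (opened n (arcs n u d)).twin (lowerHalf u d ⟨s, hs⟩).1 = _ :=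
            opened_twin_lowerAt hs
          rw [h3]
          exact hM.node_eq_nodeEquiv_iff.2 (by rw [black_upperAt, h1])
  rw [underlyingGraph_arcs_adj, BudMap.graph, SimpleGraph.fromRel_adj,
    hM.nodeEquiv.injective.ne_iff, key, key]
  refine and_congr_right fun _ => ⟨?_, Or.inl⟩
  rintro (h | ⟨s, hs, h⟩)
  · exact h
  · exact ⟨s, hs, h.symm⟩

theorem IsMeander.isBicoloredBlossomingTree_opened (hM : IsMeander n u d)
    (hT : IsMeanderingTree n (arcs n u d)) :
    (opened n (arcs n u d)).IsBicoloredBlossomingTree n where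
  finite := finite_arcs
  next_bijective := by
    have : Finite (opened n (arcs n u d)).HalfEdge := finite_arcs
    rw [← Finite.injective_iff_bijective]
    intro x y h
    -- On a finite set injectivity is enough, and cyclic predecessors are unique.
    exact (opened_next_eq_iff.1 h).injective (isNext_opened_next y)
  twin_twin x := by
    change DrawnHalfEdge n (arcs n u d) at x
    induction x using drawnCases with
    | right k hk => rw [opened_twin_rightAt, opened_twin_rightAt]
    | upper s hs => rw [opened_twin_upperAt, opened_twin_lowerAt]
    | left k hk => rw [opened_twin_leftAt, opened_twin_leftAt]
    | lower s hs => rw [opened_twin_lowerAt, opened_twin_upperAt]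
  twin_bud x hx := by
    change DrawnHalfEdge n (arcs n u d) at x
    induction x using drawnCases with
    | right k hk => exact opened_twin_rightAt hk
    | upper s hs => exact absurd hx (upperAt_ne_bud hs)
    | left k hk => exact opened_twin_leftAt hk
    | lower s hs => exact absurd hx (lowerAt_ne_bud hs)
  twin_blue x hx := by
    change DrawnHalfEdge n (arcs n u d) at x
    induction x using drawnCases with
    | right k hk => exact Kind.noConfusion hx
    | upper s hs => rw [opened_twin_upperAt]; rfl
    | left k hk => exact Kind.noConfusion hx
    | lower s hs => exact Kind.noConfusion hx
  twin_red x hx := by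
    change DrawnHalfEdge n (arcs n u d) at x
    induction x using drawnCases with
    | right k hk => exact Kind.noConfusion hx
    | upper s hs => exact Kind.noConfusion hx
    | left k hk => exact Kind.noConfusion hx
    | lower s hs => rw [opened_twin_lowerAt]; rfl
  isTree := by
    let e : underlyingGraph n (arcs n u d) ≃g (opened n (arcs n u d)).graph :=
      ⟨hM.nodeEquiv, hM.graph_adj_iff⟩
    exact e.isTree_iff.1 hT.isTree
  no_loop x hx h := by
    rcases plainHalf_cases ⟨x, hx⟩ with ⟨s, h1⟩ | ⟨s, h1⟩
    · obtain rfl : x = upperAt u d s s.2 := congrArg Subtype.val h1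
      rw [opened_twin_upperAt] at h
      have h2 := hM.node_eq_iff.1 h
      have h3 := hM.u_le s s.2
      have h4 := hM.lt_d s s.2
      rw [black_upperAt, black_lowerAt] at h2
      omega
    · obtain rfl : x = lowerAt u d s s.2 := congrArg Subtype.val h1
      rw [opened_twin_lowerAt] at h
      have h2 := hM.node_eq_iff.1 h
      have h3 := hM.u_le s s.2
      have h4 := hM.lt_d s s.2
      rw [black_upperAt, black_lowerAt] at h2
      omega
  no_multiple_edge x y hx hy h h' := by
    -- Parallel edges oriented alike are excluded by the simplicity of the underlying graph. The
    -- mixed cases below are impossible since `u s < d s`.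
    have key : ∀ s t : Fin n, u s = u t → d s = d t → s = t := by
      intro s t h1 h2
      have h3 := hT.edge_injective (2 * s + 1) (2 * t + 1) (2 * u s) (2 * d s)
        (isEdgeAt_arcs.2 ⟨s, s.2, rfl, rfl, rfl⟩)
        (isEdgeAt_arcs.2 ⟨t, t.2, rfl, by rw [h1], by rw [h2]⟩)
      exact Fin.ext (by omega)
    rcases plainHalf_cases ⟨x, hx⟩ with ⟨s, h1⟩ | ⟨s, h1⟩ <;>
      rcases plainHalf_cases ⟨y, hy⟩ with ⟨t, h2⟩ | ⟨t, h2⟩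
    · obtain rfl : x = upperAt u d s s.2 := congrArg Subtype.val h1
      obtain rfl : y = upperAt u d t t.2 := congrArg Subtype.val h2
      rw [opened_twin_upperAt, opened_twin_upperAt] at h'
      replace h := hM.node_eq_iff.1 h
      replace h' := hM.node_eq_iff.1 h'
      simp only [black_upperAt, black_lowerAt] at h h'
      rw [key s t (by omega) (by omega)]
    · obtain rfl : x = upperAt u d s s.2 := congrArg Subtype.val h1
      obtain rfl : y = lowerAt u d t t.2 := congrArg Subtype.val h2
      rw [opened_twin_upperAt, opened_twin_lowerAt] at h'
      replace h := hM.node_eq_iff.1 h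
      replace h' := hM.node_eq_iff.1 h'
      simp only [black_upperAt, black_lowerAt] at h h'
      have h3 := hM.u_le s s.2
      have h4 := hM.lt_d s s.2
      have h5 := hM.u_le t t.2
      have h6 := hM.lt_d t t.2
      omega
    · obtain rfl : x = lowerAt u d s s.2 := congrArg Subtype.val h1
      obtain rfl : y = upperAt u d t t.2 := congrArg Subtype.val h2
      rw [opened_twin_upperAt, opened_twin_lowerAt] at h'
      replace h := hM.node_eq_iff.1 h
      replace h' := hM.node_eq_iff.1 h'
      simp only [black_upperAt, black_lowerAt] at h h'
      have h3 := hM.u_le s s.2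
      have h4 := hM.lt_d s s.2
      have h5 := hM.u_le t t.2
      have h6 := hM.lt_d t t.2
      omega
    · obtain rfl : x = lowerAt u d s s.2 := congrArg Subtype.val h1
      obtain rfl : y = lowerAt u d t t.2 := congrArg Subtype.val h2
      rw [opened_twin_lowerAt, opened_twin_lowerAt] at h'
      replace h := hM.node_eq_iff.1 h
      replace h' := hM.node_eq_iff.1 h'
      simp only [black_upperAt, black_lowerAt] at h h'
      rw [key s t (by omega) (by omega)]
  card_plain := card_plainHalf_opened
  card_buds v := by
    obtain ⟨k, rfl⟩ := hM.nodeEquiv.surjective v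
    have hk : (k : ℕ) ≤ n := Nat.le_of_lt_succ k.2
    have : {h : DrawnHalfEdge n (arcs n u d) |
        (opened n (arcs n u d)).node h = hM.nodeEquiv k ∧
        (opened n (arcs n u d)).kind h = Kind.bud} = {rightAt u d k hk, leftAt u d k hk} := by
      ext x
      simp only [Set.mem_ofPred_eq, Set.mem_insert_iff, Set.mem_singleton_iff]
      constructor
      · rintro ⟨h1, h2⟩
        replace h1 := hM.node_eq_nodeEquiv_iff.1 h1
        induction x using drawnCases with
        | right l hl => exact Or.inl (eq_of_angle_eq h1 rfl)
        | upper s hs => exact absurd h2 (upperAt_ne_bud hs)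
        | left l hl => exact Or.inr (eq_of_angle_eq h1 rfl)
        | lower s hs => exact absurd h2 (lowerAt_ne_bud hs)
      · rintro (rfl | rfl)
        · exact ⟨hM.node_eq_nodeEquiv_iff.2 rfl, rfl⟩
        · exact ⟨hM.node_eq_nodeEquiv_iff.2 rfl, rfl⟩
    exact (congrArg Set.ncard this).trans (Set.ncard_pair (opened_splitBuds hk).2.2.1)
  split v := by
    obtain ⟨k, rfl⟩ := hM.nodeEquiv.surjective v
    exact ⟨_, _, rfl, opened_splitBuds (Nat.le_of_lt_succ k.2)⟩

theorem gamma_mem_bicoloredBlossomingTrees {M : ArcDiagram} (hM : M ∈ meanderingTrees n) :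
    gamma n M ∈ bicoloredBlossomingTrees n := by
  obtain ⟨u, d, h, -, rfl⟩ := mem_meanderingTrees_iff.1 hM
  exact ⟨_, h.isBicoloredBlossomingTree_opened hM, rfl⟩

end opened

/-! ### The planar matching of buds and legs -/

namespace BudMap

variable {B : BudMap}

/-- The number of buds minus the number of legs among the first `k` letters of the contour
starting at `x`. -/
def excess (B : BudMap) (x : B.HalfEdge) (k : ℕ) : ℤ :=
  ∑ j ∈ Finset.range k, weight (B.kind (B.contour^[j] x))

theorem excess_add (x : B.HalfEdge) (i j : ℕ) :
    B.excess x (i + j) = B.excess x i + B.excess (B.contour^[i] x) j := by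
  rw [excess, excess, excess, Finset.sum_range_add]
  refine congrArg _ (Finset.sum_congr rfl fun k _ => ?_)
  rw [← Function.iterate_add_apply, add_comm]

theorem excess_zero (x : B.HalfEdge) : B.excess x 0 = 0 := Finset.sum_range_zero _

theorem excess_one (x : B.HalfEdge) : B.excess x 1 = weight (B.kind x) := Finset.sum_range_one _

theorem excess_one_add (x : B.HalfEdge) (k : ℕ) :
    B.excess x (1 + k) = weight (B.kind x) + B.excess (B.contour x) k := by
  rw [excess_add, excess_one, Function.iterate_one]

theorem height_eq_excess (x : B.HalfEdge) (k : ℕ) : B.height x k = B.excess x (k + 1) := rfl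

theorem weight_eq_neg_one {c : Kind} (h : c ≠ Kind.bud) : weight c = -1 := by
  cases c with
  | bud => exact absurd rfl h
  | blue => rfl
  | red => rfl

/-- The contour leads from `x` to `y`, and its letters from `x` on and strictly before `y` form a
balanced parenthesis word. -/
def Balanced (B : BudMap) (x y : B.HalfEdge) : Prop :=
  ∃ k, B.contour^[k] x = y ∧ B.excess x k = 0 ∧ ∀ j ≤ k, 0 ≤ B.excess x j

theorem Balanced.refl (x : B.HalfEdge) : B.Balanced x x :=
  ⟨0, rfl, excess_zero x, fun j hj => by rw [Nat.le_zero.1 hj, excess_zero]⟩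

theorem Balanced.trans {x y z : B.HalfEdge} (h : B.Balanced x y) (h' : B.Balanced y z) :
    B.Balanced x z := by
  obtain ⟨k, rfl, h1, h2⟩ := h
  obtain ⟨l, rfl, h3, h4⟩ := h'
  refine ⟨k + l, by rw [add_comm, Function.iterate_add_apply], by rw [excess_add, h1, h3, zero_add],
    fun j hj => ?_⟩
  rcases le_total j k with h | h
  · exact h2 j h
  · obtain ⟨i, rfl⟩ := Nat.exists_eq_add_of_le h
    rw [excess_add, h1, zero_add]
    exact h4 i (by omega)

/-- With the bud in front, the heights are one more than the excesses of the balanced word, hence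
positive until the leg `h` brings them to `0`. -/
theorem Balanced.matched {b h : B.HalfEdge} (hb : B.kind b = Kind.bud) (hh : B.kind h ≠ Kind.bud)
    (hbal : B.Balanced (B.contour b) h) : B.Matched b h := by
  obtain ⟨k, rfl, h1, h2⟩ := hbal
  have key : ∀ j, B.height b j = 1 + B.excess (B.contour b) j := fun j => by
    rw [height_eq_excess, add_comm, excess_one_add, hb]
    rfl
  refine ⟨hb, k + 1, Function.iterate_succ_apply _ _ _, ?_, fun j hj => ?_⟩
  · rw [key, excess_add, h1, excess_one, weight_eq_neg_one hh]
    rfl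
  · rw [key]
    have := h2 j (by omega)
    omega

theorem Matched.balanced {b h : B.HalfEdge} (hm : B.Matched b h) :
    B.Balanced b (B.contour h) := by
  obtain ⟨-, k, rfl, h1, h2⟩ := hm
  refine ⟨k + 1, Function.iterate_succ_apply' _ _ _, h1, fun j hj => ?_⟩
  rcases j with _ | j
  · rw [excess_zero]
  · rcases (Nat.le_of_succ_le_succ hj).lt_or_eq with h | rfl
    · exact (h2 j h).le
    · exact h1.ge

/-- Reading backwards from `h`, the nearer bud, say `b`, lies on the contour from the farther one,
`b'`. If they differed, the part before `b` would have excess zero, as the whole word and the word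
from `b` do; but the heights from `b'` stay positive before `h`. -/
theorem Matched.left_unique (hB : Function.Injective B.contour) {b b' h : B.HalfEdge}
    (hm : B.Matched b h) (hm' : B.Matched b' h) : b = b' := by
  suffices key : ∀ (b b' : B.HalfEdge) (k l : ℕ), k ≤ l → B.contour^[k] b = B.contour^[l] b' →
      B.height b k = 0 → B.height b' l = 0 → (∀ j < l, 0 < B.height b' j) → b = b' by
    obtain ⟨-, k, h1, h2, h3⟩ := hm
    obtain ⟨-, l, h4, h5, h6⟩ := hm'
    rcases le_total k l with h | h
    · exact key b b' k l h (h1.trans h4.symm) h2 h5 h6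
    · exact (key b' b l k h (h4.trans h1.symm) h5 h2 h3).symm
  intro b b' k l hkl he hk hl hpos
  obtain ⟨i, rfl⟩ := Nat.exists_eq_add_of_le hkl
  rw [Function.iterate_add_apply] at he
  obtain rfl := hB.iterate k he
  rcases i with _ | i
  · rfl
  · have h1 := hpos i (by omega)
    rw [height_eq_excess] at h1 hk hl
    rw [show k + (i + 1) + 1 = (i + 1) + (k + 1) by omega, excess_add, hk] at hl
    omega

end BudMap

open BudMap

section opened

variable {n : ℕ} {u d : ℕ → ℕ}

theorem contour_rightAt {k : ℕ} (hk : k ≤ n) : (opened n (arcs n u d)).contour (rightAt u d k hk) =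
    (opened n (arcs n u d)).next (rightAt u d k hk) :=
  congrArg _ (opened_twin_rightAt hk)

theorem contour_leftAt {k : ℕ} (hk : k ≤ n) : (opened n (arcs n u d)).contour (leftAt u d k hk) =
    (opened n (arcs n u d)).next (leftAt u d k hk) :=
  congrArg _ (opened_twin_leftAt hk)

theorem contour_upperAt {s : ℕ} (hs : s < n) : (opened n (arcs n u d)).contour (upperAt u d s hs) =
    (opened n (arcs n u d)).next (lowerAt u d s hs) :=
  congrArg _ (opened_twin_upperAt hs)

theorem contour_lowerAt {s : ℕ} (hs : s < n) : (opened n (arcs n u d)).contour (lowerAt u d s hs) =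
    (opened n (arcs n u d)).next (upperAt u d s hs) :=
  congrArg _ (opened_twin_lowerAt hs)

/-- The right bud at a black point is matched with the leg to its right. -/
theorem IsMeander.matched_rightAt (hM : IsMeander n u d) {a t : ℕ} (hat : a ≤ t) (ht : t < n)
    (hut : u t = a)
    (ih : ∀ (k : ℕ) (hk : k < n), a ≤ k → k < t →
      (opened n (arcs n u d)).Matched (leftAt u d (k + 1) hk) (lowerAt u d k hk)) :
    (opened n (arcs n u d)).Matched (rightAt u d t ht.le) (upperAt u d t ht) := by
  refine Balanced.matched rfl (upperAt_ne_bud ht) ?_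
  rw [contour_rightAt]
  rcases hat.eq_or_lt with rfl | hlt
  · rw [hM.next_rightAt_eq_upperAt ht hut]
    exact Balanced.refl _
  -- From the left bud at `b` the contour skips a balanced word ending with the leg of the lower arc
  -- at `c = b - 1`, and continues after the upper arc at `c`. Either the next half-edge is the
  -- upper arc at `t`, or it is the left bud at `u c`, from which the walk resumes. The invariant
  -- says that the white points between `b` and `t` have their upper arcs starting at `b` or later;
  -- `m` is only a bound for `b`.
  have chain : ∀ m b, b ≤ m → a < b → ∀ hb : b ≤ t, (∀ s, b ≤ s → s < t → b ≤ u s) →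
      (opened n (arcs n u d)).Balanced (leftAt u d b (hb.trans ht.le)) (upperAt u d t ht) := by
    intro m
    induction m with
    | zero => intro b hb hab; omega
    | succ m ihm =>
      intro b hbm hab hbt hinv
      obtain ⟨c, rfl⟩ := Nat.exists_eq_succ_of_ne_zero (Nat.ne_zero_of_lt hab)
      have hcn : c < n := by omega
      have h1 := (ih c hcn (by omega) hbt).balanced
      rw [contour_lowerAt] at h1
      have h2 := hM.u_le c hcn
      have h3 := hM.u_nc c t hbt ht
      rcases eq_or_ne (u c) a with h4 | h4
      · rw [next_upperAt_eq_upperAt (t := t) hbt ht (hut.trans h4.symm) fun r hr hrt => by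
          have := hinv r hr hrt
          omega] at h1
        exact h1
      · have h5 : (opened n (arcs n u d)).next (upperAt u d c hcn) =
            leftAt u d (u c) (h2.trans hcn.le) :=
          next_upperAt_eq_leftAt hcn _ rfl fun r hr hrn => by
            rcases lt_trichotomy r t with h | rfl | h
            · have := hinv r hr h
              omega
            · omega
            · have := hM.u_nc t r h hrn
              omega
        rw [h5] at h1
        refine h1.trans (ihm (u c) (by omega) (by omega) (by omega) fun s hs hst => ?_)
        rcases lt_trichotomy s c with h | rfl | h
        · have := hM.u_nc s c h hcn
          omega
        · exact le_rfl
        · have := hinv s h hst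
          omega
  -- For `a < t` no upper arc starts at the black point `t`, as it would cross the arc from `a` to
  -- `t`.
  rw [next_rightAt_eq_leftAt ht.le fun s hs h => ?_]
  · exact chain t t le_rfl hlt le_rfl fun s hs hst => absurd hst hs.not_gt
  · have h1 := hM.u_le s hs
    rcases h1.lt_or_eq with h2 | h2
    · have := hM.u_nc t s (by omega) hs
      omega
    · obtain rfl : s = t := by omega
      omega

/-- The left bud at a black point is matched with the leg to its left. -/
theorem IsMeander.matched_leftAt (hM : IsMeander n u d) {t : ℕ} (ht : t < n)
    (ih : ∀ (k : ℕ) (hk : k < n), t < k → k < d t →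
      (opened n (arcs n u d)).Matched (rightAt u d k hk.le) (upperAt u d k hk)) :
    (opened n (arcs n u d)).Matched (leftAt u d (t + 1) ht) (lowerAt u d t ht) := by
  refine Balanced.matched rfl (lowerAt_ne_bud ht) ?_
  rw [contour_leftAt]
  have hdt := hM.lt_d t ht
  have hdn := hM.d_le t ht
  rcases (Nat.succ_le_of_lt hdt).eq_or_lt with he | hlt
  · rw [hM.next_leftAt_eq_lowerAt ht he.symm]
    exact Balanced.refl _
  -- The mirror image of the walk for right buds: from the right bud at `c` one skips to after the
  -- lower arc at `c`, and finds the lower arc at `t` or the right bud at `d c`.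
  have chain : ∀ m c, d t ≤ c + m → t < c → ∀ hc : c < d t, (∀ s, t < s → s < c → d s ≤ c) →
      (opened n (arcs n u d)).Balanced (rightAt u d c (hc.le.trans hdn)) (lowerAt u d t ht) := by
    intro m
    induction m with
    | zero => intro c hc htc hcd; omega
    | succ m ihm =>
      intro c hcm htc hcd hinv
      have hcn : c < n := by omega
      have h1 := (ih c hcn htc hcd).balanced
      rw [contour_upperAt] at h1
      have h2 := hM.lt_d c hcn
      have h3 := hM.d_nc t c htc hcn
      rcases eq_or_ne (d c) (d t) with h4 | h4
      · rw [next_lowerAt_eq_lowerAt htc hcn h4.symm fun r hr hrc => by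
          have := hinv r hr hrc
          omega] at h1
        exact h1
      · have h5 : (opened n (arcs n u d)).next (lowerAt u d c hcn) =
            rightAt u d (d c) (hM.d_le c hcn) :=
          next_lowerAt_eq_rightAt hcn _ rfl fun r hr => by
            rcases lt_trichotomy r t with h | rfl | h
            · have := hM.d_nc r t h ht
              omega
            · omega
            · have := hinv r h hr
              omega
        rw [h5] at h1
        refine h1.trans (ihm (d c) (by omega) (by omega) (by omega) fun s hs hst => ?_)
        rcases lt_trichotomy s c with h | rfl | h
        · have := hinv s hs h
          omega
        · exact le_rfl
        · have := hM.d_nc c s h (by omega)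
          omega
  rw [next_leftAt_eq_rightAt ht fun s hs h => ?_]
  · exact chain (d t) (t + 1) (by omega) (Nat.lt_succ_self t) hlt fun s _ _ => by omega
  · have h1 := hM.lt_d s hs
    rcases lt_trichotomy s t with h2 | rfl | h2
    · have := hM.d_nc s t h2 ht
      omega
    · omega
    · omega

/-- Interval induction. At the cutting point `t`, the matching of the right bud uses the pairs in
the left interval, and that of the left bud at `t + 1` those in the right interval, which contains
`d t`. -/
theorem IsMeander.matched (hM : IsMeander n u d) (hC : Compatible n u d) {k : ℕ} (hk : k < n) :
    (opened n (arcs n u d)).Matched (rightAt u d k hk.le) (upperAt u d k hk) ∧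
    (opened n (arcs n u d)).Matched (leftAt u d (k + 1) hk) (lowerAt u d k hk) := by
  have key : ∀ a b, a ≤ b → b ≤ n → IsClosedInterval u d a b →
      ∀ (k : ℕ) (hk : k < n), a ≤ k → k < b →
      (opened n (arcs n u d)).Matched (rightAt u d k hk.le) (upperAt u d k hk) ∧
      (opened n (arcs n u d)).Matched (leftAt u d (k + 1) hk) (lowerAt u d k hk) := by
    refine hM.interval_induction hC (fun a _ k hk h1 h2 => absurd h2 h1.not_gt) ?_
    intro a b t h1 h2 hb h3 h4 h5 hI ih1 ih2 k hk hak hkb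
    rcases lt_trichotomy k t with h | rfl | h
    · exact ih1 k hk hak h
    · refine ⟨hM.matched_rightAt h1 hk h3 fun l hl hal hlk => (ih1 l hl hal hlk).2,
        hM.matched_leftAt hk fun l hl hkl hld =>
          (ih2 l hl hkl (hld.trans_le (hI.d_le k h1 h2))).1⟩
    · exact ih2 k hk h hkb
  exact key 0 n (Nat.zero_le _) le_rfl hM.isClosedInterval k hk (Nat.zero_le _) hk

end opened

/-! ### The stretched closure of the opening of a meandering tree -/

section opened

variable {n : ℕ} {u d : ℕ → ℕ}

/-- The buds of a node determine their order as soon as the node carries an arc. A node with neither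
blue nor red half-edges would be isolated, which connectedness forbids because `n ≥ 1` provides
another black point. -/
theorem CutConnected.eq_of_splitBuds (hX : CutConnected n u d) (hn : 1 ≤ n)
    {x y : DrawnHalfEdge n (arcs n u d)} (h : (opened n (arcs n u d)).SplitBuds x y) :
    ∃ (k : ℕ) (hk : k ≤ n), x = rightAt u d k hk ∧ y = leftAt u d k hk := by
  obtain ⟨hx, hy, hxy, ⟨m, h1, h2⟩, ⟨m', h3, h4⟩⟩ := h
  have hb : x.black = y.black := by
    rw [← h1]
    exact black_eq_of_node_eq (node_next_iterate _ _).symm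
  induction x using drawnCases with
  | upper s hs => exact absurd hx (upperAt_ne_bud hs)
  | lower s hs => exact absurd hx (lowerAt_ne_bud hs)
  | right k hk =>
    induction y using drawnCases with
    | upper s hs => exact absurd hy (upperAt_ne_bud hs)
    | lower s hs => exact absurd hy (lowerAt_ne_bud hs)
    | right l hl => exact absurd (eq_of_angle_eq hb rfl) hxy
    | left l hl => exact ⟨k, hk, rfl, eq_of_angle_eq hb.symm rfl⟩
  | left k hk =>
    induction y using drawnCases with
    | upper s hs => exact absurd hy (upperAt_ne_bud hs)
    | lower s hs => exact absurd hy (lowerAt_ne_bud hs)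
    | left l hl => exact absurd (eq_of_angle_eq hb rfl) hxy
    | right l hl =>
      exfalso
      obtain rfl : k = l := by simpa using hb
      -- An arc below `k` would be met, as a red half-edge, on the way from the left bud to the
      -- right one, where only blue is allowed; likewise for arcs above `k` in `hu`.
      have hd : ∀ s < n, d s ≠ k := by
        intro s hs hds
        have h5 := isNext_opened_next (leftAt u d k hk)
        obtain ⟨y, hy⟩ : ∃ y, (opened n (arcs n u d)).next (leftAt u d k hk) = y := ⟨_, rfl⟩
        rw [hy] at h5
        have hys : (lowerAt u d s hs).black = (leftAt u d k hk).black := by simp [hds]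
        rcases m with _ | m
        · obtain rfl : y = rightAt u d k hl := hy.symm.trans h1
          rcases h5 with ⟨-, ⟨h5, -⟩ | ⟨h5, -⟩⟩
          · simp at h5; omega
          · have := h5 _ hys; simp at this; omega
        · have h6 := h2 0 (Nat.succ_pos m)
          rw [Function.iterate_one, hy] at h6
          induction y using drawnCases with
          | right k hk => exact Kind.noConfusion h6
          | left k hk => exact Kind.noConfusion h6
          | lower t ht => exact Kind.noConfusion h6
          | upper t ht =>
            rcases h5 with ⟨-, ⟨h5, -⟩ | ⟨h5, -⟩⟩
            · simp at h5; omega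
            · have := h5 _ hys; simp at this; omega
      have hu : ∀ s < n, u s ≠ k := by
        intro s hs hus
        have h5 := isNext_opened_next (rightAt u d k hk)
        obtain ⟨y, hy⟩ : ∃ y, (opened n (arcs n u d)).next (rightAt u d k hk) = y := ⟨_, rfl⟩
        rw [hy] at h5
        have hys : (upperAt u d s hs).black = (rightAt u d k hk).black := by simp [hus]
        rcases m' with _ | m'
        · obtain rfl : y = leftAt u d k hl := hy.symm.trans h3
          rcases h5 with ⟨-, ⟨-, h5⟩ | ⟨h5, -⟩⟩
          · have := h5 _ hys (by simp); simp at this; omega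
          · have := h5 _ hys; simp at this; omega
        · have h6 := h4 0 (Nat.succ_pos m')
          rw [Function.iterate_one, hy] at h6
          induction y using drawnCases with
          | right k hk => exact Kind.noConfusion h6
          | left k hk => exact Kind.noConfusion h6
          | upper t ht => exact Kind.noConfusion h6
          | lower t ht =>
            rcases h5 with ⟨-, ⟨-, h5⟩ | ⟨h5, -⟩⟩
            · have := h5 _ hys (by simp); simp at this; omega
            · have := h5 _ hys; simp at this; omega
      obtain ⟨j, hj, hjk⟩ : ∃ j ≤ n, j ≠ k := by
        rcases Nat.eq_zero_or_pos k with rfl | h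
        · exact ⟨1, hn, one_ne_zero⟩
        · exact ⟨0, Nat.zero_le _, by omega⟩
      obtain ⟨s, hs, h7⟩ := hX {k} k hk j hj rfl hjk
      exact h7 ⟨fun h => absurd h (hu s hs), fun h => absurd h (hd s hs)⟩

/-- The doubled abscissa of the white end of an arc. -/
def white : DrawnHalfEdge n (arcs n u d) → ℕ
  | upperArc a => a.1.2
  | lowerArc a => a.1.1
  | rightBud _ => 0
  | leftBud _ => 0

/-- The position of a vertex of the closure on the horizontal axis. -/
def position (n : ℕ) (u d : ℕ → ℕ) : (opened n (arcs n u d)).ClosureVertex → ℕ :=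
  Sum.elim
    (Quot.lift (fun x : DrawnHalfEdge n (arcs n u d) => x.black)
      fun _ _ h => (opened_next_eq_iff.1 h).1.symm)
    (Quot.lift (fun h : (opened n (arcs n u d)).PlainHalf => white h.1) <| by
      rintro h ⟨y, hy⟩ (h1 : (opened n (arcs n u d)).twin h.1 = y)
      subst h1
      rcases plainHalf_cases h with ⟨s, rfl⟩ | ⟨s, rfl⟩
      · exact (congrArg white (opened_twin_upperAt s.2)).symm
      · exact (congrArg white (opened_twin_lowerAt s.2)).symm)

theorem position_node (x : DrawnHalfEdge n (arcs n u d)) :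
    position n u d (Sum.inl ((opened n (arcs n u d)).node x)) = x.black := rfl

theorem position_upperHalf (s : Fin n) :
    position n u d (Sum.inr ((opened n (arcs n u d)).edgeVertex (upperHalf u d s))) = 2 * s + 1 :=
  rfl

theorem position_lowerHalf (s : Fin n) :
    position n u d (Sum.inr ((opened n (arcs n u d)).edgeVertex (lowerHalf u d s))) = 2 * s + 1 :=
  rfl

theorem edgeVertex_lowerHalf (s : Fin n) :
    (opened n (arcs n u d)).edgeVertex (lowerHalf u d s) =
      (opened n (arcs n u d)).edgeVertex (upperHalf u d s) :=
  Quot.sound (opened_twin_lowerAt s.2)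

theorem IsMeander.closureVertex_cases (hM : IsMeander n u d)
    (v : (opened n (arcs n u d)).ClosureVertex) :
    (∃ (k : ℕ) (hk : k ≤ n), v = Sum.inl ((opened n (arcs n u d)).node (rightAt u d k hk))) ∨
    ∃ s, v = Sum.inr ((opened n (arcs n u d)).edgeVertex (upperHalf u d s)) := by
  rcases v with v | v
  · induction v using Quot.ind with
    | _ x =>
      obtain ⟨k, hk, hx⟩ := hM.exists_black_eq x
      exact Or.inl ⟨k, hk, congrArg _ (opened_node_eq_rightAt hk hx)⟩
  · induction v using Quot.ind with
    | _ h =>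
      rcases plainHalf_cases h with ⟨s, rfl⟩ | ⟨s, rfl⟩
      · exact Or.inr ⟨s, rfl⟩
      · exact Or.inr ⟨s, congrArg _ (edgeVertex_lowerHalf s)⟩

theorem IsMeander.position_injective (hM : IsMeander n u d) :
    Function.Injective (position n u d) := by
  intro v w h
  rcases hM.closureVertex_cases v with ⟨k, hk, rfl⟩ | ⟨s, rfl⟩ <;>
    rcases hM.closureVertex_cases w with ⟨l, hl, rfl⟩ | ⟨t, rfl⟩
  · rw [position_node, position_node, black_rightAt, black_rightAt] at h
    obtain rfl : k = l := by omega
    rfl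
  · rw [position_node, position_upperHalf, black_rightAt] at h
    omega
  · rw [position_node, position_upperHalf, black_rightAt] at h
    omega
  · rw [position_upperHalf, position_upperHalf] at h
    obtain rfl : s = t := Fin.ext (by omega)
    rfl

theorem IsMeander.position_le (hM : IsMeander n u d)
    (v : (opened n (arcs n u d)).ClosureVertex) : position n u d v ≤ 2 * n := by
  rcases hM.closureVertex_cases v with ⟨k, hk, rfl⟩ | ⟨s, rfl⟩
  · rw [position_node, black_rightAt]
    omega
  · rw [position_upperHalf]
    omega

theorem exists_position_eq {p : ℕ} (hp : p ≤ 2 * n) : ∃ v, position n u d v = p := by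
  obtain ⟨k, rfl | rfl⟩ := p.even_or_odd'
  · exact ⟨_, position_node (rightAt u d k (by omega))⟩
  · exact ⟨_, position_upperHalf ⟨k, by omega⟩⟩

theorem IsMeander.injective_contour (hM : IsMeander n u d)
    (hT : IsMeanderingTree n (arcs n u d)) :
    Function.Injective (opened n (arcs n u d)).contour := by
  have h := hM.isBicoloredBlossomingTree_opened hT
  exact h.next_bijective.injective.comp
    (Function.Involutive.injective (f := (opened n (arcs n u d)).twin) h.twin_twin)

/-- Path steps are exactly the unit steps of the axis: a right bud leads from black `k` to white
`k`, a left bud from white `k` to black `k + 1`. That there are no others follows from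
`eq_of_splitBuds` and from the uniqueness of the bud matched with a leg. -/
theorem IsMeander.closureStep_iff (hM : IsMeander n u d) (hC : Compatible n u d) (hn : 1 ≤ n)
    {v w : (opened n (arcs n u d)).ClosureVertex} :
    (opened n (arcs n u d)).ClosureStep v w ↔ position n u d w = position n u d v + 1 := by
  have hX := hM.cutConnected hC
  have hinj := hM.injective_contour (hM.isMeanderingTree_of_cutConnected hX)
  constructor
  · rintro (⟨b, b', h, hb, hm⟩ | ⟨b, b', h, hb, hm⟩)
    · obtain ⟨k, hk, rfl, -⟩ := hX.eq_of_splitBuds hn hb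
      rcases plainHalf_cases h with ⟨s, rfl⟩ | ⟨s, rfl⟩
      · have h1 := hm.left_unique hinj (hM.matched hC s.2).1
        have h2 := congrArg DrawnHalfEdge.black h1
        rw [black_rightAt, black_rightAt] at h2
        rw [position_upperHalf, position_node, black_rightAt, h2]
      · have h1 := hm.left_unique hinj (hM.matched hC s.2).2
        have h2 := congrArg DrawnHalfEdge.angle h1
        rw [angle_rightAt, angle_leftAt] at h2
        omega
    · obtain ⟨k, hk, -, rfl⟩ := hX.eq_of_splitBuds hn hb
      rcases plainHalf_cases h with ⟨s, rfl⟩ | ⟨s, rfl⟩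
      · have h1 := hm.left_unique hinj (hM.matched hC s.2).1
        have h2 := congrArg DrawnHalfEdge.angle h1
        rw [angle_rightAt, angle_leftAt] at h2
        omega
      · have h1 := hm.left_unique hinj (hM.matched hC s.2).2
        have h2 := congrArg DrawnHalfEdge.black h1
        rw [black_leftAt, black_leftAt] at h2
        rw [position_lowerHalf, position_node, black_leftAt, h2]
        omega
  · intro h
    rcases hM.closureVertex_cases v with ⟨k, hk, rfl⟩ | ⟨s, rfl⟩ <;>
      rcases hM.closureVertex_cases w with ⟨l, hl, rfl⟩ | ⟨t, rfl⟩
    · rw [position_node, position_node, black_rightAt, black_rightAt] at h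
      omega
    · rw [position_node, position_upperHalf, black_rightAt] at h
      obtain rfl : k = t := by omega
      exact ClosureStep.leave _ _ _ (opened_splitBuds hk) (hM.matched hC t.2).1
    · rw [position_node, position_upperHalf, black_rightAt] at h
      obtain rfl : l = s + 1 := by omega
      rw [← edgeVertex_lowerHalf, ← opened_node_eq_rightAt hl (black_leftAt u d _ hl)]
      exact ClosureStep.arrive _ _ (lowerHalf u d s) (opened_splitBuds hl) (hM.matched hC s.2).2
    · rw [position_upperHalf, position_upperHalf] at h
      omega

theorem IsMeander.transGen_closureStep_iff (hM : IsMeander n u d) (hC : Compatible n u d)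
    (hn : 1 ≤ n) {v w : (opened n (arcs n u d)).ClosureVertex} :
    Relation.TransGen (opened n (arcs n u d)).ClosureStep v w ↔
      position n u d v < position n u d w := by
  constructor
  · intro h
    induction h with
    | single h => have := (hM.closureStep_iff hC hn).1 h; omega
    | tail _ h ih => have := (hM.closureStep_iff hC hn).1 h; omega
  · suffices key : ∀ m v w, position n u d w = position n u d v + (m + 1) →
        Relation.TransGen (opened n (arcs n u d)).ClosureStep v w from
      fun h => key (position n u d w - position n u d v - 1) v w (by omega)
    intro m
    induction m with
    | zero => exact fun v w h => .single ((hM.closureStep_iff hC hn).2 h)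
    | succ m ih =>
      intro v w h
      have := hM.position_le w
      obtain ⟨x, hx⟩ := exists_position_eq (n := n) (u := u) (d := d)
        (p := position n u d v + (m + 1)) (by omega)
      exact .tail (ih v x hx) ((hM.closureStep_iff hC hn).2 (by omega))

/-- Positions identify the vertices of the closure with `0, …, 2 n`, so the predecessors of a vertex
are as many as its position. -/
theorem IsMeander.abscissa_eq_position (hM : IsMeander n u d) (hC : Compatible n u d)
    (hn : 1 ≤ n) (v : (opened n (arcs n u d)).ClosureVertex) :
    (opened n (arcs n u d)).abscissa v = position n u d v := by
  rw [abscissa, ← Set.ncard_image_of_injective _ hM.position_injective]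
  have : position n u d '' {w | Relation.TransGen (opened n (arcs n u d)).ClosureStep w v} =
      (Finset.range (position n u d v) : Set ℕ) := by
    ext p
    simp only [Set.mem_image, Set.mem_ofPred_eq, hM.transGen_closureStep_iff hC hn,
      Finset.coe_range, Set.mem_Iio]
    constructor
    · rintro ⟨w, h, rfl⟩
      exact h
    · intro hp
      have := hM.position_le v
      obtain ⟨w, rfl⟩ := exists_position_eq (n := n) (u := u) (d := d) (p := p) (by omega)
      exact ⟨w, hp, rfl⟩
  rw [this, Set.ncard_coe_finset, Finset.card_range]

theorem IsMeander.stretchedClosure_opened (hM : IsMeander n u d) (hC : Compatible n u d)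
    (hn : 1 ≤ n) : (opened n (arcs n u d)).stretchedClosure = arcs n u d := by
  have habs := hM.abscissa_eq_position hC hn
  ext p
  · constructor
    · rintro ⟨h, h1, rfl⟩
      rw [habs, habs]
      rcases plainHalf_cases h with ⟨s, rfl⟩ | ⟨s, rfl⟩
      · exact ⟨s, s.2, rfl⟩
      · exact Kind.noConfusion h1
    · rintro ⟨s, hs, rfl⟩
      refine ⟨upperHalf u d ⟨s, hs⟩, rfl, ?_⟩
      rw [habs, habs]
      rfl
  · constructor
    · rintro ⟨h, h1, rfl⟩
      rw [habs, habs]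
      rcases plainHalf_cases h with ⟨s, rfl⟩ | ⟨s, rfl⟩
      · exact Kind.noConfusion h1
      · exact ⟨s, s.2, rfl⟩
    · rintro ⟨s, hs, rfl⟩
      refine ⟨lowerHalf u d ⟨s, hs⟩, rfl, ?_⟩
      rw [habs, habs]
      rfl

end opened

theorem delta_gamma {n : ℕ} (hn : 1 ≤ n) {M : ArcDiagram} (hM : M ∈ meanderingTrees n) :
    delta (gamma n M) = M := by
  obtain ⟨u, d, h, hC, rfl⟩ := mem_meanderingTrees_iff.1 hM
  exact h.stretchedClosure_opened hC hn

/-! ### Growing a meandering diagram along a plane tree -/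

/-- Make room for a new element at position `j`. -/
def shift (j i : ℕ) : ℕ := if i < j then i else i + 1

/-- The inverse of `shift j`. -/
def unshift (j i : ℕ) : ℕ := if i < j then i else i - 1

theorem shift_cases (j i : ℕ) : (i < j ∧ shift j i = i) ∨ (j ≤ i ∧ shift j i = i + 1) := by
  unfold shift
  split_ifs <;> omega

theorem unshift_cases (j i : ℕ) :
    (i < j ∧ unshift j i = i) ∨ (j ≤ i ∧ unshift j i = i - 1) := by
  unfold unshift
  split_ifs <;> omega

theorem unshift_shift (j i : ℕ) : unshift j (shift j i) = i := by
  have := shift_cases j i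
  have := unshift_cases j (shift j i)
  omega

theorem shift_unshift {j i : ℕ} (h : i ≠ j) : shift j (unshift j i) = i := by
  have := unshift_cases j i
  have := shift_cases j (unshift j i)
  omega

theorem shift_ne (j i : ℕ) : shift j i ≠ j := by
  have := shift_cases j i
  omega

theorem shift_lt_shift {j a b : ℕ} (h : a < b) : shift j a < shift j b := by
  have := shift_cases j a
  have := shift_cases j b
  omega

theorem shift_injective (j : ℕ) : Function.Injective (shift j) :=
  Function.LeftInverse.injective (unshift_shift j)

/-- Insertion of a black and a white point, in this order, joined by an upper arc, between the
white point number `j - 1` and the black point number `j`. The lower arc at the new white point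
goes to the black point which had number `v`. -/
theorem IsMeander.insert {m j v : ℕ} {u d : ℕ → ℕ} (hM : IsMeander m u d) (hjv : j ≤ v)
    (hv : v ≤ m) (hlow : ∀ s < j, v ≤ d s ∨ d s < j) (hhigh : ∀ s, j ≤ s → s < v → d s ≤ v) :
    IsMeander (m + 1) (fun s => if s = j then j else shift j (u (unshift j s)))
      (fun s => if s = j then v + 1 else shift j (d (unshift j s))) where
  u_le s hs := by
    split_ifs with h
    · exact h.ge
    · have h1 := unshift_cases j s
      have h2 := shift_cases j (u (unshift j s))
      have h3 := hM.u_le (unshift j s) (by omega)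
      omega
  lt_d s hs := by
    split_ifs with h
    · omega
    · have h1 := unshift_cases j s
      have h2 := shift_cases j (d (unshift j s))
      have h3 := hM.lt_d (unshift j s) (by omega)
      omega
  d_le s hs := by
    split_ifs with h
    · omega
    · have h1 := unshift_cases j s
      have h2 := shift_cases j (d (unshift j s))
      have h3 := hM.d_le (unshift j s) (by omega)
      omega
  u_nc s t hst ht := by
    have hs1 := unshift_cases j s
    have ht1 := unshift_cases j t
    split_ifs with h1 h2 h2
    · omega
    · have := shift_ne j (u (unshift j s))
      omega
    · have := shift_ne j (u (unshift j t))
      omega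
    · have h3 := hM.u_nc (unshift j s) (unshift j t) (by omega) (by omega)
      have h4 := shift_cases j (u (unshift j s))
      have h5 := shift_cases j (u (unshift j t))
      omega
  d_nc s t hst ht := by
    have hs1 := unshift_cases j s
    have ht1 := unshift_cases j t
    split_ifs with h1 h2 h2
    · omega
    -- The hypotheses `hlow` and `hhigh` say exactly that the new lower arc crosses no old one whose
    -- white end is to its left, respectively under it.
    · have h3 := hlow (unshift j s) (by omega)
      have h4 := shift_cases j (d (unshift j s))
      omega
    · have h3 := hhigh (unshift j t) (by omega)
      have h4 := shift_cases j (d (unshift j t))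
      omega
    · have h3 := hM.d_nc (unshift j s) (unshift j t) (by omega) (by omega)
      have h4 := shift_cases j (d (unshift j s))
      have h5 := shift_cases j (d (unshift j t))
      omega

/-- The halves `H` of the edges of a plane map with set of vertices `V`: the half `h` is attached
to the vertex `node h`, is opposite to the half `twin h` of the other colour, and its rank in the
counterclockwise order around its vertex is `rank h`. -/
structure HalfEdgeSystem (H V : Type*) where
  node : H → V
  blue : H → Bool
  twin : H → H
  rank : H → ℕ
  twin_twin : ∀ h, twin (twin h) = h
  blue_twin : ∀ h, blue (twin h) = !blue h
  rank_injective : ∀ x y, node x = node y → rank x = rank y → x = y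

namespace HalfEdgeSystem

variable {H V : Type*}

/-- Exchanging the colours. -/
@[simps]
def swap (S : HalfEdgeSystem H V) : HalfEdgeSystem H V where
  node := S.node
  blue h := !S.blue h
  twin := S.twin
  rank := S.rank
  twin_twin := S.twin_twin
  blue_twin h := by rw [S.blue_twin]
  rank_injective := S.rank_injective

/-- A drawing of the submap with set of vertices `N` and set of halves of edges `P` as a
meandering diagram of size `m`: the vertex `v` is the black point number `ν v`, and the half `h`
is the arc at the white point number `ε h`. -/
structure Labeling (S : HalfEdgeSystem H V) (m : ℕ) (N : Set V) (P : Set H) (ν : V → ℕ)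
    (ε : H → ℕ) (u d : ℕ → ℕ) : Prop where
  isMeander : IsMeander m u d
  bijOn_node : Set.BijOn ν N (Set.Iic m)
  twin_mem : ∀ x ∈ P, S.twin x ∈ P
  node_mem : ∀ x ∈ P, S.node x ∈ N
  label_twin : ∀ x ∈ P, ε (S.twin x) = ε x
  bijOn_edge : Set.BijOn ε {x | x ∈ P ∧ S.blue x = true} (Set.Iio m)
  u_eq : ∀ x ∈ P, S.blue x = true → u (ε x) = ν (S.node x)
  d_eq : ∀ x ∈ P, S.blue x = false → d (ε x) = ν (S.node x)
  blue_lt : ∀ x ∈ P, ∀ y ∈ P, S.blue x = true → S.blue y = true → S.node x = S.node y →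
    S.rank x < S.rank y → ε x < ε y
  red_lt : ∀ x ∈ P, ∀ y ∈ P, S.blue x = false → S.blue y = false → S.node x = S.node y →
    S.rank x < S.rank y → ε y < ε x

namespace Labeling

variable {S : HalfEdgeSystem H V} {m : ℕ} {N : Set V} {P : Set H} {ν : V → ℕ} {ε : H → ℕ}
  {u d : ℕ → ℕ}

theorem label_lt (hL : S.Labeling m N P ν ε u d) {x : H} (hx : x ∈ P) : ε x < m := by
  rcases hb : S.blue x with _ | _
  · rw [← hL.label_twin x hx]
    exact hL.bijOn_edge.mapsTo ⟨hL.twin_mem x hx, by rw [S.blue_twin, hb]; rfl⟩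
  · exact hL.bijOn_edge.mapsTo ⟨hx, hb⟩

theorem exists_red (hL : S.Labeling m N P ν ε u d) {s : ℕ} (hs : s < m) :
    ∃ z ∈ P, S.blue z = false ∧ ε z = s := by
  obtain ⟨b, ⟨hb, hb'⟩, rfl⟩ := hL.bijOn_edge.surjOn hs
  exact ⟨S.twin b, hL.twin_mem b hb, by rw [S.blue_twin, hb']; rfl, hL.label_twin b hb⟩

theorem red_injective (hL : S.Labeling m N P ν ε u d) {x y : H} (hx : x ∈ P) (hy : y ∈ P)
    (hxb : S.blue x = false) (hyb : S.blue y = false) (h : ε x = ε y) : x = y := by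
  have h1 : S.twin x = S.twin y := hL.bijOn_edge.injOn
    ⟨hL.twin_mem x hx, by rw [S.blue_twin, hxb]; rfl⟩
    ⟨hL.twin_mem y hy, by rw [S.blue_twin, hyb]; rfl⟩
    (by rw [hL.label_twin x hx, hL.label_twin y hy, h])
  rw [← S.twin_twin x, h1, S.twin_twin]

/-- Turning the drawing by a half-turn exchanges the half-planes, hence the colours, and preserves
the counterclockwise orders. -/
theorem swap (hL : S.Labeling m N P ν ε u d) :
    S.swap.Labeling m N P (fun v => m - ν v) (fun x => m - 1 - ε x)
      (fun s => m - d (m - 1 - s)) (fun s => m - u (m - 1 - s)) where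
  isMeander := hL.isMeander.reverse
  bijOn_node := by
    refine ⟨fun v _ => Nat.sub_le _ _, fun v hv w hw h => hL.bijOn_node.injOn hv hw ?_,
      fun k hk => ?_⟩
    · have h1 : ν v ≤ m := hL.bijOn_node.mapsTo hv
      have h2 : ν w ≤ m := hL.bijOn_node.mapsTo hw
      dsimp only at h
      omega
    · obtain ⟨v, hv, h⟩ := hL.bijOn_node.surjOn (Nat.sub_le m k : m - k ∈ Set.Iic m)
      have hk' : k ≤ m := hk
      exact ⟨v, hv, by dsimp only; omega⟩
  twin_mem := hL.twin_mem
  node_mem := hL.node_mem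
  label_twin x hx := by
    rw [swap_twin, hL.label_twin x hx]
  bijOn_edge := by
    refine ⟨fun x hx => ?_, fun x hx y hy h => ?_, fun k hk => ?_⟩
    · have := hL.label_lt hx.1
      exact Set.mem_Iio.2 (by dsimp only; omega)
    · have h1 := hL.label_lt hx.1
      have h2 := hL.label_lt hy.1
      obtain ⟨hx, hxb⟩ := hx
      obtain ⟨hy, hyb⟩ := hy
      rw [swap_blue, Bool.not_eq_true'] at hxb hyb
      dsimp only at h
      exact hL.red_injective hx hy hxb hyb (by omega)
    · have hk' : k < m := hk
      obtain ⟨z, hz, hzb, h⟩ := hL.exists_red (s := m - 1 - k) (by omega)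
      exact ⟨z, ⟨hz, by rw [swap_blue, hzb]; rfl⟩, by dsimp only; omega⟩
  u_eq x hx hb := by
    rw [swap_blue, Bool.not_eq_true'] at hb
    have h1 := hL.label_lt hx
    rw [show m - 1 - (m - 1 - ε x) = ε x by omega, hL.d_eq x hx hb]
    rfl
  d_eq x hx hb := by
    rw [swap_blue, Bool.not_eq_false'] at hb
    have h1 := hL.label_lt hx
    rw [show m - 1 - (m - 1 - ε x) = ε x by omega, hL.u_eq x hx hb]
    rfl
  blue_lt x hx y hy hxb hyb hxy h := by
    rw [swap_blue, Bool.not_eq_true'] at hxb hyb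
    have h1 := hL.red_lt x hx y hy hxb hyb hxy h
    have h2 := hL.label_lt hx
    omega
  red_lt x hx y hy hxb hyb hxy h := by
    rw [swap_blue, Bool.not_eq_false'] at hxb hyb
    have h1 := hL.blue_lt x hx y hy hxb hyb hxy h
    have h2 := hL.label_lt hy
    omega

/-- The place where a new blue leaf, attached to the red half `x`, has to be inserted. -/
theorem exists_place (hL : S.Labeling m N P ν ε u d) {x : H} (hx : S.node x ∈ N) (hxP : x ∉ P) :
    ∃ j ≤ ν (S.node x), (∀ s < j, ν (S.node x) ≤ d s ∨ d s < j) ∧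
      (∀ s, j ≤ s → s < ν (S.node x) → d s ≤ ν (S.node x)) ∧
      (∀ z ∈ P, S.blue z = false → S.node z = S.node x → S.rank x < S.rank z → ε z < j) ∧
      ∀ y ∈ P, S.blue y = false → S.node y = S.node x → S.rank y < S.rank x → j ≤ ε y := by
  classical
  set v := ν (S.node x) with hv
  have hvm : v ≤ m := hL.bijOn_node.mapsTo hx
  -- These are the white ends of the red arcs that have to stay inside the new one.
  let Y : ℕ → Prop := fun s => ∃ y ∈ P, S.blue y = false ∧ S.node y = S.node x ∧
    S.rank y < S.rank x ∧ ε y = s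
  have hex : ∃ j, ∀ s, j ≤ s → s < v → d s < v ∨ Y s := ⟨v, fun s h1 h2 => absurd h2 h1.not_gt⟩
  -- The new white point is moved from `v` to the left as long as it passes only arcs ending before
  -- `v`, or arcs at `v` that must be inner to the new one. The search stops at `j` because the arc
  -- at `j - 1` passes over `v` or is an arc at `v` that must be outer (`hpred`).
  obtain ⟨j, hj, hmin⟩ : ∃ j, (∀ s, j ≤ s → s < v → d s < v ∨ Y s) ∧
      ∀ i < j, ¬ ∀ s, i ≤ s → s < v → d s < v ∨ Y s :=
    ⟨Nat.find hex, Nat.find_spec hex, fun i hi => Nat.find_min hex hi⟩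
  have hjv : j ≤ v := by
    by_contra h
    exact hmin v (by omega) fun s h1 h2 => absurd h2 h1.not_gt
  have hdY : ∀ s, Y s → d s = v := by
    rintro _ ⟨y, hy, hyb, hyx, -, rfl⟩
    rw [hL.d_eq y hy hyb, hyx]
  have hpred : ∀ i, j = i + 1 → v ≤ d i ∧ ¬ Y i := by
    intro i hi
    have h1 := hmin i (by omega)
    push Not at h1
    obtain ⟨s, h2, h3, h4, h5⟩ := h1
    rcases h2.eq_or_lt with rfl | h6
    · exact ⟨h4, h5⟩
    · exact absurd (hj s (by omega) h3) (not_or.2 ⟨h4.not_gt, h5⟩)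
  refine ⟨j, hjv, fun s hs => ?_, fun s h1 h2 => ?_, fun z hz hzb hzx hr => ?_,
    fun y hy hyb hyx hr => ?_⟩
  · obtain ⟨i, rfl⟩ := Nat.exists_eq_succ_of_ne_zero (Nat.ne_zero_of_lt hs)
    have h1 := (hpred i rfl).1
    rcases (Nat.le_of_lt_succ hs).eq_or_lt with rfl | h2
    · exact Or.inl h1
    · have := hL.isMeander.d_nc s i h2 (by omega)
      omega
  · rcases hj s h1 h2 with h3 | h3
    · exact h3.le
    · exact (hdY s h3).le
  · by_contra! h
    have h1 := hL.isMeander.lt_d (ε z) (hL.label_lt hz)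
    have h2 : d (ε z) = v := by rw [hL.d_eq z hz hzb, hzx]
    rcases hj (ε z) h (by omega) with h3 | ⟨y, hy, hyb, hyx, hyr, h3⟩
    · omega
    · obtain rfl := hL.red_injective hy hz hyb hzb h3
      omega
  · by_contra! h
    obtain ⟨i, rfl⟩ := Nat.exists_eq_succ_of_ne_zero (Nat.ne_zero_of_lt h)
    obtain ⟨h1, h2⟩ := hpred i rfl
    have h3 : ε y ≠ i := fun h => h2 ⟨y, hy, hyb, hyx, hr, h⟩
    have h4 : d (ε y) = v := by rw [hL.d_eq y hy hyb, hyx]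
    have h5 := hL.isMeander.d_nc (ε y) i (by omega) (by omega)
    obtain ⟨z, hz, hzb, hzi⟩ := hL.exists_red (s := i) (by omega)
    -- An arc of `Y` left of `j - 1` forces the arc at `j - 1` to end at `v` too. By the order of
    -- ranks it is either in `Y`, or equal to `x`, or outer to the former: each case is absurd.
    have h6 : S.node z = S.node x := hL.bijOn_node.injOn (hL.node_mem z hz) hx (by
      rw [← hL.d_eq z hz hzb, hzi]
      omega)
    rcases lt_trichotomy (S.rank z) (S.rank x) with h7 | h7 | h7
    · exact h2 ⟨z, hz, hzb, h6, h7, hzi⟩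
    · exact hxP (S.rank_injective z x h6 h7 ▸ hz)
    · have := hL.red_lt y hy z hz hyb hzb (hyx.trans h6.symm) (hr.trans h7)
      omega

/-- The new vertex becomes black point `j` and its edge white point `j`, right after it, with a
shortest upper arc. The old numbers are shifted, which preserves their order; only the comparison of
the new red half with the old ones at its vertex needs the choice of `j`. -/
theorem exists_insert_of_red (hL : S.Labeling m N P ν ε u d) {x : H} (hx : S.node x ∈ N)
    (hx' : S.node (S.twin x) ∉ N) (hxb : S.blue x = false) :
    ∃ ν' ε' u' d', S.Labeling (m + 1) (insert (S.node (S.twin x)) N)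
      (insert x (insert (S.twin x) P)) ν' ε' u' d' := by
  classical
  have hxP : x ∉ P := fun h => hx' (hL.node_mem _ (hL.twin_mem x h))
  have htP : S.twin x ∉ P := fun h => hx' (hL.node_mem _ h)
  have htb : S.blue (S.twin x) = true := by rw [S.blue_twin, hxb]; rfl
  obtain ⟨j, hjv, hlow, hhigh, hz, hy⟩ := hL.exists_place hx hxP
  have hvm : ν (S.node x) ≤ m := hL.bijOn_node.mapsTo hx
  have hνN : ∀ v ∈ N, (if v = S.node (S.twin x) then j else shift j (ν v)) = shift j (ν v) :=
    fun v hv => if_neg fun (h : v = S.node (S.twin x)) => hx' (h ▸ hv)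
  have hεP : ∀ y ∈ P, (if y = x ∨ y = S.twin x then j else shift j (ε y)) = shift j (ε y) :=
    fun y hy => if_neg fun h => h.elim (fun h => hxP (h ▸ hy)) fun h => htP (h ▸ hy)
  have hεx : ∀ y, (y = x ∨ y = S.twin x) →
      (if y = x ∨ y = S.twin x then j else shift j (ε y)) = j := fun y hy => if_pos hy
  have hcases : ∀ y ∈ insert x (insert (S.twin x) P), y = x ∨ y = S.twin x ∨ y ∈ P :=
    fun y hy => hy
  refine ⟨fun v => if v = S.node (S.twin x) then j else shift j (ν v),
    fun y => if y = x ∨ y = S.twin x then j else shift j (ε y), _, _,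
    hL.isMeander.insert hjv hvm hlow hhigh, ?_, ?_, ?_, ?_, ?_, ?_, ?_, ?_, ?_⟩
  · refine ⟨?_, ?_, ?_⟩
    · rintro v (rfl | hv)
      · dsimp only
        rw [if_pos rfl]
        exact Set.mem_Iic.2 (by omega)
      · dsimp only
        rw [hνN v hv]
        have h1 : ν v ≤ m := hL.bijOn_node.mapsTo hv
        have h2 := shift_cases j (ν v)
        exact Set.mem_Iic.2 (by omega)
    · rintro v (rfl | hv) w (rfl | hw) h
      · rfl
      · dsimp only at h
        rw [hνN w hw, if_pos rfl] at h
        exact absurd h.symm (shift_ne _ _)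
      · dsimp only at h
        rw [hνN v hv, if_pos rfl] at h
        exact absurd h (shift_ne _ _)
      · dsimp only at h
        rw [hνN v hv, hνN w hw] at h
        exact hL.bijOn_node.injOn hv hw (shift_injective j h)
    · intro k hk
      have hk' : k ≤ m + 1 := hk
      rcases eq_or_ne k j with rfl | hkj
      · exact ⟨_, Set.mem_insert _ _, if_pos rfl⟩
      · have h1 := unshift_cases j k
        obtain ⟨v, hv, h2⟩ := hL.bijOn_node.surjOn
          (show unshift j k ∈ Set.Iic m from Set.mem_Iic.2 (by omega))
        refine ⟨v, Set.mem_insert_of_mem _ hv, ?_⟩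
        dsimp only
        rw [hνN v hv, h2, shift_unshift hkj]
  · intro y hy
    rcases hcases y hy with rfl | rfl | hy
    · exact Or.inr (Or.inl rfl)
    · exact Or.inl (S.twin_twin x)
    · exact Or.inr (Or.inr (hL.twin_mem y hy))
  · intro y hy
    rcases hcases y hy with rfl | rfl | hy
    · exact Or.inr hx
    · exact Or.inl rfl
    · exact Or.inr (hL.node_mem y hy)
  · intro y hy
    rcases hcases y hy with rfl | rfl | hy
    · rw [hεx _ (Or.inr rfl), hεx _ (Or.inl rfl)]
    · rw [hεx _ (Or.inl (S.twin_twin x)), hεx _ (Or.inr rfl)]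
    · rw [hεP _ hy, hεP _ (hL.twin_mem y hy), hL.label_twin y hy]
  · refine ⟨?_, ?_, ?_⟩
    · rintro y ⟨hy, -⟩
      dsimp only
      rcases hcases y hy with rfl | rfl | hy
      · rw [hεx _ (Or.inl rfl)]
        exact Set.mem_Iio.2 (by omega)
      · rw [hεx _ (Or.inr rfl)]
        exact Set.mem_Iio.2 (by omega)
      · rw [hεP _ hy]
        have h1 := hL.label_lt hy
        have h2 := shift_cases j (ε y)
        exact Set.mem_Iio.2 (by omega)
    · rintro y ⟨hy, hyb⟩ z ⟨hz, hzb⟩ h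
      dsimp only at h
      rcases hcases y hy with rfl | rfl | hy
      · rw [hxb] at hyb
        exact Bool.noConfusion hyb
      · rcases hcases z hz with rfl | rfl | hz
        · rw [hxb] at hzb
          exact Bool.noConfusion hzb
        · rfl
        · rw [hεP _ hz, hεx _ (Or.inr rfl)] at h
          exact absurd h.symm (shift_ne _ _)
      · rcases hcases z hz with rfl | rfl | hz
        · rw [hxb] at hzb
          exact Bool.noConfusion hzb
        · rw [hεP _ hy, hεx _ (Or.inr rfl)] at h
          exact absurd h (shift_ne _ _)
        · rw [hεP _ hy, hεP _ hz] at h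
          exact hL.bijOn_edge.injOn ⟨hy, hyb⟩ ⟨hz, hzb⟩ (shift_injective j h)
    · intro k hk
      have hk' : k < m + 1 := hk
      rcases eq_or_ne k j with rfl | hkj
      · exact ⟨_, ⟨Or.inr (Or.inl rfl), htb⟩, hεx _ (Or.inr rfl)⟩
      · have h1 := unshift_cases j k
        obtain ⟨y, ⟨hy, hyb⟩, h2⟩ := hL.bijOn_edge.surjOn
          (show unshift j k ∈ Set.Iio m from Set.mem_Iio.2 (by omega))
        refine ⟨y, ⟨Or.inr (Or.inr hy), hyb⟩, ?_⟩
        dsimp only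
        rw [hεP y hy, h2, shift_unshift hkj]
  · intro y hy hyb
    rcases hcases y hy with rfl | rfl | hy
    · rw [hxb] at hyb
      exact Bool.noConfusion hyb
    · rw [hεx _ (Or.inr rfl), if_pos rfl, if_pos rfl]
    · rw [hεP _ hy, if_neg (shift_ne _ _), unshift_shift, hL.u_eq y hy hyb,
        hνN _ (hL.node_mem y hy)]
  · intro y hy hyb
    rcases hcases y hy with rfl | rfl | hy
    · rw [hεx _ (Or.inl rfl), if_pos rfl, hνN _ hx]
      have := shift_cases j (ν (S.node y))
      omega
    · rw [htb] at hyb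
      exact Bool.noConfusion hyb
    · rw [hεP _ hy, if_neg (shift_ne _ _), unshift_shift, hL.d_eq y hy hyb,
        hνN _ (hL.node_mem y hy)]
  · intro y hy z hz hyb hzb hyz hr
    rcases hcases y hy with rfl | rfl | hy
    · rw [hxb] at hyb
      exact Bool.noConfusion hyb
    · rcases hcases z hz with rfl | rfl | hz
      · rw [hxb] at hzb
        exact Bool.noConfusion hzb
      · exact absurd hr (lt_irrefl _)
      · exact absurd (hyz ▸ hL.node_mem z hz) hx'
    · rcases hcases z hz with rfl | rfl | hz
      · rw [hxb] at hzb
        exact Bool.noConfusion hzb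
      · exact absurd (hyz ▸ hL.node_mem y hy) hx'
      · rw [hεP _ hy, hεP _ hz]
        exact shift_lt_shift (hL.blue_lt y hy z hz hyb hzb hyz hr)
  · intro y hyP z hzP hyb hzb hyz hr
    rcases hcases y hyP with rfl | rfl | hyQ
    · rcases hcases z hzP with rfl | rfl | hzQ
      · exact absurd hr (lt_irrefl _)
      · rw [htb] at hzb
        exact Bool.noConfusion hzb
      · rw [hεx _ (Or.inl rfl), hεP _ hzQ]
        have h1 := hz z hzQ hzb hyz.symm hr
        have h2 := shift_cases j (ε z)
        omega
    · rw [htb] at hyb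
      exact Bool.noConfusion hyb
    · rcases hcases z hzP with rfl | rfl | hzQ
      · rw [hεx _ (Or.inl rfl), hεP _ hyQ]
        have h1 := hy y hyQ hyb hyz hr
        have h2 := shift_cases j (ε y)
        omega
      · rw [htb] at hzb
        exact Bool.noConfusion hzb
      · rw [hεP _ hyQ, hεP _ hzQ]
        exact shift_lt_shift (hL.red_lt y hyQ z hzQ hyb hzb hyz hr)

/-- A blue half becomes red in the swapped system, so this case is the other one seen after a
half-turn. -/
theorem exists_insert (hL : S.Labeling m N P ν ε u d) {x : H} (hx : S.node x ∈ N)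
    (hx' : S.node (S.twin x) ∉ N) :
    ∃ ν' ε' u' d', S.Labeling (m + 1) (insert (S.node (S.twin x)) N)
      (insert x (insert (S.twin x) P)) ν' ε' u' d' := by
  rcases hxb : S.blue x with _ | _
  · exact hL.exists_insert_of_red hx hx' hxb
  · obtain ⟨ν', ε', u', d', h⟩ := hL.swap.exists_insert_of_red (x := x) hx hx'
      (by rw [swap_blue, hxb]; rfl)
    have h1 := h.swap
    have h2 : S.swap.swap = S := by
      cases S
      simp only [HalfEdgeSystem.swap, Bool.not_not]
    rw [h2] at h1
    exact ⟨_, _, _, _, h1⟩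

end Labeling

/-- A connected system has drawings of all its edges, as soon as it has as few edges as a tree. -/
theorem exists_labeling (S : HalfEdgeSystem H V) {n : ℕ} (hV : Nat.card V = n + 1)
    (hH : {x | S.blue x = true}.ncard = n) (hfin : {x | S.blue x = true}.Finite)
    (hS : ∀ (N : Set V) (v w : V), v ∈ N → w ∉ N → ∃ x, S.node x ∈ N ∧ S.node (S.twin x) ∉ N) :
    ∃ ν ε u d, S.Labeling n Set.univ Set.univ ν ε u d := by
  have hVf : Finite V := Nat.finite_of_card_ne_zero (by omega)
  have key : ∀ m ≤ n, ∃ N P ν ε u d, N.ncard = m + 1 ∧ S.Labeling m N P ν ε u d := by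
    intro m
    induction m with
    | zero =>
      intro _
      have : Nonempty V := (Nat.card_pos_iff.1 (by omega)).1
      obtain ⟨v⟩ := this
      refine ⟨{v}, ∅, fun _ => 0, fun _ => 0, fun _ => 0, fun _ => 0, Set.ncard_singleton v,
        ⟨by omega, by omega, by omega, by omega, by omega⟩, ⟨fun _ _ => Set.mem_Iic.2 le_rfl,
        fun _ h _ h' _ => h.trans h'.symm, fun k hk => ⟨v, rfl, (Nat.le_zero.1 hk).symm⟩⟩,
        fun x hx => hx.elim, fun x hx => hx.elim, fun x hx => hx.elim, ⟨fun _ h => h.1.elim,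
        fun _ h => h.1.elim, fun k hk => absurd hk (Nat.not_lt_zero k)⟩,
        fun x hx => hx.elim, fun x hx => hx.elim, fun x hx => hx.elim, fun x hx => hx.elim⟩
    | succ m ih =>
      intro hm
      obtain ⟨N, P, ν, ε, u, d, hN, hL⟩ := ih (by omega)
      obtain ⟨v, hv⟩ := Set.nonempty_of_ncard_ne_zero (s := N) (by omega)
      obtain ⟨w, hw⟩ : ∃ w, w ∉ N := by
        by_contra! h
        rw [Set.eq_univ_of_forall h, Set.ncard_univ] at hN
        omega
      obtain ⟨x, hx, hx'⟩ := hS N v w hv hw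
      obtain ⟨ν', ε', u', d', h⟩ := hL.exists_insert hx hx'
      exact ⟨_, _, _, _, _, _, by rw [Set.ncard_insert_of_notMem hx', hN], h⟩
  obtain ⟨N, P, ν, ε, u, d, hN, hL⟩ := key n le_rfl
  have h1 : N = Set.univ :=
    Set.eq_of_subset_of_ncard_le (Set.subset_univ N) (by rw [Set.ncard_univ, hN, hV])
  have h2 : {x | x ∈ P ∧ S.blue x = true} = {x | S.blue x = true} := by
    -- The drawing of all `n + 1` vertices has used `n` blue halves, which are all there are.
    refine Set.eq_of_subset_of_ncard_le (fun x hx => hx.2) ?_ hfin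
    rw [hH, ← hL.bijOn_edge.injOn.ncard_image, hL.bijOn_edge.image_eq,
      ← Finset.coe_range, Set.ncard_coe_finset, Finset.card_range]
  have h3 : P = Set.univ := by
    refine Set.eq_univ_of_forall fun x => ?_
    rcases hb : S.blue x with _ | _
    · have h4 : S.twin x ∈ {x | x ∈ P ∧ S.blue x = true} := by
        rw [h2]
        change S.blue (S.twin x) = true
        rw [S.blue_twin, hb]
        rfl
      have h5 := hL.twin_mem _ h4.1
      rwa [S.twin_twin] at h5
    · have h4 : x ∈ {x | x ∈ P ∧ S.blue x = true} := by
        rw [h2]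
        exact hb
      exact h4.1
  subst h1 h3
  exact ⟨ν, ε, u, d, hL⟩

end HalfEdgeSystem

/-! ### Bicolored blossoming trees are openings of meandering trees -/

/-- Whether the kind of a half-edge is blue. -/
def Kind.isBlue : Kind → Bool
  | Kind.blue => true
  | _ => false

theorem Kind.isBlue_eq_true {c : Kind} : Kind.isBlue c = true ↔ c = Kind.blue := by
  cases c <;> simp [Kind.isBlue]

namespace BudMap

variable {B : BudMap} {n : ℕ}

namespace IsBicoloredBlossomingTree

theorem kind_twin_ne_bud (hB : B.IsBicoloredBlossomingTree n) {h : B.HalfEdge}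
    (hh : B.kind h ≠ Kind.bud) : B.kind (B.twin h) ≠ Kind.bud := by
  rcases hk : B.kind h with _ | _ | _
  · exact absurd hk hh
  · rw [hB.twin_blue h hk]
    exact fun h => Kind.noConfusion h
  · rw [hB.twin_red h hk]
    exact fun h => Kind.noConfusion h

theorem isBlue_twin (hB : B.IsBicoloredBlossomingTree n) {h : B.HalfEdge}
    (hh : B.kind h ≠ Kind.bud) :
    Kind.isBlue (B.kind (B.twin h)) = !Kind.isBlue (B.kind h) := by
  rcases hk : B.kind h with _ | _ | _
  · exact absurd hk hh
  · rw [hB.twin_blue h hk]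
    rfl
  · rw [hB.twin_red h hk]
    rfl

/-- The half-edges of the plain edges of a bicolored blossoming tree, with a ranking of the
half-edges at each node. -/
def system (hB : B.IsBicoloredBlossomingTree n) (ρ : B.HalfEdge → ℕ)
    (hρ : ∀ x y, B.node x = B.node y → ρ x = ρ y → x = y) :
    HalfEdgeSystem B.PlainHalf B.Node where
  node h := B.node h.1
  blue h := Kind.isBlue (B.kind h.1)
  twin h := ⟨B.twin h.1, hB.kind_twin_ne_bud h.2⟩
  rank h := ρ h.1
  twin_twin h := Subtype.ext (hB.twin_twin h.1)
  blue_twin h := hB.isBlue_twin h.2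
  rank_injective x y h h' := Subtype.ext (hρ x.1 y.1 h h')

/-- The involution `twin` exchanges blue and red halves, so the former are half of the `2 n`. -/
theorem ncard_blue (hB : B.IsBicoloredBlossomingTree n) :
    {h : B.PlainHalf | Kind.isBlue (B.kind h.1) = true}.ncard = n := by
  have := hB.finite
  have : Finite B.PlainHalf := Subtype.finite
  let t : B.PlainHalf → B.PlainHalf := fun h => ⟨B.twin h.1, hB.kind_twin_ne_bud h.2⟩
  have ht : Function.Involutive t := fun h => Subtype.ext (hB.twin_twin h.1)
  have h1 : t '' {h | Kind.isBlue (B.kind h.1) = true} =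
      {h : B.PlainHalf | Kind.isBlue (B.kind h.1) = true}ᶜ := by
    ext h
    rw [Set.mem_image_iff_of_inverse ht.leftInverse ht.rightInverse]
    change Kind.isBlue (B.kind (B.twin h.1)) = true ↔ ¬ Kind.isBlue (B.kind h.1) = true
    rw [hB.isBlue_twin h.2, Bool.not_eq_true', Bool.not_eq_true]
  have h2 := Set.ncard_add_ncard_compl {h : B.PlainHalf | Kind.isBlue (B.kind h.1) = true}
  rw [← h1, Set.ncard_image_of_injective _ ht.injective, hB.card_plain] at h2
  omega

theorem graph_adj_iff (hB : B.IsBicoloredBlossomingTree n) {v w : B.Node} :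
    B.graph.Adj v w ↔ ∃ h : B.PlainHalf, B.node h.1 = v ∧ B.node (B.twin h.1) = w := by
  rw [graph, SimpleGraph.fromRel_adj]
  constructor
  · rintro ⟨-, h | ⟨h, h1, h2⟩⟩
    · exact h
    · exact ⟨⟨B.twin h.1, hB.kind_twin_ne_bud h.2⟩, h2, by rw [hB.twin_twin, h1]⟩
  · rintro ⟨h, rfl, rfl⟩
    exact ⟨hB.no_loop h.1 h.2, Or.inl ⟨h, rfl, rfl⟩⟩

/-- Each edge of the simple graph comes from exactly one blue half, so the tree has `n` edges. -/
theorem card_node (hB : B.IsBicoloredBlossomingTree n) : Nat.card B.Node = n + 1 := by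
  have := hB.finite
  have : Finite B.Node := Quot.finite _
  let f : {h : B.PlainHalf | Kind.isBlue (B.kind h.1) = true} → B.graph.edgeSet :=
    fun h => ⟨s(B.node h.1.1, B.node (B.twin h.1.1)), hB.graph_adj_iff.2 ⟨h.1, rfl, rfl⟩⟩
  have hf : Function.Bijective f := by
    constructor
    · rintro ⟨h, hh⟩ ⟨h', hh'⟩ he
      have h1 := congrArg Subtype.val he
      change s(B.node h.1, B.node (B.twin h.1)) = s(B.node h'.1, B.node (B.twin h'.1)) at h1
      rw [Sym2.eq_iff] at h1
      rcases h1 with ⟨h1, h2⟩ | ⟨h1, h2⟩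
      · exact Subtype.ext (Subtype.ext (hB.no_multiple_edge h.1 h'.1 h.2 h'.2 h1 h2))
      · have h3 := hB.no_multiple_edge h.1 (B.twin h'.1) h.2 (hB.kind_twin_ne_bud h'.2) h1
          (by rw [hB.twin_twin, h2])
        have h4 := hB.isBlue_twin h'.2
        change Kind.isBlue (B.kind h.1) = true at hh
        change Kind.isBlue (B.kind h'.1) = true at hh'
        rw [← h3, hh, hh'] at h4
        exact Bool.noConfusion h4
    · rintro ⟨e, he⟩
      induction e using Sym2.ind with
      | _ v w =>
        obtain ⟨h, rfl, rfl⟩ := hB.graph_adj_iff.1 he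
        rcases hb : Kind.isBlue (B.kind h.1) with _ | _
        · refine ⟨⟨⟨B.twin h.1, hB.kind_twin_ne_bud h.2⟩, ?_⟩, Subtype.ext ?_⟩
          · change Kind.isBlue (B.kind (B.twin h.1)) = true
            rw [hB.isBlue_twin h.2, hb]
            rfl
          · change s(B.node (B.twin h.1), B.node (B.twin (B.twin h.1))) = _
            rw [hB.twin_twin, Sym2.eq_swap]
        · exact ⟨⟨h, hb⟩, rfl⟩
  have h1 := (SimpleGraph.isTree_iff_connected_and_card.1 hB.isTree).2
  rw [← Nat.card_eq_of_bijective f hf] at h1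
  rw [← h1, ← hB.ncard_blue]
  rfl

theorem exists_boundary (hB : B.IsBicoloredBlossomingTree n) (N : Set B.Node) (v w : B.Node)
    (hv : v ∈ N) (hw : w ∉ N) :
    ∃ h : B.PlainHalf, B.node h.1 ∈ N ∧ B.node (B.twin h.1) ∉ N := by
  obtain ⟨a, b, hab, ha, hb⟩ := exists_adj_of_connected hB.isTree.connected N hv hw
  obtain ⟨h, rfl, rfl⟩ := hB.graph_adj_iff.1 hab
  exact ⟨h, ha, hb⟩

/-- The half-edges at a node, in counterclockwise order, starting from the bud that precedes the
blue ones: `rank` is `0` at this bud and `mid` at the other one. -/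
structure Ranking (B : BudMap) (rank : B.HalfEdge → ℕ) (mid : B.Node → ℕ) : Prop where
  injective : ∀ x y, B.node x = B.node y → rank x = rank y → x = y
  next : ∀ x, rank (B.next x) = rank x + 1 ∨
    rank (B.next x) = 0 ∧ ∀ y, B.node y = B.node x → rank y ≤ rank x
  kind : ∀ x, B.kind x = Kind.bud ∧ rank x = 0 ∨
    B.kind x = Kind.blue ∧ 0 < rank x ∧ rank x < mid (B.node x) ∨
    B.kind x = Kind.bud ∧ rank x = mid (B.node x) ∨
    B.kind x = Kind.red ∧ mid (B.node x) < rank x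
  mid_pos : ∀ v, 0 < mid v
  exists_zero : ∀ v, ∃ x, B.node x = v ∧ rank x = 0
  exists_mid : ∀ v, ∃ x, B.node x = v ∧ rank x = mid v

/-- All half-edges at a node are met when turning around it. -/
theorem exists_iterate_next (hB : B.IsBicoloredBlossomingTree n) {b x : B.HalfEdge} {N : ℕ}
    (hN : 0 < N) (hb : B.next^[N] b = b) (h : B.node x = B.node b) :
    ∃ i < N, B.next^[i] b = x := by
  -- The predicate "met within one period from `b`" is invariant under `next`, by periodicity and
  -- injectivity; it therefore descends to the nodes and can be transported from `b` to `x`.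
  have key : (∃ i < N, B.next^[i] b = x) = ∃ i < N, B.next^[i] b = b :=
    congrArg (Quot.lift (fun x => ∃ i < N, B.next^[i] b = x) <| by
      rintro x _ rfl
      refine propext ⟨?_, ?_⟩
      · rintro ⟨i, hi, rfl⟩
        rcases (Nat.succ_le_of_lt hi).eq_or_lt with h1 | h1
        · exact ⟨0, hN, by rw [← Function.iterate_succ_apply' B.next, h1, hb]; rfl⟩
        · exact ⟨i + 1, h1, Function.iterate_succ_apply' _ _ _⟩
      · rintro ⟨i, hi, h1⟩
        rcases i with _ | i
        · refine ⟨N - 1, by omega, hB.next_bijective.injective ?_⟩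
          rw [← Function.iterate_succ_apply' B.next, show (N - 1).succ = N by omega, hb, ← h1]
          rfl
        · exact ⟨i, by omega, hB.next_bijective.injective
            ((Function.iterate_succ_apply' _ _ _).symm.trans h1)⟩) h
  rw [key]
  exact ⟨0, hN, rfl⟩

/-- The rank counts the turns needed from the bud `b` that opens the blue group, and `mid` is the
rank of the other bud. The kinds met on the way show that `b` does not recur before a full turn, so
ranks are consecutive and well defined. -/
theorem exists_ranking (hB : B.IsBicoloredBlossomingTree n) :
    ∃ rank mid, Ranking B rank mid := by
  classical
  have hsplit : ∀ v, ∃ (b : B.HalfEdge) (m l : ℕ), B.node b = v ∧ B.kind b = Kind.bud ∧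
      B.kind (B.next^[m + 1] b) = Kind.bud ∧ B.next^[m + 1] b ≠ b ∧
      (∀ i, 0 < i → i < m + 1 → B.kind (B.next^[i] b) = Kind.blue) ∧
      B.next^[m + 1 + (l + 1)] b = b ∧
      ∀ i, m + 1 < i → i < m + 1 + (l + 1) → B.kind (B.next^[i] b) = Kind.red := by
    intro v
    obtain ⟨b, b', h0, h1, h2, h3, ⟨m, rfl, h4⟩, ⟨l, h5, h6⟩⟩ := hB.split v
    refine ⟨b, m, l, h0, h1, h2, h3.symm, fun i hi him => ?_, ?_, fun i hi hil => ?_⟩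
    · obtain ⟨i, rfl⟩ := Nat.exists_eq_succ_of_ne_zero hi.ne'
      exact h4 i (by omega)
    · rw [add_comm, Function.iterate_add_apply, h5]
    · obtain ⟨i, rfl⟩ := Nat.exists_eq_add_of_lt hi
      rw [show m + 1 + i + 1 = (i + 1) + (m + 1) by omega, Function.iterate_add_apply]
      exact h6 i (by omega)
  choose b m l hb hk hk' hne hblue hper hred using hsplit
  have hex : ∀ x, ∃ i, B.next^[i] (b (B.node x)) = x := fun x => by
    obtain ⟨i, -, hi⟩ := hB.exists_iterate_next (by omega) (hper (B.node x)) (hb (B.node x)).symm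
    exact ⟨i, hi⟩
  let rank : B.HalfEdge → ℕ := fun x => Nat.find (hex x)
  have hr : ∀ x, B.next^[rank x] (b (B.node x)) = x := fun x => Nat.find_spec (hex x)
  have hmin : ∀ x i, B.next^[i] (b (B.node x)) = x → rank x ≤ i := fun x i h =>
    Nat.find_min' (hex x) h
  have hlt : ∀ x, rank x < m (B.node x) + 1 + (l (B.node x) + 1) := fun x => by
    obtain ⟨i, hi, h⟩ :=
      hB.exists_iterate_next (by omega) (hper (B.node x)) (hb (B.node x)).symm
    exact (hmin x i h).trans_lt hi
  have hret : ∀ v i, 0 < i → i < m v + 1 + (l v + 1) → B.next^[i] (b v) ≠ b v := by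
    intro v i h1 h2 h3
    rcases lt_trichotomy i (m v + 1) with h | rfl | h
    · have h4 := hblue v i h1 h
      rw [h3, hk] at h4
      exact Kind.noConfusion h4
    · exact hne v h3
    · have h4 := hred v i h h2
      rw [h3, hk] at h4
      exact Kind.noConfusion h4
  have hrank : ∀ v i, i < m v + 1 + (l v + 1) → rank (B.next^[i] (b v)) = i := by
    intro v i hi
    have hv : B.node (B.next^[i] (b v)) = v := (node_next_iterate _ _).trans (hb v)
    have h1 := hr (B.next^[i] (b v))
    have h2 := hmin (B.next^[i] (b v)) i (by rw [hv])
    rw [hv] at h1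
    rcases h2.eq_or_lt with h3 | h3
    · exact h3
    · exfalso
      obtain ⟨k, hk⟩ := Nat.exists_eq_add_of_lt h3
      have h4 : B.next^[rank (B.next^[i] (b v))] (b v) =
          B.next^[rank (B.next^[i] (b v))] (B.next^[k + 1] (b v)) := by
        rw [h1, ← Function.iterate_add_apply, ← add_assoc, ← hk]
      exact hret v (k + 1) (by omega) (by omega)
        (hB.next_bijective.injective.iterate _ h4).symm
  refine ⟨rank, fun v => m v + 1, ⟨fun x y hxy h => ?_, fun x => ?_, fun x => ?_,
    fun v => Nat.succ_pos _, fun v => ⟨b v, hb v, hrank v 0 (by omega)⟩,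
    fun v => ⟨B.next^[m v + 1] (b v), (node_next_iterate _ _).trans (hb v),
      hrank v _ (by omega)⟩⟩⟩
  · rw [← hr x, ← hr y, hxy, h]
  · have h1 := hlt x
    have h2 : B.next x = B.next^[rank x + 1] (b (B.node x)) := by
      rw [Function.iterate_succ_apply', hr]
    rcases (Nat.succ_le_of_lt h1).eq_or_lt with h3 | h3
    · refine Or.inr ⟨?_, fun y hy => ?_⟩
      · rw [h2, show rank x + 1 = _ from h3, hper]
        exact hrank _ 0 (by omega)
      · have h4 := hlt y
        rw [hy] at h4
        omega
    · left
      rw [h2]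
      exact hrank _ _ h3
  · have h1 := hlt x
    have h2 := hr x
    rcases Nat.eq_zero_or_pos (rank x) with h3 | h3
    · rw [h3] at h2
      replace h2 : b (B.node x) = x := h2
      exact Or.inl ⟨h2 ▸ hk _, h3⟩
    · right
      rcases lt_trichotomy (rank x) (m (B.node x) + 1) with h4 | h4 | h4
      · refine Or.inl ⟨?_, h3, h4⟩
        rw [← hblue _ _ h3 h4, h2]
      · refine Or.inr (Or.inl ⟨?_, h4⟩)
        rw [← hk' (B.node x), ← h4, h2]
      · refine Or.inr (Or.inr ⟨?_, h4⟩)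
        rw [← hred _ _ h4 h1, h2]

end IsBicoloredBlossomingTree

end BudMap

/-- Every bicolored blossoming tree is isomorphic to the opening of a meandering tree. -/
theorem BudMap.IsBicoloredBlossomingTree.exists_iso {B : BudMap} {n : ℕ}
    (hB : B.IsBicoloredBlossomingTree n) :
    ∃ M ∈ meanderingTrees n, Nonempty (Iso B (opened n M)) := by
  have := hB.finite
  have : Finite B.PlainHalf := Subtype.finite
  obtain ⟨rank, mid, hR⟩ := hB.exists_ranking
  obtain ⟨ν, ε, u, d, hL⟩ := (hB.system rank hR.injective).exists_labeling hB.card_node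
    hB.ncard_blue (Set.toFinite {h : B.PlainHalf | Kind.isBlue (B.kind h.1) = true}) hB.exists_boundary
  have hM := hL.isMeander
  have hν : ∀ v, ν v ≤ n := fun v => hL.bijOn_node.mapsTo (Set.mem_univ v)
  have hνinj : Function.Injective ν := Set.injOn_univ.1 hL.bijOn_node.injOn
  have hε : ∀ h, ε h < n := fun h => hL.label_lt (Set.mem_univ h)
  have hu : ∀ h : B.PlainHalf, B.kind h.1 = Kind.blue → u (ε h) = ν (B.node h.1) := fun h hh =>
    hL.u_eq h (Set.mem_univ h) (Kind.isBlue_eq_true.2 hh)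
  have hd : ∀ h : B.PlainHalf, B.kind h.1 = Kind.red → d (ε h) = ν (B.node h.1) := fun h hh =>
    hL.d_eq h (Set.mem_univ h) (congrArg Kind.isBlue hh)
  -- A boundary edge of the tree for the preimage of `X` under `ν` is drawn as an edge leaving `X`.
  have hX : CutConnected n u d := by
    intro X i hi j hj hiX hjX
    obtain ⟨v, -, rfl⟩ := hL.bijOn_node.surjOn (Set.mem_Iic.2 hi)
    obtain ⟨w, -, rfl⟩ := hL.bijOn_node.surjOn (Set.mem_Iic.2 hj)
    obtain ⟨h, h1, h2⟩ := hB.exists_boundary (ν ⁻¹' X) v w hiX hjX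
    have htw : ε ⟨B.twin h.1, hB.kind_twin_ne_bud h.2⟩ = ε h := hL.label_twin h (Set.mem_univ h)
    refine ⟨ε h, hε h, fun h3 => ?_⟩
    rcases hk : B.kind h.1 with _ | _ | _
    · exact h.2 hk
    · have h4 := hd ⟨B.twin h.1, hB.kind_twin_ne_bud h.2⟩ (hB.twin_blue h.1 hk)
      rw [htw] at h4
      rw [hu h hk, h4] at h3
      exact h2 (h3.1 h1)
    · have h4 := hu ⟨B.twin h.1, hB.kind_twin_ne_bud h.2⟩ (hB.twin_red h.1 hk)
      rw [htw] at h4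
      rw [hd h hk, h4] at h3
      exact h2 (h3.2 h1)
  refine ⟨arcs n u d, hM.isMeanderingTree_of_cutConnected hX, ?_⟩
  -- The isomorphism `f` is specified by kind and rank: rank `0` goes to a right bud, the ranks
  -- below `mid` to upper arcs, `mid` to a left bud and the larger ranks to lower arcs.
  have hex : ∀ x : B.HalfEdge, ∃ y : DrawnHalfEdge n (arcs n u d),
      (rank x = 0 ∧ B.kind x = Kind.bud ∧ y = rightAt u d _ (hν (B.node x))) ∨
      (∃ h : B.PlainHalf, h.1 = x ∧ 0 < rank x ∧ rank x < mid (B.node x) ∧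
        B.kind x = Kind.blue ∧ y = upperAt u d _ (hε h)) ∨
      (rank x = mid (B.node x) ∧ B.kind x = Kind.bud ∧ y = leftAt u d _ (hν (B.node x))) ∨
      (∃ h : B.PlainHalf, h.1 = x ∧ mid (B.node x) < rank x ∧
        B.kind x = Kind.red ∧ y = lowerAt u d _ (hε h)) := by
    intro x
    rcases hR.kind x with ⟨h1, h2⟩ | ⟨h1, h2, h3⟩ | ⟨h1, h2⟩ | ⟨h1, h2⟩
    · exact ⟨_, Or.inl ⟨h2, h1, rfl⟩⟩
    · exact ⟨_, Or.inr (Or.inl ⟨⟨x, by rw [h1]; exact fun h => Kind.noConfusion h⟩, rfl, h2, h3,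
        h1, rfl⟩)⟩
    · exact ⟨_, Or.inr (Or.inr (Or.inl ⟨h2, h1, rfl⟩))⟩
    · exact ⟨_, Or.inr (Or.inr (Or.inr ⟨⟨x, by rw [h1]; exact fun h => Kind.noConfusion h⟩, rfl,
        h2, h1, rfl⟩))⟩
  choose f hf using hex
  have hblack : ∀ x, (f x).black = 2 * ν (B.node x) := by
    intro x
    rcases hf x with ⟨-, -, h⟩ | ⟨h, rfl, -, -, hk, h'⟩ | ⟨-, -, h⟩ | ⟨h, rfl, -, hk, h'⟩
    · rw [h, black_rightAt]
    · rw [h', black_upperAt, hu h hk]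
    · rw [h, black_leftAt]
    · rw [h', black_lowerAt, hd h hk]
  have hkind : ∀ x, (f x).kind = B.kind x := by
    intro x
    rcases hf x with ⟨-, hk, h⟩ | ⟨k, -, -, -, hk, h⟩ | ⟨-, hk, h⟩ | ⟨k, -, -, hk, h⟩ <;>
      rw [h, hk] <;> rfl
  -- At each node `f` turns the order of ranks into that of angles; for arcs this is the purpose of
  -- `blue_lt` and `red_lt`.
  have hangle : ∀ x y, B.node x = B.node y → rank x < rank y → (f x).angle < (f y).angle := by
    intro x y hxy hr
    have hpos := hR.mid_pos (B.node y)
    have hmid : mid (B.node x) = mid (B.node y) := by rw [hxy]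
    rcases hf x with ⟨h1, -, h⟩ | ⟨k, rfl, h1, h2, hk, h⟩ | ⟨h1, -, h⟩ | ⟨k, rfl, h1, hk, h⟩ <;>
    rcases hf y with ⟨h3, -, h'⟩ | ⟨k', rfl, h3, h4, hk', h'⟩ | ⟨h3, -, h'⟩ |
      ⟨k', rfl, h3, hk', h'⟩ <;> rw [h, h'] <;> simp only [angle_rightAt, angle_upperAt,
        angle_leftAt, angle_lowerAt]
    · omega
    · omega
    · omega
    · have := hε k'
      omega
    · omega
    · have := hL.blue_lt k (Set.mem_univ _) k' (Set.mem_univ _) (Kind.isBlue_eq_true.2 hk)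
        (Kind.isBlue_eq_true.2 hk') hxy hr
      omega
    · have := hε k
      omega
    · have := hε k
      have := hε k'
      omega
    · omega
    · omega
    · omega
    · have := hε k'
      omega
    · omega
    · omega
    · omega
    · have := hL.red_lt k (Set.mem_univ _) k' (Set.mem_univ _) (congrArg Kind.isBlue hk)
        (congrArg Kind.isBlue hk') hxy hr
      omega
  have hnode : ∀ x y, (f x).black = (f y).black → B.node x = B.node y := by
    intro x y h
    rw [hblack, hblack] at h
    exact hνinj (by omega)
  have hinj : Function.Injective f := by
    intro x y h
    have h1 := hnode x y (congrArg _ h)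
    rcases lt_trichotomy (rank x) (rank y) with h2 | h2 | h2
    · exact absurd (congrArg angle h) (hangle x y h1 h2).ne
    · exact hR.injective x y h1 h2
    · exact absurd (congrArg angle h) (hangle y x h1.symm h2).ne'
  have hsurj : Function.Surjective f := by
    intro y
    induction y using drawnCases with
    | right k hk =>
      obtain ⟨v, -, rfl⟩ := hL.bijOn_node.surjOn (Set.mem_Iic.2 hk)
      obtain ⟨x, rfl, hx⟩ := hR.exists_zero v
      have hpos := hR.mid_pos (B.node x)
      refine ⟨x, ?_⟩
      rcases hf x with ⟨-, -, h⟩ | ⟨-, -, h1, -⟩ | ⟨h1, -⟩ | ⟨-, -, h1, -⟩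
      · exact h
      all_goals omega
    | upper s hs =>
      obtain ⟨h, ⟨-, hb⟩, rfl⟩ := hL.bijOn_edge.surjOn (Set.mem_Iio.2 hs)
      replace hb := Kind.isBlue_eq_true.1 hb
      refine ⟨h.1, ?_⟩
      rcases hf h.1 with ⟨-, hk, -⟩ | ⟨h', h1, -, -, -, h2⟩ | ⟨-, hk, -⟩ | ⟨-, -, -, hk, -⟩
      · exact absurd (hk.symm.trans hb) fun h => Kind.noConfusion h
      · obtain rfl : h' = h := Subtype.ext h1
        exact h2
      · exact absurd (hk.symm.trans hb) fun h => Kind.noConfusion h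
      · exact absurd (hk.symm.trans hb) fun h => Kind.noConfusion h
    | left k hk =>
      obtain ⟨v, -, rfl⟩ := hL.bijOn_node.surjOn (Set.mem_Iic.2 hk)
      obtain ⟨x, rfl, hx⟩ := hR.exists_mid v
      have hpos := hR.mid_pos (B.node x)
      refine ⟨x, ?_⟩
      rcases hf x with ⟨h1, -⟩ | ⟨-, -, -, h1, -⟩ | ⟨-, -, h⟩ | ⟨-, -, h1, -⟩
      · omega
      · omega
      · exact h
      · omega
    | lower s hs =>
      obtain ⟨h, -, hb, rfl⟩ := hL.exists_red hs
      have hb' : B.kind h.1 ≠ Kind.blue := fun h' => by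
        have := Kind.isBlue_eq_true.2 h'
        exact Bool.noConfusion (this.symm.trans hb)
      refine ⟨h.1, ?_⟩
      rcases hf h.1 with ⟨-, hk, -⟩ | ⟨-, -, -, -, hk, -⟩ | ⟨-, hk, -⟩ | ⟨h', h1, -, -, h2⟩
      · exact absurd hk h.2
      · exact absurd hk hb'
      · exact absurd hk h.2
      · obtain rfl : h' = h := Subtype.ext h1
        exact h2
  refine ⟨⟨Equiv.ofBijective f ⟨hinj, hsurj⟩, hkind, fun x => ?_, fun x => ?_⟩⟩
  · change (opened n (arcs n u d)).next (f x) = f (B.next x)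
    have hb : (f (B.next x)).black = (f x).black := by rw [hblack, hblack, node_next]
    have hmono : ∀ y z, B.node y = B.node z → rank y ≤ rank z → (f y).angle ≤ (f z).angle := by
      intro y z h1 h2
      rcases h2.eq_or_lt with h3 | h3
      · rw [hR.injective y z h1 h3]
      · exact (hangle y z h1 h3).le
    -- Being an increasing bijection at each node, `f` carries cyclic successors to cyclic
    -- successors, wrap-around included.
    refine opened_next_eq_iff.2 ⟨hb, ?_⟩
    rcases hR.next x with h1 | ⟨h1, h2⟩
    · refine Or.inl ⟨hangle _ _ (node_next x).symm (by omega), fun z hz hxz => ?_⟩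
      obtain ⟨z, rfl⟩ := hsurj z
      have h2 := hnode _ _ hz
      refine hmono _ _ ((node_next x).trans h2.symm) ?_
      by_contra! h3
      exact absurd (hmono z x h2 (by omega)) hxz.not_ge
    · refine Or.inr ⟨fun z hz => ?_, fun z hz => ?_⟩
      · obtain ⟨z, rfl⟩ := hsurj z
        exact hmono _ _ (hnode _ _ hz) (h2 z (hnode _ _ hz))
      · obtain ⟨z, rfl⟩ := hsurj z
        exact hmono _ _ ((node_next x).trans (hnode _ _ hz).symm) (by omega)
  · change (opened n (arcs n u d)).twin (f x) = f (B.twin x)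
    have htw : ∀ h : B.PlainHalf, ε ⟨B.twin h.1, hB.kind_twin_ne_bud h.2⟩ = ε h := fun h =>
      hL.label_twin h (Set.mem_univ h)
    rcases hf x with ⟨-, hk, h⟩ | ⟨h, rfl, -, -, hk, h'⟩ | ⟨-, hk, h⟩ | ⟨h, rfl, -, hk, h'⟩
    · rw [hB.twin_bud x hk, h, opened_twin_rightAt]
    · rw [h', opened_twin_upperAt]
      have hk2 := hB.twin_blue _ hk
      rcases hf (B.twin h.1) with ⟨-, hk', -⟩ | ⟨-, -, -, -, hk', -⟩ | ⟨-, hk', -⟩ |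
        ⟨k, h1, -, -, h2⟩
      · exact absurd (hk'.symm.trans hk2) fun h => Kind.noConfusion h
      · exact absurd (hk'.symm.trans hk2) fun h => Kind.noConfusion h
      · exact absurd (hk'.symm.trans hk2) fun h => Kind.noConfusion h
      · obtain rfl : k = ⟨B.twin h.1, hB.kind_twin_ne_bud h.2⟩ := Subtype.ext h1
        rw [h2]
        simp only [htw]
        rfl
    · rw [hB.twin_bud x hk, h, opened_twin_leftAt]
    · rw [h', opened_twin_lowerAt]
      have hk2 := hB.twin_red _ hk
      rcases hf (B.twin h.1) with ⟨-, hk', -⟩ | ⟨k, h1, -, -, -, h2⟩ | ⟨-, hk', -⟩ |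
        ⟨-, -, -, hk', -⟩
      · exact absurd (hk'.symm.trans hk2) fun h => Kind.noConfusion h
      · obtain rfl : k = ⟨B.twin h.1, hB.kind_twin_ne_bud h.2⟩ := Subtype.ext h1
        rw [h2]
        simp only [htw]
        rfl
      · exact absurd (hk'.symm.trans hk2) fun h => Kind.noConfusion h
      · exact absurd (hk'.symm.trans hk2) fun h => Kind.noConfusion h

theorem exists_gamma_eq {n : ℕ} {q : BudMapClass} (hq : q ∈ bicoloredBlossomingTrees n) :
    ∃ M ∈ meanderingTrees n, gamma n M = q := by
  obtain ⟨B, hB, rfl⟩ := hq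
  obtain ⟨M, hM, ⟨e⟩⟩ := hB.exists_iso
  exact ⟨M, hM, Quotient.sound ⟨e.symm⟩⟩

end TamariBlossom

/-! ### Assembly of the theorem -/

theorem mainTheorem1 (n : ℕ) (hn : 1 ≤ n) :
    Set.MapsTo (phi n) (tamariIntervals n) (meanderingTrees n) ∧
    Set.MapsTo (gamma n) (meanderingTrees n) (bicoloredBlossomingTrees n) ∧
    Set.MapsTo delta (bicoloredBlossomingTrees n) (meanderingTrees n) ∧
    Set.MapsTo (psi n) (meanderingTrees n) (tamariIntervals n) ∧
    Set.BijOn (Phi n) (tamariIntervals n) (bicoloredBlossomingTrees n) ∧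
    Set.InvOn (Psi n) (Phi n) (tamariIntervals n) (bicoloredBlossomingTrees n) := by
  have hphi : Set.MapsTo (phi n) (tamariIntervals n) (meanderingTrees n) :=
    fun _ hX => phi_mem_meanderingTrees hX
  have hgamma : Set.MapsTo (gamma n) (meanderingTrees n) (bicoloredBlossomingTrees n) :=
    fun _ hM => gamma_mem_bicoloredBlossomingTrees hM
  have hdelta : Set.MapsTo delta (bicoloredBlossomingTrees n) (meanderingTrees n) := by
    intro q hq
    -- By surjectivity of `gamma`, only openings have to be closed.
    obtain ⟨M, hM, rfl⟩ := exists_gamma_eq hq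
    rwa [delta_gamma hn hM]
  have hpsi : Set.MapsTo (psi n) (meanderingTrees n) (tamariIntervals n) := by
    intro M hM
    -- By surjectivity of `phi`, it is enough to know `psi` on the image of `phi`.
    obtain ⟨X, hX, rfl⟩ := exists_phi_eq hM
    rwa [psi_phi hX.1 hX.2.1]
  have hinv : Set.InvOn (Psi n) (Phi n) (tamariIntervals n) (bicoloredBlossomingTrees n) := by
    constructor
    · intro X hX
      change psi n (delta (gamma n (phi n X))) = X
      rw [delta_gamma hn (hphi hX), psi_phi hX.1 hX.2.1]
    · intro q hq
      obtain ⟨M, hM, rfl⟩ := exists_gamma_eq hq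
      obtain ⟨X, hX, rfl⟩ := exists_phi_eq hM
      change gamma n (phi n (psi n (delta (gamma n (phi n X))))) = gamma n (phi n X)
      rw [delta_gamma hn (hphi hX), psi_phi hX.1 hX.2.1]
  exact ⟨hphi, hgamma, hdelta, hpsi,
    hinv.bijOn (fun _ hX => hgamma (hphi hX)) fun _ hq => hpsi (hdelta hq), hinv⟩
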